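/- **Setting.** In a combinatorial auction, a set $M$ of $m$ items is to be allocated to an ordered set $N$ of $n$ bidders; bidder $i$ has a valuation $v_i\colon 2^M\to\mathbb R_{\ge 0}$ with $v_i(\emptyset)=0$ and $v_i(S)\le v_i(T)$ for $S\subseteq T$. The welfare of an allocation $(A_i)_{i\in N}$ of pairwise disjoint bundles is $\sum_i v_i(A_i)$, and the utility of a bidder is the value of the received bundle minus the payment. Bidders are accessed by value queries (given $S$, return $v_i(S)$) and demand queries (given a set $U\subseteq M$ of items for sale and prices $p$, return a bundle $S\subseteq U$ maximizing $v_i(S)-p(S)$, ties broken arbitrarily, where $p(S)=\sum_{e\in S}p_e$). A deterministic mechanism is truthful if answering truthfully is a dominant strategy of each bidder; a randomized mechanism is universally truthful if it is a distribution over truthful deterministic mechanisms. A valuation $v$ is subadditive if $v(S\cup T)\le v(S)+v(T)$, submodular if $v(S\cup T)+v(S\cap T)\le v(S)+v(T)$, and XOS if it is a maximum of finitely many additive functions with nonnegative coefficients. **Fixed-price auction.** Given prices $p$ and an ordered list of bidders, the bidders arrive in order, each takes a most demanded bundle at prices $p$ among the items still available, and pays its price. **Binary-search mechanism** for an ordered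 list of bidders and a scale $\psi\ge0$. Let $\beta$ be minimal with $2^\beta\ge 3\lceil\log_2 m\rceil+1$. Every item starts with the vector of candidate prices $(0,\psi/2^{2^\beta-1},\dots,\psi/4,\psi/2)$ of length $2^\beta$. Each bidder $i$ draws a round $r_i$, and a final round $r^\star$ is drawn, independently and uniformly from $\{1,\dots,\beta+1\}$. In round $\ell\le\beta$, an item with $k=2^{\beta-\ell+1}$ remaining candidate prices $b_1\le\dots\le b_k$ gets the price $b_{k/2+1}$, and a fixed-price auction of all items is run among the bidders with $r_i=\ell$ (in their order); the items sold keep the candidates $b_{k/2+1},\dots,b_k$, the others $b_1,\dots,b_{k/2}$. In round $\beta+1$ a fixed-price auction is run among the bidders with $r_i=\beta+1$ at the one remaining price of each item. The outcome is that of the auction of round $r^\star$; bidders of other rounds get nothing and pay nothing. **Theorem.** Consider the following mechanism. Each bidder is put into a set $N'$ independently with probability $\frac12$. With probability $\frac12$, the outcome is that of the second-price auction for the grand bundle $M$ among the bidders in $N'$ (the bidder with the highest reported value of $M$, the first one in case of ties, gets $M$ and pays the highest report of the others in $N'$, or $0$ if there are none). Otherwise, let $\psi$ be the highest reported value of $M$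 in $N'$ ($\psi=0$ if $N'=\emptyset$); the outcome is that of the binary-search mechanism with scale $\psi$ on the bidders in $N\setminus N'$. Then: 1. The outcome is always an allocation, and the mechanism is universally truthful (for all normalized monotone valuations). 2. The mechanism is computationally efficient: there is one program, for all $n$ and $m$, on a random access machine with natural and real numbers (addition, subtraction, halving, comparison), uniform random draws, and value and demand queries, whose random outcome has the distribution of the outcome of the mechanism however the bidders answer, and which in every run takes a number of steps that is polynomial in $n$ and $m$ and asks at most $n$ value and demand queries in total, at most one of each bidder. 3. There is a constant $C$ such that for all $n$, all $m\ge 3$, and all valuations, if the bidders answer truthfully, then the maximum welfare of an allocation is at most $C(\log\log m)^3$ times the expected welfare of the mechanism if all valuations are subadditive, and at most $C(\log\log m)^2$ times the expected welfare if all valuations are XOS, and also if all valuations are submodular. -/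

import Mathlib

open scoped NNReal

namespace CombinatorialAuction

/-! ## Valuations

There are `n` bidders `Fin n`, ordered by index, and `m` items `Fin m`. A bundle is a
`Finset (Fin m)`, and a valuation is a function from bundles to the nonnegative reals. -/

section Valuations

variable {n m : ℕ}

/-- The standing assumption on valuations: normalized and monotone. -/
structure IsValuation (v : Finset (Fin m) → ℝ≥0) : Prop where
  empty : v ∅ = 0
  mono : ∀ S T : Finset (Fin m), S ⊆ T → v S ≤ v T

def IsSubadditive (v : Finset (Fin m) → ℝ≥0) : Prop :=
  ∀ S T : Finset (Fin m), v (S ∪ T) ≤ v S + v T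

/-- XOS: a pointwise maximum of finitely many additive functions. -/
def IsXOS (v : Finset (Fin m) → ℝ≥0) : Prop :=
  ∃ F : Finset (Fin m → ℝ≥0), F.Nonempty ∧
    ∀ S : Finset (Fin m), v S = F.sup (fun a => ∑ e ∈ S, a e)

def IsSubmodular (v : Finset (Fin m) → ℝ≥0) : Prop :=
  ∀ S T : Finset (Fin m), v (S ∪ T) + v (S ∩ T) ≤ v S + v T

/-- `A i` is the bundle of bidder `i`; no item is given to two bidders. -/
def IsAllocation (A : Fin n → Finset (Fin m)) : Prop :=
  ∀ i j : Fin n, i ≠ j → Disjoint (A i) (A j)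

/-- Social welfare of an allocation. -/
noncomputable def welfare (v : Fin n → Finset (Fin m) → ℝ≥0) (A : Fin n → Finset (Fin m)) : ℝ :=
  ∑ i, (v i (A i) : ℝ)

/-- The optimal welfare (a maximum over the finite nonempty set of allocations). -/
noncomputable def optimalWelfare (v : Fin n → Finset (Fin m) → ℝ≥0) : ℝ :=
  ⨆ A : {A : Fin n → Finset (Fin m) // IsAllocation A}, welfare v A.1

end Valuations

/-! ## Queries, mechanisms, truthfulness -/

section Mechanisms

variable {n m : ℕ}

/-- How a bidder answers queries, truthfully or not. A value query names a bundle and is answered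
by a nonnegative number. A demand query offers a set `U` of items at prices `p` (items outside `U`
are not for sale, that is, have price infinity) and is answered by a bundle of offered items. -/
structure Strategy (m : ℕ) where
  value : Finset (Fin m) → ℝ≥0
  demand : Finset (Fin m) → (Fin m → ℝ) → Finset (Fin m)
  demand_subset : ∀ U p, demand U p ⊆ U

/-- All queries are answered according to the valuation `v`: value queries by the value, demand
queries by some (arbitrary) most demanded bundle. -/
def Strategy.IsTruthful (τ : Strategy m) (v : Finset (Fin m) → ℝ≥0) : Prop :=
  (∀ S, τ.value S = v S) ∧
    ∀ (U : Finset (Fin m)) (p : Fin m → ℝ), ∀ S ⊆ U,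
      (v S : ℝ) - ∑ e ∈ S, p e ≤ (v (τ.demand U p) : ℝ) - ∑ e ∈ τ.demand U p, p e

/-- The outcome of a mechanism: bundles and payments. -/
structure Outcome (n m : ℕ) where
  alloc : Fin n → Finset (Fin m)
  pay : Fin n → ℝ

/-- Quasi-linear utility of bidder `i` with valuation `v`. -/
noncomputable def utility (v : Finset (Fin m) → ℝ≥0) (i : Fin n) (o : Outcome n m) : ℝ :=
  (v (o.alloc i) : ℝ) - o.pay i

/-- A deterministic mechanism maps the bidders' ways of answering queries to an outcome. It is
truthful if answering truthfully is a dominant strategy: whatever the other bidders do, any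
strategy `σ i` of bidder `i` is no better than any truthful strategy `τ`. -/
def IsTruthfulMechanism (f : (Fin n → Strategy m) → Outcome n m) : Prop :=
  ∀ (i : Fin n) (v : Finset (Fin m) → ℝ≥0), IsValuation v →
    ∀ τ : Strategy m, τ.IsTruthful v → ∀ σ : Fin n → Strategy m,
      utility v i (f σ) ≤ utility v i (f (Function.update σ i τ))

/-- A randomized mechanism: a deterministic mechanism for each value of a uniformly random seed. -/
structure RandomizedMechanism (n m : ℕ) where
  Seed : Type
  [fintype : Fintype Seed]
  [nonempty : Nonempty Seed]
  outcome : Seed → (Fin n → Strategy m) → Outcome n m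

attribute [instance] RandomizedMechanism.fintype RandomizedMechanism.nonempty

/-- Every outcome is an allocation, whatever the bidders answer. -/
def RandomizedMechanism.IsFeasible (M : RandomizedMechanism n m) : Prop :=
  ∀ s σ, IsAllocation (M.outcome s σ).alloc

/-- A distribution over truthful deterministic mechanisms. -/
def RandomizedMechanism.IsUniversallyTruthful (M : RandomizedMechanism n m) : Prop :=
  ∀ s, IsTruthfulMechanism (M.outcome s)

/-- Expected welfare, for valuations `v`, when the bidders answer according to `σ`. -/
noncomputable def RandomizedMechanism.expectedWelfare (M : RandomizedMechanism n m)
    (v : Fin n → Finset (Fin m) → ℝ≥0) (σ : Fin n → Strategy m) : ℝ :=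
  (∑ s : M.Seed, welfare v (M.outcome s σ).alloc) / Fintype.card M.Seed

end Mechanisms

/-! ## The mechanism -/

section TheMechanism

variable {n m : ℕ}

open Classical in
/-- Second-price auction for the grand bundle among the bidders in `N`: the highest bidder wins
(ties go to the smaller index) and pays the highest bid of the others (zero if there are none). -/
noncomputable def secondPriceAuction (N : Finset (Fin n)) (bid : Fin n → ℝ≥0) : Outcome n m :=
  let wins : Fin n → Prop := fun i =>
    i ∈ N ∧ ∀ j ∈ N, bid j < bid i ∨ (bid j = bid i ∧ i ≤ j)
  { alloc := fun i => if wins i then Finset.univ else ∅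
    pay := fun i => if wins i then (((N.erase i).sup bid : ℝ≥0) : ℝ) else 0 }

/-- The fixed-price auction: the bidders in the list `N` arrive in order, and each takes a most
demanded bundle, at prices `p`, of the items still available; `U` are the items at the start. -/
def fixedPriceAuction (σ : Fin n → Strategy m) (p : Fin m → ℝ) :
    List (Fin n) → Finset (Fin m) → Fin n → Finset (Fin m)
  | [], _ => fun _ => ∅
  | i :: N, U =>
      Function.update (fixedPriceAuction σ p N (U \ (σ i).demand U p)) i ((σ i).demand U p)

/-- The number `β` of search rounds: `2 ^ β` is the least power of two that is at least
`3 * ⌈log₂ m⌉ + 1`. -/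
def searchRounds (m : ℕ) : ℕ := Nat.clog 2 (3 * Nat.clog 2 m + 1)

/-- The increasing vector of the `2 ^ β` candidate prices `0, ψ / 2 ^ (2 ^ β - 1), …, ψ / 4, ψ / 2`,
indexed by `j = 0, …, 2 ^ β - 1`. It contains `0` and `ψ / 2 ^ k` for `1 ≤ k ≤ 3 * ⌈log₂ m⌉`,
padded by smaller numbers so that its length is a power of two. -/
noncomputable def candidatePrice (m : ℕ) (ψ : ℝ) (j : ℕ) : ℝ :=
  if j = 0 then 0 else ψ / 2 ^ (2 ^ searchRounds m - j)

/-- Price of item `e` in round `ℓ` (rounds are `0, …, β`), if `2 ^ (β - ℓ)` candidates remain for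
it, of which the first has index `low e`: the middle candidate, or the only one if `ℓ = β`. -/
noncomputable def roundPrice (ψ : ℝ) (ℓ : ℕ) (low : Fin m → ℕ) (e : Fin m) : ℝ :=
  candidatePrice m ψ (low e + 2 ^ (searchRounds m - ℓ) / 2)

/-- The bidders of `N` that take part in round `ℓ`, in the same order. -/
def roundBidders (N : List (Fin n)) (r : Fin n → Fin (searchRounds m + 1)) (ℓ : ℕ) :
    List (Fin n) :=
  N.filter (fun i => (r i : ℕ) = ℓ)

open Classical in
/-- Index of the first remaining candidate price of each item at the start of round `ℓ`. In each
round the upper half of the remaining candidates is kept for the items that were sold in that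
round, and the lower half for the others. -/
noncomputable def lowIndex (σ : Fin n → Strategy m) (N : List (Fin n)) (ψ : ℝ)
    (r : Fin n → Fin (searchRounds m + 1)) : ℕ → Fin m → ℕ
  | 0 => fun _ => 0
  | ℓ + 1 => fun e =>
      let low := lowIndex σ N ψ r ℓ
      if ∃ i, e ∈ fixedPriceAuction σ (roundPrice ψ ℓ low) (roundBidders N r ℓ) Finset.univ i then
        low e + 2 ^ (searchRounds m - ℓ) / 2
      else low e

/-- The binary-search mechanism for the bidders in `N` and scale `ψ`: bidder `i` takes part in the
fixed-price auction of round `r i`, and the auction of round `rstar` gives the final allocation,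
for which the bidders pay the prices of that round. -/
noncomputable def binarySearchMechanism (σ : Fin n → Strategy m) (N : List (Fin n)) (ψ : ℝ)
    (r : Fin n → Fin (searchRounds m + 1)) (rstar : Fin (searchRounds m + 1)) : Outcome n m :=
  let p : Fin m → ℝ := roundPrice ψ rstar (lowIndex σ N ψ r rstar)
  let A := fixedPriceAuction σ p (roundBidders N r rstar) Finset.univ
  { alloc := A
    pay := fun i => ∑ e ∈ A i, p e }

/-- The final mechanism. The uniform seed is a tuple `(h, c, r, rstar)` of independent uniform
choices: `h i` tells whether bidder `i` is split off, the coin `c` tells whether the second-price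
auction among the split-off bidders is the final outcome, and `r`, `rstar` are the random rounds of
the binary-search mechanism, which is run on the other bidders, the scale being the highest value
(zero if there is none) that a split-off bidder reports for the grand bundle. -/
noncomputable def finalMechanism (n m : ℕ) : RandomizedMechanism n m where
  Seed := (Fin n → Bool) × Bool × (Fin n → Fin (searchRounds m + 1)) × Fin (searchRounds m + 1)
  outcome := fun ⟨h, c, r, rstar⟩ σ =>
    let bid : Fin n → ℝ≥0 := fun i => (σ i).value Finset.univ
    let N : Finset (Fin n) := Finset.univ.filter (fun i => h i = true)
    if c = true then secondPriceAuction N bid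
    else binarySearchMechanism σ ((List.finRange n).filter (fun i => h i = false))
      ((N.sup bid : ℝ≥0) : ℝ) r rstar

end TheMechanism

/-! ## Programs with a step count

A random access machine with finitely many named arrays of natural numbers and of reals, random
draws and queries. Natural numbers and reals can be added, subtracted, halved and compared, so the
lengths of the numbers grow by a bounded amount per step. Loops are counted, so every program halts;
the steps are counted explicitly. -/

section Programs

inductive NatExpr : Type
  | lit (c : ℕ)
  | get (a : ℕ) (i : NatExpr)
  | add (x y : NatExpr)
  | sub (x y : NatExpr)
  | half (x : NatExpr)

inductive RealExpr : Type
  | zero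
  | get (a : ℕ) (i : NatExpr)
  | add (x y : RealExpr)
  | sub (x y : RealExpr)
  | half (x : RealExpr)

inductive Test : Type
  | natLE (x y : NatExpr)
  | realLE (x y : RealExpr)

inductive Program : Type
  | skip
  | setNat (a : ℕ) (i x : NatExpr)
  | setReal (a : ℕ) (i : NatExpr) (x : RealExpr)
  /-- Store a uniform draw from `{0, …, k}` in cell `i` of the number array `a`. -/
  | draw (a : ℕ) (i k : NatExpr)
  /-- Ask bidder `b` for the value of the bundle whose indicator is stored in the number array `S`;
  store the answer in cell `i` of the real array `a`. -/
  | askValue (b : NatExpr) (S : ℕ) (a : ℕ) (i : NatExpr)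
  /-- Ask bidder `b` for a demanded bundle, the offered items being given by an indicator in the
  number array `U` and the prices by the real array `p`; store the indicator of the answer in the
  number array `A`. -/
  | askDemand (b : NatExpr) (U p A : ℕ)
  | seq (P Q : Program)
  | cond (t : Test) (P Q : Program)
  /-- Run `P` for `0, …, k - 1`, the current value being in cell `0` of the number array `x`. -/
  | loop (x : ℕ) (k : NatExpr) (P : Program)

/-- Contents of the arrays, the number of steps so far, and the number of queries so far that each
bidder was asked. -/
structure Memory where
  nat : ℕ → ℕ → ℕ
  real : ℕ → ℕ → ℝ
  steps : ℕ
  queries : ℕ → ℕ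

def NatExpr.eval (μ : Memory) : NatExpr → ℕ
  | .lit c => c
  | .get a i => μ.nat a (i.eval μ)
  | .add x y => x.eval μ + y.eval μ
  | .sub x y => x.eval μ - y.eval μ
  | .half x => x.eval μ / 2

noncomputable def RealExpr.eval (μ : Memory) : RealExpr → ℝ
  | .zero => 0
  | .get a i => μ.real a (i.eval μ)
  | .add x y => x.eval μ + y.eval μ
  | .sub x y => x.eval μ - y.eval μ
  | .half x => x.eval μ / 2

def Test.Holds (μ : Memory) : Test → Prop
  | .natLE x y => x.eval μ ≤ y.eval μ
  | .realLE x y => x.eval μ ≤ y.eval μ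

def Memory.tick (μ : Memory) (c : ℕ) : Memory :=
  { μ with steps := μ.steps + c }

def Memory.countQuery (μ : Memory) (b : ℕ) : Memory :=
  { μ with queries := Function.update μ.queries b (μ.queries b + 1) }

def Memory.setNat (μ : Memory) (a i x : ℕ) : Memory :=
  { μ with nat := Function.update μ.nat a (Function.update (μ.nat a) i x) }

def Memory.setReal (μ : Memory) (a i : ℕ) (x : ℝ) : Memory :=
  { μ with real := Function.update μ.real a (Function.update (μ.real a) i x) }

/-- The bundle whose indicator is stored in the first `m` cells of the number array `a`. -/
def Memory.bundle (μ : Memory) (m a : ℕ) : Finset (Fin m) :=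
  Finset.univ.filter (fun e : Fin m => μ.nat a e ≠ 0)

/-- Store the indicator of a bundle in the first `m` cells of the number array `a`. -/
def Memory.setBundle (μ : Memory) {m : ℕ} (a : ℕ) (S : Finset (Fin m)) : Memory :=
  { μ with
    nat := Function.update μ.nat a
      (fun e => if h : e < m then (if (⟨e, h⟩ : Fin m) ∈ S then 1 else 0) else μ.nat a e) }

noncomputable def iterate (f : ℕ → Memory → PMF Memory) : ℕ → Memory → PMF Memory
  | 0, μ => PMF.pure μ
  | k + 1, μ => (iterate f k μ).bind (f k)

variable {n m : ℕ}

open Classical in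
/-- Distribution of the memory after a run, the bidders answering according to `σ`. An instruction
costs one step (expressions have constant size, as the program is fixed), a query `m + 1` steps. -/
noncomputable def Program.exec (σ : Fin n → Strategy m) : Program → Memory → PMF Memory
  | .skip, μ => PMF.pure (μ.tick 1)
  | .setNat a i x, μ => PMF.pure ((μ.tick 1).setNat a (i.eval μ) (x.eval μ))
  | .setReal a i x, μ => PMF.pure ((μ.tick 1).setReal a (i.eval μ) (x.eval μ))
  | .draw a i k, μ =>
      (PMF.uniformOfFintype (Fin (k.eval μ + 1))).map
        (fun d => (μ.tick 1).setNat a (i.eval μ) d)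
  | .askValue b S a i, μ =>
      PMF.pure (((μ.tick (m + 1)).countQuery (b.eval μ)).setReal a (i.eval μ)
        (if h : b.eval μ < n then ((σ ⟨b.eval μ, h⟩).value (μ.bundle m S) : ℝ) else 0))
  | .askDemand b U p A, μ =>
      PMF.pure (((μ.tick (m + 1)).countQuery (b.eval μ)).setBundle A
        (if h : b.eval μ < n then
          (σ ⟨b.eval μ, h⟩).demand (μ.bundle m U) (fun e => μ.real p e) else ∅))
  | .seq P Q, μ => (P.exec σ μ).bind (fun ν => Q.exec σ ν)
  | .cond t P Q, μ => if t.Holds μ then P.exec σ (μ.tick 1) else Q.exec σ (μ.tick 1)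
  | .loop x k P, μ =>
      iterate (fun j ν => P.exec σ ((ν.tick 1).setNat x 0 j)) (k.eval μ) (μ.tick 1)

/-- Input: cell `0` of the number arrays `0` and `1` holds `n` and `m`; all other cells are zero. -/
def Memory.initial (n m : ℕ) : Memory where
  nat := fun a i => if i = 0 then (if a = 0 then n else if a = 1 then m else 0) else 0
  real := fun _ _ => 0
  steps := 0
  queries := fun _ => 0

/-- Output: cell `e` of the number array `2` holds `i + 1` if item `e` goes to bidder `i` (any other
number if nobody gets it), cell `i` of the real array `0` holds the payment of bidder `i`. -/
def Memory.outcome (n m : ℕ) (μ : Memory) : Outcome n m where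
  alloc := fun i => Finset.univ.filter (fun e : Fin m => μ.nat 2 e = (i : ℕ) + 1)
  pay := fun i => μ.real 0 i

/-- Distribution of the memory at the end of a run of `P` for `n` bidders and `m` items. -/
noncomputable def Program.run (P : Program) (σ : Fin n → Strategy m) : PMF Memory :=
  P.exec σ (Memory.initial n m)

/-- The program plays the mechanism: whatever the bidders do, its random outcome has the same
distribution as that of the mechanism. -/
def Program.Implements (P : Program) (M : RandomizedMechanism n m) : Prop :=
  ∀ σ : Fin n → Strategy m,
    (P.run σ).map (Memory.outcome n m) =
      (PMF.uniformOfFintype M.Seed).map (fun s => M.outcome s σ)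

/-- In every run each bidder is asked at most one (value or demand) query, and at most `n` queries
are asked in total. -/
def Program.UsesFewQueries (P : Program) (n m : ℕ) : Prop :=
  ∀ σ : Fin n → Strategy m, ∀ μ ∈ (P.run σ).support,
    (∀ i : Fin n, μ.queries i ≤ 1) ∧ ∑ i : Fin n, μ.queries i ≤ n

/-- One program for all `n` and `m`, every run of which ends within polynomially many steps. -/
def Program.IsPolynomialTime (P : Program) : Prop :=
  ∃ c k : ℕ, ∀ (n m : ℕ) (σ : Fin n → Strategy m), ∀ μ ∈ (P.run σ).support,
    μ.steps ≤ c * (n + m + 1) ^ k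

end Programs

end CombinatorialAuction

open CombinatorialAuction

namespace CombinatorialAuction

/-! ## Fixed-price auctions -/

section Auctions

variable {n m : ℕ}

/-! Truthfulness. Each bidder's answers can affect that bidder's own utility in one place only. A
split-off bidder can win only in the second-price auction; otherwise the bid merely sets the scale
of an auction from which this bidder gets nothing. Any other bidder acts in one round, at prices
fixed by earlier rounds (`lowIndex_congr`) and on a set of items fixed by the predecessors in that
round (`fixedPriceAuction_append`), so a truthful demand answer is optimal.

Welfare rests on supporting prices (`HasSupportingPrices`): a random subset `S` of a bundle `U` and
item prices such that, whatever part `T` of `U` is lost, the expected utility of `S \ T` plus the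
price of `T` is at least `w`. If `v` is XOS or submodular, an additive function below `v` that is
tight on `U`, halved, gives `w = v U / 2`. If `v` is subadditive, suppose that quality `c` is
impossible. Then by linear programming duality every lottery with marginals at most `q` can be
intersected with an independent one so that the marginals drop to `q * q` and at most `c` is lost.
After `k` squarings the lottery is too sparse to keep a quarter of `v U`, so `c = v U / (4 * k + 1)`
is possible once `4 * m ≤ 2 ^ 2 ^ k` (`IsSubadditive.hasSupportingPrices`).

Binary search. Fix a bidder `i`, the target bundle in an optimal allocation, and the supporting
prices rounded down to candidates `q e`. For each item, either some round sells it for at least `q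
e`, or some round leaves it unsold at a price of at most `q e`, or its last price is exactly `q e`
(`sold_or_unsold_or_correct`). Items of the first kind are paid for by revenue. Every other item is
available to `i` at a price of at most `q e` in some round, so by subadditivity the utilities of `i`
over all possible own rounds cover their share (`le_utilities_add_revenue`). This counterfactual is
sound because a bidder placed in round `ℓ` or later does not influence the prices of round `ℓ`.
Averaging over the own round costs a factor `β + 1`, and the random final round costs another.

Scale. With probability 1/2 the bidder `t` with the highest value of the grand bundle is split off.
Then the scale is that value, the second-price auction earns it, which also absorbs the rounding
error, and each other bidder still takes part in the search with conditional probability 1/2. The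
total loss is `16 * b * (β + 1) ^ 2` for supporting prices of quality `v U / b`, where `b = 2` or `b
= 4 * β + 1` and `β = O(log log m)`.

Program. Only `drawProgram` is random; everything else is deterministic and is verified by loop
invariants for `Program.det`, together with frame rules for arrays that are not written. Reordering
the draws gives the seed of the mechanism (`seedEquiv`). -/

/-- The items that are left over by the bidders of a list in a fixed-price auction. -/
def remainingItems (σ : Fin n → Strategy m) (p : Fin m → ℝ) :
    List (Fin n) → Finset (Fin m) → Finset (Fin m)
  | [], U => U
  | i :: N, U => remainingItems σ p N (U \ (σ i).demand U p)

theorem fixedPriceAuction_subset (σ : Fin n → Strategy m) (p : Fin m → ℝ) (L : List (Fin n))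
    (U : Finset (Fin m)) (i : Fin n) : fixedPriceAuction σ p L U i ⊆ U := by
  induction L generalizing U with
  | nil => simp [fixedPriceAuction]
  | cons j L ih =>
    by_cases h : i = j
    · subst h
      simpa [fixedPriceAuction] using (σ i).demand_subset U p
    · simpa [fixedPriceAuction, Function.update_of_ne h] using
        (ih (U \ (σ j).demand U p)).trans Finset.sdiff_subset

theorem fixedPriceAuction_of_notMem (σ : Fin n → Strategy m) (p : Fin m → ℝ) {L : List (Fin n)}
    (U : Finset (Fin m)) {i : Fin n} (h : i ∉ L) : fixedPriceAuction σ p L U i = ∅ := by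
  induction L generalizing U with
  | nil => simp [fixedPriceAuction]
  | cons j L ih =>
    obtain ⟨h1, h2⟩ := not_or.1 (fun hh => h (List.mem_cons.2 hh))
    simpa [fixedPriceAuction, Function.update_of_ne h1] using ih _ h2

theorem fixedPriceAuction_isAllocation (σ : Fin n → Strategy m) (p : Fin m → ℝ)
    (L : List (Fin n)) (U : Finset (Fin m)) : IsAllocation (fixedPriceAuction σ p L U) := by
  induction L generalizing U with
  | nil => intro i j _; simp [fixedPriceAuction]
  | cons k L ih =>
    intro i j hij
    have key : ∀ l, l ≠ k → Disjoint ((σ k).demand U p)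
        (fixedPriceAuction σ p L (U \ (σ k).demand U p) l) := fun l _ =>
      Finset.disjoint_left.2 fun e he he' =>
        (Finset.mem_sdiff.1 (fixedPriceAuction_subset σ p L _ l he')).2 he
    by_cases hi : i = k
    · subst hi
      simpa [fixedPriceAuction, Function.update_of_ne hij.symm] using key j hij.symm
    · by_cases hj : j = k
      · subst hj
        simpa [fixedPriceAuction, Function.update_of_ne hi] using (key i hi).symm
      · simpa [fixedPriceAuction, Function.update_of_ne hi, Function.update_of_ne hj] using
          ih _ i j hij

theorem fixedPriceAuction_congr {σ σ' : Fin n → Strategy m} (p : Fin m → ℝ) {L : List (Fin n)}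
    (U : Finset (Fin m)) (h : ∀ j ∈ L, σ j = σ' j) :
    fixedPriceAuction σ p L U = fixedPriceAuction σ' p L U := by
  induction L generalizing U with
  | nil => rfl
  | cons j L ih =>
    simp only [List.mem_cons, forall_eq_or_imp] at h
    simp only [fixedPriceAuction, h.1, ih _ h.2]

theorem remainingItems_congr {σ σ' : Fin n → Strategy m} (p : Fin m → ℝ) {L : List (Fin n)}
    (U : Finset (Fin m)) (h : ∀ j ∈ L, σ j = σ' j) :
    remainingItems σ p L U = remainingItems σ' p L U := by
  induction L generalizing U with
  | nil => rfl
  | cons j L ih =>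
    simp only [List.mem_cons, forall_eq_or_imp] at h
    simp only [remainingItems, h.1, ih _ h.2]

/-- The offer to a bidder is determined by the predecessors alone; truthfulness and the comparison
of rounds both use this. -/
theorem fixedPriceAuction_append (σ : Fin n → Strategy m) (p : Fin m → ℝ) {L₁ : List (Fin n)}
    (L₂ : List (Fin n)) (U : Finset (Fin m)) {i : Fin n} (h : i ∉ L₁) :
    fixedPriceAuction σ p (L₁ ++ i :: L₂) U i = (σ i).demand (remainingItems σ p L₁ U) p := by
  induction L₁ generalizing U with
  | nil => simp [fixedPriceAuction, remainingItems]
  | cons j L ih =>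
    obtain ⟨h1, h2⟩ := not_or.1 (fun hh => h (List.mem_cons.2 hh))
    simpa [fixedPriceAuction, remainingItems, Function.update_of_ne h1] using ih _ h2

/-- `Nodup` matters: if a bidder came twice, the outer `Function.update` would discard the bundle
taken at the later visit. -/
theorem exists_sold_of_notMem_remainingItems (σ : Fin n → Strategy m) (p : Fin m → ℝ)
    {L₁ L₂ : List (Fin n)} (U : Finset (Fin m)) (hL : (L₁ ++ L₂).Nodup) {e : Fin m} (he : e ∈ U)
    (h : e ∉ remainingItems σ p L₁ U) : ∃ i, e ∈ fixedPriceAuction σ p (L₁ ++ L₂) U i := by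
  induction L₁ generalizing U with
  | nil => exact absurd he h
  | cons j L ih =>
    rw [List.cons_append, List.nodup_cons] at hL
    by_cases hD : e ∈ (σ j).demand U p
    · exact ⟨j, by simpa [fixedPriceAuction] using hD⟩
    · obtain ⟨i, hi⟩ := ih _ hL.2 (Finset.mem_sdiff.2 ⟨he, hD⟩) h
      have hij : i ≠ j := by
        rintro rfl
        rw [fixedPriceAuction_of_notMem σ p _ hL.1] at hi
        simp at hi
      exact ⟨i, by simpa [fixedPriceAuction, Function.update_of_ne hij] using hi⟩

/-- Prices of a round depend only on who acts, and how, in strictly earlier rounds. It is applied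
once to a changed strategy and once to a changed round of a bidder. -/
theorem lowIndex_congr {σ σ' : Fin n → Strategy m} (N : List (Fin n)) (ψ : ℝ)
    {r r' : Fin n → Fin (searchRounds m + 1)} {ℓ : ℕ}
    (hr : ∀ k < ℓ, roundBidders N r k = roundBidders N r' k)
    (hσ : ∀ k < ℓ, ∀ j ∈ roundBidders N r k, σ j = σ' j) :
    lowIndex σ N ψ r ℓ = lowIndex σ' N ψ r' ℓ := by
  induction ℓ with
  | zero => rfl
  | succ ℓ ih =>
    have ih' := ih (fun k hk => hr k (by omega)) (fun k hk => hσ k (by omega))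
    funext e
    simp only [lowIndex]
    rw [ih', ← hr ℓ (by omega), fixedPriceAuction_congr _ _ (hσ ℓ (by omega))]

theorem mem_roundBidders {N : List (Fin n)} {r : Fin n → Fin (searchRounds m + 1)} {ℓ : ℕ}
    {i : Fin n} : i ∈ roundBidders N r ℓ ↔ i ∈ N ∧ (r i : ℕ) = ℓ := by
  simp [roundBidders]

theorem roundBidders_nodup {N : List (Fin n)} (hN : N.Nodup)
    (r : Fin n → Fin (searchRounds m + 1)) (ℓ : ℕ) : (roundBidders N r ℓ).Nodup :=
  hN.filter _

theorem secondPriceAuction_isAllocation (N : Finset (Fin n)) (bid : Fin n → ℝ≥0) :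
    IsAllocation (secondPriceAuction (m := m) N bid).alloc := by
  intro i j hij
  simp only [secondPriceAuction]
  split_ifs with h1 h2
  · exfalso
    rcases h1.2 j h2.1 with h | h <;> rcases h2.2 i h1.1 with h' | h'
    · exact lt_asymm h h'
    · exact h.ne h'.1.symm
    · exact h'.ne h.1.symm
    · exact hij (le_antisymm h.2 h'.2)
  all_goals simp

theorem finalMechanism_isFeasible (n m : ℕ) : (finalMechanism n m).IsFeasible := by
  rintro ⟨h, c, r, rstar⟩ σ
  simp only [finalMechanism]
  split_ifs
  · exact secondPriceAuction_isAllocation _ _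
  · exact fixedPriceAuction_isAllocation _ _ _ _

/-! ## Truthfulness -/

theorem utility_secondPriceAuction_of_notMem {N : Finset (Fin n)} {bid : Fin n → ℝ≥0} {i : Fin n}
    (hi : i ∉ N) {v : Finset (Fin m) → ℝ≥0} (hv : IsValuation v) :
    utility v i (secondPriceAuction N bid) = 0 := by
  simp [utility, secondPriceAuction, hi, hv.empty]

/-- The price of winning does not involve the own bid, and a truthful bid wins when the value
exceeds this price and never wins when it is below. -/
theorem secondPriceAuction_truthful (N : Finset (Fin n)) (bid : Fin n → ℝ≥0) (i : Fin n)
    {v : Finset (Fin m) → ℝ≥0} (hv : IsValuation v) :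
    utility v i (secondPriceAuction N bid) ≤
      utility v i (secondPriceAuction N (Function.update bid i (v Finset.univ))) := by
  by_cases hi : i ∈ N
  swap
  · rw [utility_secondPriceAuction_of_notMem hi hv, utility_secondPriceAuction_of_notMem hi hv]
  have hsup : (N.erase i).sup (Function.update bid i (v Finset.univ)) = (N.erase i).sup bid :=
    Finset.sup_congr rfl fun j hj => Function.update_of_ne (Finset.ne_of_mem_erase hj) _ _
  simp only [utility, secondPriceAuction, hsup]
  have hle : ∀ b : Fin n → ℝ≥0, (∀ j ∈ N, b j < b i ∨ (b j = b i ∧ i ≤ j)) →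
      (N.erase i).sup b ≤ b i := fun b hb => Finset.sup_le fun j hj => by
    rcases hb j (Finset.mem_of_mem_erase hj) with h | h
    · exact h.le
    · exact h.1.le
  split_ifs with h1 h2 h2
  · exact le_rfl
  · have : (v Finset.univ : ℝ) ≤ ((N.erase i).sup bid : ℝ≥0) := by
      rw [NNReal.coe_le_coe]
      by_contra hcon
      push Not at hcon
      refine h2 ⟨hi, fun j hj => ?_⟩
      by_cases hji : j = i
      · subst hji; exact Or.inr ⟨rfl, le_rfl⟩
      · left
        rw [Function.update_of_ne hji, Function.update_self]
        exact (Finset.le_sup (Finset.mem_erase.2 ⟨hji, hj⟩)).trans_lt hcon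
    simp only [hv.empty, NNReal.coe_zero]
    linarith
  · have := hle _ h2.2
    rw [hsup, Function.update_self, ← NNReal.coe_le_coe] at this
    simp only [hv.empty, NNReal.coe_zero]
    linarith
  · exact le_rfl

theorem utility_binarySearchMechanism_of_notMem {σ : Fin n → Strategy m} {N : List (Fin n)} {ψ : ℝ}
    {r : Fin n → Fin (searchRounds m + 1)} {rstar : Fin (searchRounds m + 1)} {i : Fin n}
    (hi : ¬ (i ∈ N ∧ r i = rstar)) {v : Finset (Fin m) → ℝ≥0} (hv : IsValuation v) :
    utility v i (binarySearchMechanism σ N ψ r rstar) = 0 := by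
  have : i ∉ roundBidders N r rstar := fun h =>
    hi ⟨(mem_roundBidders.1 h).1, Fin.ext (mem_roundBidders.1 h).2⟩
  simp [utility, binarySearchMechanism, fixedPriceAuction_of_notMem _ _ _ this, hv.empty]

theorem binarySearchMechanism_truthful (σ : Fin n → Strategy m) {N : List (Fin n)} (hN : N.Nodup)
    (ψ : ℝ) (r : Fin n → Fin (searchRounds m + 1)) (rstar : Fin (searchRounds m + 1)) (i : Fin n)
    {v : Finset (Fin m) → ℝ≥0} (hv : IsValuation v) {τ : Strategy m} (hτ : τ.IsTruthful v) :
    utility v i (binarySearchMechanism σ N ψ r rstar) ≤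
      utility v i (binarySearchMechanism (Function.update σ i τ) N ψ r rstar) := by
  by_cases hi : i ∈ N ∧ r i = rstar
  swap
  · rw [utility_binarySearchMechanism_of_notMem hi hv, utility_binarySearchMechanism_of_notMem hi hv]
  obtain ⟨L₁, L₂, hL⟩ := List.append_of_mem (mem_roundBidders.2 ⟨hi.1, by rw [hi.2]⟩ :
    i ∈ roundBidders N r rstar)
  have hnd := roundBidders_nodup hN r rstar
  rw [hL] at hnd
  have hiL : i ∉ L₁ := fun h => by
    have := List.disjoint_of_nodup_append hnd h
    simp at this
  -- Bidder `i` acts in round `rstar` only, so the earlier rounds, and hence the prices, ignore the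
  -- strategy of `i`.
  have hlow : lowIndex (Function.update σ i τ) N ψ r rstar = lowIndex σ N ψ r rstar := by
    refine lowIndex_congr N ψ (fun _ _ => rfl) fun k hk j hj => Function.update_of_ne ?_ _ _
    rintro rfl
    have := (mem_roundBidders.1 hj).2
    rw [hi.2] at this
    omega
  have hrem : ∀ p U, remainingItems (Function.update σ i τ) p L₁ U = remainingItems σ p L₁ U :=
    fun p U => remainingItems_congr p U fun j hj => Function.update_of_ne
      (by rintro rfl; exact hiL hj) _ _
  simp only [utility, binarySearchMechanism, hlow, hL, fixedPriceAuction_append _ _ _ _ hiL, hrem,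
    Function.update_self]
  exact hτ.2 _ _ _ ((σ i).demand_subset _ _)

theorem finalMechanism_isUniversallyTruthful (n m : ℕ) :
    (finalMechanism n m).IsUniversallyTruthful := by
  rintro ⟨h, c, r, rstar⟩ i v hv τ hτ σ
  have hbid : (fun j => (Function.update σ i τ j).value Finset.univ) =
      Function.update (fun j => (σ j).value Finset.univ) i (v Finset.univ) := by
    funext j
    by_cases hj : j = i
    · subst hj; simp [hτ.1]
    · simp [Function.update_of_ne hj]
  simp only [finalMechanism, hbid]
  split_ifs with hc
  · exact secondPriceAuction_truthful _ _ i hv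
  -- A split-off bidder may change the scale but gets nothing from the search; for any other bidder
  -- the scale is out of reach.
  · by_cases hi : h i = true
    · rw [utility_binarySearchMechanism_of_notMem (by simp [hi]) hv,
        utility_binarySearchMechanism_of_notMem (by simp [hi]) hv]
    · have : (Finset.univ.filter (fun i => h i = true)).sup
          (Function.update (fun j => (σ j).value Finset.univ) i (v Finset.univ)) =
          (Finset.univ.filter (fun i => h i = true)).sup (fun j => (σ j).value Finset.univ) :=
        Finset.sup_congr rfl fun j hj => Function.update_of_ne
          (by rintro rfl; exact hi (Finset.mem_filter.1 hj).2) _ _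
      rw [this]
      exact binarySearchMechanism_truthful σ ((List.nodup_finRange n).filter _) _ r rstar i hv hτ

end Auctions

/-! ## Supporting prices -/

section SupportingPrices

variable {m : ℕ}

/-- Probability weights on bundles. -/
structure IsLottery (w : Finset (Fin m) → ℝ) : Prop where
  nonneg : ∀ S, 0 ≤ w S
  sum_eq_one : ∑ S, w S = 1

/-- The probability that an item is in a random bundle. -/
noncomputable def marginal (w : Finset (Fin m) → ℝ) (e : Fin m) : ℝ :=
  ∑ S, if e ∈ S then w S else 0

theorem sum_mul_sum_mem (w : Finset (Fin m) → ℝ) (p : Fin m → ℝ) :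
    ∑ S, w S * ∑ e ∈ S, p e = ∑ e, marginal w e * p e := by
  have : ∀ S, w S * ∑ e ∈ S, p e = ∑ e, if e ∈ S then w S * p e else 0 := fun S => by
    rw [Finset.mul_sum, ← Finset.sum_filter]
    simp
  simp_rw [this, marginal, Finset.sum_mul, ite_mul, zero_mul]
  exact Finset.sum_comm

theorem IsLottery.marginal_nonneg {w : Finset (Fin m) → ℝ} (hw : IsLottery w) (e : Fin m) :
    0 ≤ marginal w e :=
  Finset.sum_nonneg fun S _ => by split_ifs; exacts [hw.nonneg S, le_rfl]

theorem isLottery_single (U : Finset (Fin m)) : IsLottery (Pi.single U (1 : ℝ)) where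
  nonneg S := by
    by_cases h : S = U
    · subst h; simp
    · simp [Pi.single_eq_of_ne h]
  sum_eq_one := by simp

theorem sum_single_mul (U : Finset (Fin m)) (F : Finset (Fin m) → ℝ) :
    ∑ S, (Pi.single U (1 : ℝ) : Finset (Fin m) → ℝ) S * F S = F U := by
  rw [Finset.sum_eq_single U]
  · simp
  · intro b _ hb; simp [Pi.single_eq_of_ne hb]
  · simp

/-- Linear programming duality: if every random bundle that contains each item with probability
at most `q` costs at least `c` in expectation, there are item prices that certify it. -/
theorem exists_prices_of_lotteries {q : ℝ} (hq : 0 < q) (g : Finset (Fin m) → ℝ) (c : ℝ)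
    (h : ∀ μ, IsLottery μ → (∀ e, marginal μ e ≤ q) → c ≤ ∑ T, μ T * g T) :
    ∃ p : Fin m → ℝ, (∀ e, 0 ≤ p e) ∧ ∀ T, c ≤ g T + ∑ e ∈ T, p e - q * ∑ e, p e := by
  -- The set of pairs (marginals, expected cost) of lotteries is convex and misses this open convex
  -- set; the separating functional, normalized in the cost coordinate, gives the prices.
  let s : Set ((Fin m → ℝ) × ℝ) := {a | (∀ e, a.1 e < q) ∧ a.2 < c}
  let t : Set ((Fin m → ℝ) × ℝ) :=
    {a | ∃ μ, IsLottery μ ∧ (∀ e, a.1 e = marginal μ e) ∧ a.2 = ∑ T, μ T * g T}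
  have hs : Convex ℝ s := by
    rintro ⟨a, b⟩ ⟨ha, hb⟩ ⟨a', b'⟩ ⟨ha', hb'⟩ x y hx hy hxy
    have key : ∀ u w z : ℝ, u < z → w < z → x * u + y * w < z := fun u w z hu hw => by
      rcases hx.eq_or_lt with rfl | hx
      · obtain rfl : y = 1 := by linarith
        linarith
      · have h1 : x * u < x * z := mul_lt_mul_of_pos_left hu hx
        have h2 : y * w ≤ y * z := mul_le_mul_of_nonneg_left hw.le hy
        have h3 : x * z + y * z = z := by rw [← add_mul, hxy, one_mul]
        linarith
    exact ⟨fun e => key _ _ _ (ha e) (ha' e), key _ _ _ hb hb'⟩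
  have hso : IsOpen s := by
    have : s = (⋂ e, {a : (Fin m → ℝ) × ℝ | a.1 e < q}) ∩ {a | a.2 < c} := by
      ext a; simp [s]
    rw [this]
    refine IsOpen.inter (isOpen_iInter_of_finite fun e => ?_) ?_
    · exact isOpen_lt (by fun_prop) continuous_const
    · exact isOpen_lt (by fun_prop) continuous_const
  have ht : Convex ℝ t := by
    rintro ⟨a, b⟩ ⟨μ, hμ, ha, hb⟩ ⟨a', b'⟩ ⟨μ', hμ', ha', hb'⟩ x y hx hy hxy
    refine ⟨fun T => x * μ T + y * μ' T, ⟨fun T => ?_, ?_⟩, fun e => ?_, ?_⟩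
    · have := hμ.nonneg T; have := hμ'.nonneg T; positivity
    · rw [Finset.sum_add_distrib, ← Finset.mul_sum, ← Finset.mul_sum, hμ.sum_eq_one,
        hμ'.sum_eq_one]
      linarith
    · simp only [Prod.smul_mk, Prod.mk_add_mk, Pi.add_apply, Pi.smul_apply, smul_eq_mul]
      simp only at ha ha'
      rw [ha, ha']
      simp only [marginal, Finset.mul_sum, ← Finset.sum_add_distrib]
      refine Finset.sum_congr rfl fun T _ => ?_
      split_ifs <;> simp
    · simp only [Prod.smul_mk, Prod.mk_add_mk, smul_eq_mul]
      simp only at hb hb'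
      rw [hb, hb']
      simp only [Finset.mul_sum, ← Finset.sum_add_distrib]
      exact Finset.sum_congr rfl fun T _ => by ring
  have hd : Disjoint s t := by
    rw [Set.disjoint_left]
    rintro ⟨a, b⟩ ⟨ha, hb⟩ ⟨μ, hμ, ha', hb'⟩
    have := h μ hμ (fun e => by rw [← ha' e]; exact (ha e).le)
    simp only at hb hb'
    linarith
  obtain ⟨f, u, hfs, hft⟩ := geometric_hahn_banach_open hs hso ht hd
  set π : Fin m → ℝ := fun e => f (Pi.single e 1, 0) with hπ
  set τ : ℝ := f (0, 1) with hτ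
  have hf : ∀ a b, f (a, b) = ∑ e, a e * π e + b * τ := fun a b => by
    have h1 : ((a, b) : (Fin m → ℝ) × ℝ) = (∑ e, a e • ((Pi.single e 1 : Fin m → ℝ), (0 : ℝ))) +
        b • ((0 : Fin m → ℝ), (1 : ℝ)) := by
      ext e
      · simp [Prod.fst_sum, Finset.sum_apply, Pi.single_apply]
      · simp [Prod.snd_sum]
    rw [h1, map_add, map_sum, map_smul]
    simp only [map_smul, smul_eq_mul, hπ, hτ]
  have hS : ∀ (a : Fin m → ℝ) (b : ℝ), (∀ e, a e < q) → b < c → ∑ e, a e * π e + b * τ < u := fun a b ha hb => by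
    rw [← hf]; exact hfs _ ⟨ha, hb⟩
  have hT : ∀ T : Finset (Fin m), u ≤ ∑ e ∈ T, π e + g T * τ := fun T => by
    have h1 := hft (fun e => if e ∈ T then 1 else 0, g T)
      ⟨Pi.single T 1, isLottery_single T, fun e => ?_, (sum_single_mul T g).symm⟩
    · rw [hf] at h1
      simpa using h1
    · have := sum_single_mul T (fun S => if e ∈ S then (1 : ℝ) else 0)
      simpa [marginal] using this.symm
  -- `s` is unbounded below in each coordinate, so a negative coefficient would make the functional
  -- unbounded above on `s`. The point is chosen so that coordinate `e` contributes exactly `|C|`.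
  have hπ0 : ∀ e, 0 ≤ π e := fun e => by
    by_contra hneg
    push Not at hneg
    set C : ℝ := (c - 1) * τ - u with hC
    have h1 := hS (Pi.single e (-(|C| / -π e))) (c - 1) (fun e' => by
      by_cases he : e' = e
      · subst he
        have : 0 ≤ |C| / -π e' := div_nonneg (abs_nonneg _) (by linarith)
        simp; linarith
      · simp [Pi.single_eq_of_ne he, hq]) (by linarith)
    have h2 : ∑ e', (Pi.single e (-(|C| / -π e)) : Fin m → ℝ) e' * π e' = |C| := by
      rw [Finset.sum_eq_single e]
      · have := hneg.ne
        simp only [Pi.single_eq_same]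
        field_simp
      · intro b _ hb; simp [Pi.single_eq_of_ne hb]
      · simp
    rw [h2] at h1
    have := neg_abs_le C
    linarith
  have hτ0 : 0 ≤ τ := by
    by_contra hneg
    push Not at hneg
    have h1 := hS 0 (c - 1 - |u - (c - 1) * τ| / -τ) (fun e => hq) (by
      have : 0 ≤ |u - (c - 1) * τ| / -τ := div_nonneg (abs_nonneg _) (by linarith)
      linarith)
    have h2 : (c - 1 - |u - (c - 1) * τ| / -τ) * τ = (c - 1) * τ + |u - (c - 1) * τ| := by
      have := hneg.ne
      field_simp
      ring
    rw [h2] at h1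
    have := le_abs_self (u - (c - 1) * τ)
    simp at h1
    linarith
  -- Slater's condition: the point mass on `∅` has marginals `0`, strictly below `q`, which excludes
  -- a separation that ignores the cost.
  have hτpos : 0 < τ := by
    refine hτ0.lt_of_ne fun h0 => ?_
    have h1 := hS (fun _ => q / 2) (c - 1) (fun _ => by linarith) (by linarith)
    have h2 := hT ∅
    have h3 : 0 ≤ ∑ e, q / 2 * π e := Finset.sum_nonneg fun e _ => mul_nonneg (by linarith) (hπ0 e)
    rw [← h0] at h1 h2
    simp at h2
    linarith
  -- The corner `(q, …, q, c)` is only in the closure of `s`, so the bound is obtained by moving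
  -- inwards by a small amount.
  have hcl : q * ∑ e, π e + c * τ ≤ u := by
    refine le_of_forall_pos_le_add fun ε hε => ?_
    have hP : 0 < ∑ e, π e + τ := add_pos_of_nonneg_of_pos (Finset.sum_nonneg fun e _ => hπ0 e) hτpos
    have hδ : 0 < ε / (∑ e, π e + τ) := div_pos hε hP
    have h1 := hS (fun _ => q - ε / (∑ e, π e + τ)) (c - ε / (∑ e, π e + τ))
      (fun _ => by linarith) (by linarith)
    rw [← Finset.mul_sum] at h1
    have h2 : ε / (∑ e, π e + τ) * (∑ e, π e + τ) = ε := div_mul_cancel₀ _ hP.ne'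
    nlinarith
  refine ⟨fun e => π e / τ, fun e => div_nonneg (hπ0 e) hτ0, fun T => ?_⟩
  have h1 := hT T
  rw [← Finset.sum_div, ← Finset.sum_div]
  have h2 : (q * ∑ e, π e + c * τ) / τ ≤ (∑ e ∈ T, π e + g T * τ) / τ :=
    div_le_div_of_nonneg_right (hcl.trans h1) hτ0
  rw [add_div, add_div, mul_div_cancel_right₀ _ hτpos.ne', mul_div_cancel_right₀ _ hτpos.ne',
    mul_div_assoc] at h2
  linarith

/-- The law of the intersection of two independent random bundles. -/
noncomputable def interLottery (w μ : Finset (Fin m) → ℝ) (R : Finset (Fin m)) : ℝ :=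
  ∑ S, ∑ T, if S ∩ T = R then w S * μ T else 0

theorem sum_interLottery_mul (w μ F : Finset (Fin m) → ℝ) :
    ∑ R, interLottery w μ R * F R = ∑ S, w S * ∑ T, μ T * F (S ∩ T) := by
  simp_rw [interLottery, Finset.sum_mul]
  rw [Finset.sum_comm]
  refine Finset.sum_congr rfl fun S _ => ?_
  rw [Finset.sum_comm, Finset.mul_sum]
  refine Finset.sum_congr rfl fun T _ => ?_
  simp_rw [ite_mul, zero_mul]
  rw [Finset.sum_ite_eq]
  simp [mul_assoc]

theorem IsLottery.inter {w μ : Finset (Fin m) → ℝ} (hw : IsLottery w) (hμ : IsLottery μ) :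
    IsLottery (interLottery w μ) where
  nonneg R := Finset.sum_nonneg fun S _ => Finset.sum_nonneg fun T _ => by
    have := hw.nonneg S; have := hμ.nonneg T
    split_ifs <;> positivity
  sum_eq_one := by
    have := sum_interLottery_mul w μ (fun _ => 1)
    simpa [hw.sum_eq_one, hμ.sum_eq_one] using this

theorem marginal_interLottery (w μ : Finset (Fin m) → ℝ) (e : Fin m) :
    marginal (interLottery w μ) e = marginal w e * marginal μ e := by
  have h := sum_interLottery_mul w μ (fun R => if e ∈ R then 1 else 0)
  have h' : ∀ w' : Finset (Fin m) → ℝ, marginal w' e = ∑ S, w' S * if e ∈ S then 1 else 0 :=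
    fun w' => by simp [marginal]
  rw [h', h, h', h', Finset.sum_mul]
  refine Finset.sum_congr rfl fun S _ => ?_
  by_cases hS : e ∈ S <;> simp [hS]

/-- Item prices and a random subset of `U` which certify that, whatever part `T` of `U` is sold,
the utility of the random bundle without `T` plus the price of `T` is at least `w`. -/
def HasSupportingPrices (v : Finset (Fin m) → ℝ≥0) (U : Finset (Fin m)) (w : ℝ) : Prop :=
  ∃ (lam : Finset (Fin m) → ℝ) (p : Fin m → ℝ), IsLottery lam ∧ (∀ S, lam S ≠ 0 → S ⊆ U) ∧
    (∀ e, 0 ≤ p e ∧ p e ≤ v U) ∧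
    ∀ T ⊆ U, w ≤ ∑ S, lam S * ((v (S \ T) : ℝ) - ∑ e ∈ S \ T, p e) + ∑ e ∈ T, p e

/-- The random bundle contains each item with probability at most `q`, so its expected price is at
most `q * ∑ e, p e`, the term that duality subtracts. Truncating the prices at `v U` keeps them
below the scale of the search. -/
theorem hasSupportingPrices_of_lottery {v : Finset (Fin m) → ℝ≥0} (hv : IsValuation v)
    {U : Finset (Fin m)} {lam : Finset (Fin m) → ℝ} (hl : IsLottery lam)
    (hU : ∀ S, lam S ≠ 0 → S ⊆ U) {q c : ℝ} (hq0 : 0 ≤ q) (hq : ∀ e, marginal lam e ≤ q)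
    {p : Fin m → ℝ} (hp : ∀ e, 0 ≤ p e)
    (h : ∀ T, c ≤ ∑ S, lam S * (v (S \ T) : ℝ) + ∑ e ∈ T, p e - q * ∑ e, p e) :
    HasSupportingPrices v U c := by
  refine ⟨lam, fun e => min (p e) (v U), hl, hU,
    fun e => ⟨le_min (hp e) (v U).coe_nonneg, min_le_right _ _⟩, fun T hT => ?_⟩
  have hp' : ∀ e, 0 ≤ min (p e) (v U : ℝ) := fun e => le_min (hp e) (v U).coe_nonneg
  have h1 : ∑ S, lam S * ∑ e ∈ S \ T, min (p e) (v U : ℝ) ≤ q * ∑ e, p e := by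
    calc ∑ S, lam S * ∑ e ∈ S \ T, min (p e) (v U : ℝ)
        ≤ ∑ S, lam S * ∑ e ∈ S, min (p e) (v U : ℝ) :=
          Finset.sum_le_sum fun S _ => mul_le_mul_of_nonneg_left
            (Finset.sum_le_sum_of_subset_of_nonneg Finset.sdiff_subset fun e _ _ => hp' e)
            (hl.nonneg S)
      _ = ∑ e, marginal lam e * min (p e) (v U : ℝ) := sum_mul_sum_mem _ _
      _ ≤ ∑ e, q * p e := Finset.sum_le_sum fun e _ =>
          mul_le_mul (hq e) (min_le_left _ _) (hp' e) hq0
      _ = q * ∑ e, p e := (Finset.mul_sum _ _ _).symm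
  simp_rw [mul_sub, Finset.sum_sub_distrib]
  by_cases hB : ∀ e ∈ T, p e ≤ v U
  · have h2 : ∑ e ∈ T, min (p e) (v U : ℝ) = ∑ e ∈ T, p e :=
      Finset.sum_congr rfl fun e he => min_eq_left (hB e he)
    have := h T
    rw [h2]
    linarith
  · push Not at hB
    obtain ⟨b, hb, hbU⟩ := hB
    -- Apply the dual inequality without the overpriced items `B`: losing them costs at most `v U`
    -- in value, and one of them already contributes `v U` to the truncated price of `T`.
    set B := T.filter (fun e => (v U : ℝ) < p e) with hBdef
    have h2 := h (T \ B)
    have h3 : ∑ e ∈ T \ B, p e + v U ≤ ∑ e ∈ T, min (p e) (v U : ℝ) := by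
      rw [← Finset.sum_sdiff (Finset.filter_subset (fun e => (v U : ℝ) < p e) T)]
      refine add_le_add (Finset.sum_le_sum fun e he => ?_) ?_
      · have : ¬ (v U : ℝ) < p e := fun hlt =>
          (Finset.mem_sdiff.1 he).2 (Finset.mem_filter.2 ⟨(Finset.mem_sdiff.1 he).1, hlt⟩)
        exact le_min le_rfl (not_lt.1 this)
      · have := Finset.single_le_sum (f := fun e => min (p e) (v U : ℝ)) (fun e _ => hp' e)
          (Finset.mem_filter.2 ⟨hb, hbU⟩ : b ∈ T.filter (fun e => (v U : ℝ) < p e))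
        simp only [min_eq_right hbU.le] at this
        exact this
    have h4 : ∑ S, lam S * (v (S \ (T \ B)) : ℝ) ≤ v U := by
      calc ∑ S, lam S * (v (S \ (T \ B)) : ℝ) ≤ ∑ S, lam S * v U :=
            Finset.sum_le_sum fun S _ => by
              by_cases h0 : lam S = 0
              · simp [h0]
              · exact mul_le_mul_of_nonneg_left (NNReal.coe_le_coe.2
                  (hv.mono _ _ (Finset.sdiff_subset.trans (hU S h0)))) (hl.nonneg S)
        _ = v U := by rw [← Finset.sum_mul, hl.sum_eq_one, one_mul]
    have h5 : 0 ≤ ∑ S, lam S * (v (S \ T) : ℝ) :=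
      Finset.sum_nonneg fun S _ => mul_nonneg (hl.nonneg S) (NNReal.coe_nonneg _)
    linarith

/-! ### Supporting prices for XOS and submodular valuations. -/

theorem HasSupportingPrices.of_additive {v : Finset (Fin m) → ℝ≥0} {U : Finset (Fin m)}
    {a : Fin m → ℝ} (ha : ∀ e, 0 ≤ a e) (hle : ∀ S ⊆ U, ∑ e ∈ S, a e ≤ v S)
    (heq : ∑ e ∈ U, a e = v U) : HasSupportingPrices v U (v U / 2) := by
  -- At half of the additive weights, each item contributes the same amount `a e / 2` whether it is
  -- kept (as utility) or sold (as revenue).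
  refine ⟨Pi.single U 1, fun e => if e ∈ U then a e / 2 else 0, isLottery_single U,
    fun S hS => ?_, fun e => ?_, fun T hT => ?_⟩
  · by_cases h : S = U
    · exact h.subset
    · simp [Pi.single_eq_of_ne h] at hS
  · dsimp only
    split_ifs with he
    · have := Finset.single_le_sum (fun e _ => ha e) he
      have := ha e
      constructor <;> linarith
    · exact ⟨le_rfl, NNReal.coe_nonneg _⟩
  · rw [sum_single_mul U (fun S => (v (S \ T) : ℝ) - ∑ e ∈ S \ T, if e ∈ U then a e / 2 else 0)]
    have h1 : ∀ R ⊆ U, (∑ e ∈ R, if e ∈ U then a e / 2 else 0) = (∑ e ∈ R, a e) / 2 :=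
      fun R hR => by
        rw [Finset.sum_div]
        exact Finset.sum_congr rfl fun e he => if_pos (hR he)
    rw [h1 _ Finset.sdiff_subset, h1 _ hT]
    have h2 := hle (U \ T) Finset.sdiff_subset
    have h3 := Finset.sum_sdiff (f := a) hT
    linarith

theorem IsXOS.hasSupportingPrices {v : Finset (Fin m) → ℝ≥0} (hv : IsXOS v)
    (U : Finset (Fin m)) : HasSupportingPrices v U (v U / 2) := by
  obtain ⟨F, hF, h⟩ := hv
  obtain ⟨a, haF, ha⟩ := Finset.exists_mem_eq_sup F hF (fun a => ∑ e ∈ U, a e)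
  refine HasSupportingPrices.of_additive (a := fun e => (a e : ℝ)) (fun e => (a e).coe_nonneg)
    (fun S _ => ?_) ?_
  · rw [h S, ← NNReal.coe_sum, NNReal.coe_le_coe]
    exact Finset.le_sup (f := fun a : Fin m → ℝ≥0 => ∑ e ∈ S, a e) haF
  · rw [h U, ha, NNReal.coe_sum]

theorem IsXOS.isSubadditive {v : Finset (Fin m) → ℝ≥0} (hv : IsXOS v) : IsSubadditive v := by
  obtain ⟨F, hF, h⟩ := hv
  intro S T
  rw [h S, h T, h (S ∪ T)]
  refine Finset.sup_le fun a ha => ?_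
  calc ∑ e ∈ S ∪ T, a e ≤ ∑ e ∈ S, a e + ∑ e ∈ T, a e := by
        rw [← Finset.sum_union_inter]; exact le_self_add
    _ ≤ _ := add_le_add (Finset.le_sup (f := fun a : Fin m → ℝ≥0 => ∑ e ∈ S, a e) ha)
        (Finset.le_sup (f := fun a : Fin m → ℝ≥0 => ∑ e ∈ T, a e) ha)

theorem IsSubmodular.isSubadditive {v : Finset (Fin m) → ℝ≥0} (hv : IsSubmodular v) :
    IsSubadditive v := fun S T => le_self_add.trans (hv S T)

/-- Insert the items of `U` one by one and weigh each by its marginal value. Submodularity for `U`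
and `S`, where `S` contains the new item, says that this item adds at least as much to the smaller
set. -/
theorem IsSubmodular.exists_additive {v : Finset (Fin m) → ℝ≥0} (hv : IsSubmodular v)
    (hval : IsValuation v) (U : Finset (Fin m)) : ∃ a : Fin m → ℝ, (∀ e, 0 ≤ a e) ∧
      (∀ S ⊆ U, ∑ e ∈ S, a e ≤ v S) ∧ ∑ e ∈ U, a e = v U := by
  classical
  induction U using Finset.induction_on with
  | empty =>
    refine ⟨0, fun _ => le_rfl, fun S hS => ?_, by simp [hval.empty]⟩
    simp
  | insert x U hx ih =>
    obtain ⟨a, ha, hle, heq⟩ := ih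
    have hmono : (v U : ℝ) ≤ v (insert x U) :=
      NNReal.coe_le_coe.2 (hval.mono _ _ (Finset.subset_insert x U))
    have hup : ∀ S ⊆ U, ∑ e ∈ S, Function.update a x (v (insert x U) - v U) e = ∑ e ∈ S, a e :=
      fun S hS => Finset.sum_congr rfl fun e he =>
        Function.update_of_ne (by rintro rfl; exact hx (hS he)) _ _
    refine ⟨Function.update a x (v (insert x U) - v U), fun e => ?_, fun S hS => ?_, ?_⟩
    · by_cases he : e = x
      · subst he; simpa using hmono
      · simpa [Function.update_of_ne he] using ha e
    · by_cases hxS : x ∈ S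
      · have hsub : S.erase x ⊆ U := by
          intro e he
          rcases Finset.mem_insert.1 (hS (Finset.mem_of_mem_erase he)) with h | h
          · exact absurd h (Finset.ne_of_mem_erase he)
          · exact h
        rw [← Finset.add_sum_erase _ _ hxS, hup _ hsub, Function.update_self]
        have h1 := hle _ hsub
        have h2 := hv U S
        have h3 : U ∪ S = insert x U := by
          ext e; simp only [Finset.mem_union, Finset.mem_insert]
          constructor
          · rintro (h | h)
            · exact Or.inr h
            · exact Finset.mem_insert.1 (hS h)
          · rintro (rfl | h)
            · exact Or.inr hxS
            · exact Or.inl h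
        have h4 : U ∩ S = S.erase x := by
          ext e; simp only [Finset.mem_inter, Finset.mem_erase]
          constructor
          · rintro ⟨h, h'⟩
            exact ⟨by rintro rfl; exact hx h, h'⟩
          · rintro ⟨h, h'⟩
            exact ⟨hsub (Finset.mem_erase.2 ⟨h, h'⟩), h'⟩
        rw [h3, h4, ← NNReal.coe_le_coe] at h2
        push_cast at h2
        linarith
      · have hsub : S ⊆ U := fun e he => by
          rcases Finset.mem_insert.1 (hS he) with h | h
          · subst h; exact absurd he hxS
          · exact h
        rw [hup _ hsub]
        exact hle _ hsub
    · rw [Finset.sum_insert hx, hup _ le_rfl, heq, Function.update_self]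
      ring

theorem IsSubmodular.hasSupportingPrices {v : Finset (Fin m) → ℝ≥0} (hv : IsSubmodular v)
    (hval : IsValuation v) (U : Finset (Fin m)) : HasSupportingPrices v U (v U / 2) := by
  obtain ⟨a, h1, h2, h3⟩ := hv.exists_additive hval U
  exact HasSupportingPrices.of_additive h1 h2 h3

/-- A nonempty subset of `U` is worth at most `v U`, hence at most `v U` per item; a sparse lottery
has few items in expectation. -/
theorem sum_lottery_mul_le {v : Finset (Fin m) → ℝ≥0} (hv : IsValuation v)
    {U : Finset (Fin m)} {lam : Finset (Fin m) → ℝ} (hl : IsLottery lam)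
    (hU : ∀ S, lam S ≠ 0 → S ⊆ U) {q : ℝ} (hq : ∀ e, marginal lam e ≤ q) :
    ∑ S, lam S * (v S : ℝ) ≤ m * q * v U := by
  have h1 : ∀ S, lam S * (v S : ℝ) ≤ lam S * ∑ e ∈ S, (v U : ℝ) := fun S => by
    by_cases h0 : lam S = 0
    · simp [h0]
    · refine mul_le_mul_of_nonneg_left ?_ (hl.nonneg S)
      rcases S.eq_empty_or_nonempty with rfl | hS
      · simp [hv.empty]
      · rw [Finset.sum_const, nsmul_eq_mul]
        have h2 : (v S : ℝ) ≤ v U := NNReal.coe_le_coe.2 (hv.mono _ _ (hU S h0))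
        have h3 : (1 : ℝ) ≤ S.card := by exact_mod_cast hS.card_pos
        nlinarith [(v U).coe_nonneg]
  calc ∑ S, lam S * (v S : ℝ) ≤ ∑ S, lam S * ∑ e ∈ S, (v U : ℝ) := Finset.sum_le_sum fun S _ => h1 S
    _ = ∑ e, marginal lam e * v U := sum_mul_sum_mem lam fun _ => (v U : ℝ)
    _ ≤ ∑ _e : Fin m, q * v U :=
        Finset.sum_le_sum fun e _ => mul_le_mul_of_nonneg_right (hq e) (NNReal.coe_nonneg _)
    _ = m * q * v U := by simp [mul_assoc]

/-- Either there are supporting prices, or a lottery can be made sparser at a small loss. -/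
theorem exists_sparser_lottery {v : Finset (Fin m) → ℝ≥0} (hv : IsValuation v)
    (hsub : IsSubadditive v) {U : Finset (Fin m)} {c : ℝ} (hno : ¬ HasSupportingPrices v U c)
    {lam : Finset (Fin m) → ℝ} (hl : IsLottery lam) (hU : ∀ S, lam S ≠ 0 → S ⊆ U) {q : ℝ}
    (hq0 : 0 < q) (hq : ∀ e, marginal lam e ≤ q) :
    ∃ lam', IsLottery lam' ∧ (∀ S, lam' S ≠ 0 → S ⊆ U) ∧ (∀ e, marginal lam' e ≤ q * q) ∧
      ∑ S, lam S * (v S : ℝ) - c ≤ ∑ S, lam' S * (v S : ℝ) := by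
  -- Otherwise duality, applied to the cost `T ↦ E v (S \ T)`, would yield supporting prices of
  -- quality `c`.
  have h1 : ∃ μ, IsLottery μ ∧ (∀ e, marginal μ e ≤ q) ∧
      ∑ T, μ T * ∑ S, lam S * (v (S \ T) : ℝ) < c := by
    by_contra hcon
    push Not at hcon
    obtain ⟨p, hp, hp'⟩ := exists_prices_of_lotteries hq0 _ c hcon
    exact hno (hasSupportingPrices_of_lottery hv hl hU hq0.le hq hp hp')
  obtain ⟨μ, hμ, hμq, hμc⟩ := h1
  refine ⟨interLottery lam μ, hl.inter hμ, fun R hR => ?_, fun e => ?_, ?_⟩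
  · obtain ⟨S, -, hS⟩ := Finset.exists_ne_zero_of_sum_ne_zero hR
    obtain ⟨T, -, hT⟩ := Finset.exists_ne_zero_of_sum_ne_zero hS
    split_ifs at hT with h
    · rw [← h]
      exact Finset.inter_subset_left.trans (hU S (left_ne_zero_of_mul hT))
    · exact absurd rfl hT
  · rw [marginal_interLottery]
    exact mul_le_mul (hq e) (hμq e) (hμ.marginal_nonneg e) hq0.le
  · rw [sum_interLottery_mul]
    have h2 : ∑ T, μ T * ∑ S, lam S * (v (S \ T) : ℝ) =
        ∑ S, lam S * ∑ T, μ T * (v (S \ T) : ℝ) := by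
      simp_rw [Finset.mul_sum]
      rw [Finset.sum_comm]
      exact Finset.sum_congr rfl fun S _ => Finset.sum_congr rfl fun T _ => by ring
    -- Subadditivity for `S = (S \ T) ∪ (S ∩ T)`, averaged over both lotteries.
    have h3 : ∑ S, lam S * (v S : ℝ) ≤ ∑ S, lam S * ∑ T, μ T * (v (S \ T) : ℝ) +
        ∑ S, lam S * ∑ T, μ T * (v (S ∩ T) : ℝ) := by
      rw [← Finset.sum_add_distrib]
      refine Finset.sum_le_sum fun S _ => ?_
      rw [← mul_add, ← Finset.sum_add_distrib]
      refine mul_le_mul_of_nonneg_left ?_ (hl.nonneg S)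
      calc (v S : ℝ) = ∑ T, μ T * v S := by rw [← Finset.sum_mul, hμ.sum_eq_one, one_mul]
        _ ≤ _ := Finset.sum_le_sum fun T _ => by
          rw [← mul_add]
          refine mul_le_mul_of_nonneg_left ?_ (hμ.nonneg T)
          have := hsub (S \ T) (S ∩ T)
          rw [Finset.sdiff_union_inter] at this
          exact_mod_cast this
    linarith

/-- Dütting, Kesselheim, Lucier: supporting prices of subadditive valuations. -/
theorem IsSubadditive.hasSupportingPrices {v : Finset (Fin m) → ℝ≥0} (hsub : IsSubadditive v)
    (hv : IsValuation v) (U : Finset (Fin m)) {k : ℕ} (hk : 4 * m ≤ 2 ^ 2 ^ k) :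
    HasSupportingPrices v U (v U / (4 * k + 1)) := by
  by_contra hno
  have hU0 : (0 : ℝ) < v U := by
    refine (v U).coe_nonneg.lt_of_ne fun h0 => hno ?_
    refine ⟨Pi.single ∅ 1, 0, isLottery_single ∅, fun S hS => ?_, fun e => ⟨le_rfl, ?_⟩,
      fun T hT => ?_⟩
    · by_cases h : S = ∅
      · simp [h]
      · simp [Pi.single_eq_of_ne h] at hS
    · exact NNReal.coe_nonneg _
    · rw [sum_single_mul ∅ (fun S => (v (S \ T) : ℝ) - ∑ e ∈ S \ T, (0 : Fin m → ℝ) e)]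
      simp [hv.empty, ← h0]
  set c : ℝ := v U / (4 * k + 1) with hc
  -- The starting lottery is `U` or `∅` with probability 1/2 each; each step squares the bound on
  -- the marginals and loses at most `c`.
  have key : ∀ j : ℕ, ∃ lam, IsLottery lam ∧ (∀ S, lam S ≠ 0 → S ⊆ U) ∧
      (∀ e, marginal lam e ≤ (1 / 2) ^ 2 ^ j) ∧ v U / 2 - j * c ≤ ∑ S, lam S * (v S : ℝ) := by
    intro j
    induction j with
    | zero =>
      set lam : Finset (Fin m) → ℝ := fun S =>
        1 / 2 * (Pi.single U (1 : ℝ) : Finset (Fin m) → ℝ) S +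
          1 / 2 * (Pi.single ∅ (1 : ℝ) : Finset (Fin m) → ℝ) S with hlam
      have hF : ∀ F : Finset (Fin m) → ℝ, ∑ S, lam S * F S = 1 / 2 * F U + 1 / 2 * F ∅ :=
        fun F => by
          simp_rw [hlam, add_mul, mul_assoc]
          rw [Finset.sum_add_distrib, ← Finset.mul_sum, ← Finset.mul_sum, sum_single_mul,
            sum_single_mul]
      refine ⟨lam, ⟨fun S => ?_, ?_⟩, fun S hS => ?_, fun e => ?_, ?_⟩
      · have := (isLottery_single U).nonneg S
        have := (isLottery_single (∅ : Finset (Fin m))).nonneg S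
        simp only [hlam]; positivity
      · have := hF fun _ => 1
        simp only [mul_one] at this
        rw [this]; norm_num
      · by_contra hSU
        have h1 : S ≠ U := by rintro rfl; exact hSU subset_rfl
        have h2 : S ≠ ∅ := by rintro rfl; exact hSU (Finset.empty_subset _)
        simp [hlam, Pi.single_eq_of_ne h1, Pi.single_eq_of_ne h2] at hS
      · have := hF fun S => if e ∈ S then 1 else 0
        simp only [mul_ite, mul_one, mul_zero] at this
        rw [marginal, this]
        split_ifs <;> norm_num at *
      · rw [hF]
        simp [hv.empty]; linarith
    | succ j ih =>
      obtain ⟨lam, h1, h2, h3, h4⟩ := ih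
      obtain ⟨lam', h1', h2', h3', h4'⟩ :=
        exists_sparser_lottery hv hsub hno h1 h2 (by positivity) h3
      refine ⟨lam', h1', h2', fun e => (h3' e).trans_eq ?_, ?_⟩
      · rw [← pow_add, pow_succ, mul_two]
      · push_cast; linarith
  obtain ⟨lam, h1, h2, h3, h4⟩ := key k
  have h5 := sum_lottery_mul_le hv h1 h2 h3
  have h6 : (m : ℝ) * (1 / 2) ^ 2 ^ k ≤ 1 / 4 := by
    rw [one_div_pow, mul_one_div, div_le_div_iff₀ (by positivity) (by norm_num)]
    have : ((4 * m : ℕ) : ℝ) ≤ ((2 ^ 2 ^ k : ℕ) : ℝ) := Nat.cast_le.2 hk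
    push_cast at this
    linarith
  have h7 : (4 * k + 1) * c = v U := by
    rw [hc]; field_simp
  have h8 : (m : ℝ) * (1 / 2) ^ 2 ^ k * v U ≤ 1 / 4 * v U :=
    mul_le_mul_of_nonneg_right h6 hU0.le
  -- The bounds give `v U / 2 - k * c ≤ v U / 4`, that is `v U ≤ 4 * k * c = v U - c`, which is
  -- absurd.
  have h9 : 0 < c := div_pos hU0 (by positivity)
  nlinarith

end SupportingPrices

/-! ## Welfare of the binary-search mechanism -/

section BinarySearch

variable {n m : ℕ}

theorem candidatePrice_nonneg (m : ℕ) {ψ : ℝ} (hψ : 0 ≤ ψ) (j : ℕ) : 0 ≤ candidatePrice m ψ j := by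
  unfold candidatePrice
  split_ifs
  · exact le_rfl
  · positivity

theorem candidatePrice_mono (m : ℕ) {ψ : ℝ} (hψ : 0 ≤ ψ) : Monotone (candidatePrice m ψ) := by
  intro j k hjk
  by_cases hj : j = 0
  · simpa [candidatePrice, hj] using candidatePrice_nonneg m hψ k
  · have hk : k ≠ 0 := by omega
    simp only [candidatePrice, hj, hk, if_false]
    exact div_le_div_of_nonneg_left hψ (by positivity)
      (pow_le_pow_right₀ (by norm_num) (by omega))

/-- Every price up to the scale can be rounded to a candidate price. -/
theorem exists_candidatePrice (m : ℕ) {ψ x : ℝ} (hx : 0 ≤ x) (hxψ : x ≤ ψ) :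
    ∃ j < 2 ^ searchRounds m, candidatePrice m ψ j ≤ x ∧
      x ≤ 2 * candidatePrice m ψ j + ψ / 2 ^ (2 ^ searchRounds m - 1) := by
  set K := 2 ^ searchRounds m with hK
  have hKpos : 0 < K := by positivity
  have hψ : 0 ≤ ψ := hx.trans hxψ
  -- Round down to the largest candidate: neighbouring positive candidates differ by a factor 2, and
  -- the gap above candidate `0` causes the additive error.
  have hex : ∃ j < K, candidatePrice m ψ j ≤ x ∧ ∀ k < K, candidatePrice m ψ k ≤ x → k ≤ j := by
    let s := (Finset.range K).filter (fun j => candidatePrice m ψ j ≤ x)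
    have hs : s.Nonempty := ⟨0, Finset.mem_filter.2 ⟨Finset.mem_range.2 hKpos, by simpa [candidatePrice] using hx⟩⟩
    have h1 := s.max'_mem hs
    simp only [s, Finset.mem_filter, Finset.mem_range] at h1
    exact ⟨s.max' hs, h1.1, h1.2, fun k hk hkx => s.le_max' k (by simp [s, hk, hkx])⟩
  obtain ⟨j, hj, hjx, hmax⟩ := hex
  refine ⟨j, hj, hjx, ?_⟩
  have hsmall : 0 ≤ ψ / 2 ^ (K - 1) := by positivity
  by_cases hj1 : j + 1 < K
  · have h1 : x < candidatePrice m ψ (j + 1) := by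
      by_contra hcon
      have := hmax _ hj1 (not_lt.1 hcon)
      omega
    by_cases hj0 : j = 0
    · subst hj0
      simp only [candidatePrice, ← hK] at h1 ⊢
      simp at h1 ⊢
      linarith
    · have h2 : candidatePrice m ψ (j + 1) = 2 * candidatePrice m ψ j := by
        simp only [candidatePrice, hj0, ← hK, if_false, Nat.succ_ne_zero]
        have : K - j = K - (j + 1) + 1 := by omega
        rw [this, pow_succ]
        field_simp
      linarith
  · by_cases hj0 : j = 0
    · have hK1 : K = 1 := by omega
      simp only [candidatePrice, hj0, hK1]
      simp
      exact hxψ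
    · have h2 : candidatePrice m ψ j = ψ / 2 := by
        have : K - j = 1 := by omega
        simp [candidatePrice, hj0, ← hK, this]
      linarith

theorem three_mul_clog_lt (m : ℕ) : 3 * Nat.clog 2 m + 1 ≤ 2 ^ searchRounds m :=
  Nat.le_pow_clog (by norm_num) _

/-- This keeps the additive rounding error, summed over all items, below the scale `ψ`. -/
theorem le_two_pow_sub_one (m : ℕ) : m ≤ 2 ^ (2 ^ searchRounds m - 1) := by
  have h := three_mul_clog_lt m
  exact (Nat.le_pow_clog (by norm_num) m).trans (Nat.pow_le_pow_right (by norm_num) (by omega))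

/-- The prices of a round. -/
noncomputable def searchPrice (σ : Fin n → Strategy m) (N : List (Fin n)) (ψ : ℝ)
    (r : Fin n → Fin (searchRounds m + 1)) (ℓ : ℕ) : Fin m → ℝ :=
  roundPrice ψ ℓ (lowIndex σ N ψ r ℓ)

/-- The allocation of the auction of a round. -/
noncomputable def searchAlloc (σ : Fin n → Strategy m) (N : List (Fin n)) (ψ : ℝ)
    (r : Fin n → Fin (searchRounds m + 1)) (ℓ : ℕ) : Fin n → Finset (Fin m) :=
  fixedPriceAuction σ (searchPrice σ N ψ r ℓ) (roundBidders N r ℓ) Finset.univ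

theorem searchPrice_nonneg (σ : Fin n → Strategy m) (N : List (Fin n)) {ψ : ℝ} (hψ : 0 ≤ ψ)
    (r : Fin n → Fin (searchRounds m + 1)) (ℓ : ℕ) (e : Fin m) : 0 ≤ searchPrice σ N ψ r ℓ e :=
  candidatePrice_nonneg m hψ _

open Classical in
theorem lowIndex_succ (σ : Fin n → Strategy m) (N : List (Fin n)) (ψ : ℝ)
    (r : Fin n → Fin (searchRounds m + 1)) (ℓ : ℕ) (e : Fin m) :
    lowIndex σ N ψ r (ℓ + 1) e = if ∃ i, e ∈ searchAlloc σ N ψ r ℓ i then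
      lowIndex σ N ψ r ℓ e + 2 ^ (searchRounds m - ℓ) / 2 else lowIndex σ N ψ r ℓ e := rfl

theorem two_pow_sub_half {b ℓ : ℕ} (h : ℓ < b) :
    2 ^ (b - ℓ) / 2 = 2 ^ (b - (ℓ + 1)) ∧ 2 ^ (b - ℓ) = 2 * 2 ^ (b - (ℓ + 1)) := by
  have : b - ℓ = b - (ℓ + 1) + 1 := by omega
  rw [this, pow_succ]
  simp [mul_comm]

/-- An item whose price should be candidate `j` is sold in some round at this price or more, or is
not sold in some round at this price or less, or has this price in the last round. -/
theorem sold_or_unsold_or_correct (σ : Fin n → Strategy m) (N : List (Fin n)) {ψ : ℝ} (hψ : 0 ≤ ψ)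
    (r : Fin n → Fin (searchRounds m + 1)) (e : Fin m) {j : ℕ} (hj : j < 2 ^ searchRounds m) :
    (∃ ℓ < searchRounds m, (∃ i, e ∈ searchAlloc σ N ψ r ℓ i) ∧
      candidatePrice m ψ j ≤ searchPrice σ N ψ r ℓ e) ∨
    (∃ ℓ < searchRounds m, (¬ ∃ i, e ∈ searchAlloc σ N ψ r ℓ i) ∧
      searchPrice σ N ψ r ℓ e ≤ candidatePrice m ψ j) ∨
    searchPrice σ N ψ r (searchRounds m) e = candidatePrice m ψ j := by
  by_contra hcon
  push Not at hcon
  obtain ⟨h1, h2, h3⟩ := hcon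
  -- Unless one of the first two cases occurs, every halving keeps the half that contains candidate
  -- `j`; with one candidate left, it is `j`.
  have key : ∀ ℓ ≤ searchRounds m, lowIndex σ N ψ r ℓ e ≤ j ∧
      j < lowIndex σ N ψ r ℓ e + 2 ^ (searchRounds m - ℓ) := by
    intro ℓ
    induction ℓ with
    | zero => intro _; simpa [lowIndex] using hj
    | succ ℓ ih =>
      intro hℓ
      obtain ⟨ih1, ih2⟩ := ih (by omega)
      obtain ⟨hw1, hw2⟩ := two_pow_sub_half (show ℓ < searchRounds m by omega)
      rw [lowIndex_succ, hw1]
      have hprice : searchPrice σ N ψ r ℓ e =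
          candidatePrice m ψ (lowIndex σ N ψ r ℓ e + 2 ^ (searchRounds m - (ℓ + 1))) := by
        rw [searchPrice, roundPrice, hw1]
      rw [hw2] at ih2
      by_cases hs : ∃ i, e ∈ searchAlloc σ N ψ r ℓ i
      · rw [if_pos hs]
        have := h1 ℓ (by omega) hs
        rw [hprice] at this
        refine ⟨?_, by omega⟩
        by_contra hlt
        exact absurd (candidatePrice_mono m hψ (not_le.1 hlt).le) (not_le.2 this)
      · rw [if_neg hs]
        have := h2 ℓ (by omega) (fun i hi => hs ⟨i, hi⟩)
        rw [hprice] at this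
        refine ⟨ih1, ?_⟩
        by_contra hlt
        exact absurd (candidatePrice_mono m hψ (not_lt.1 hlt)) (not_le.2 this)
  obtain ⟨k1, k2⟩ := key _ le_rfl
  refine h3 ?_
  simp only [Nat.sub_self, pow_zero] at k2
  have : lowIndex σ N ψ r (searchRounds m) e = j := by omega
  simp [searchPrice, roundPrice, this]

/-! ### Moving one bidder to another round. -/

theorem roundBidders_append_cons_self {N₁ N₂ : List (Fin n)} {i : Fin n}
    (hN : (N₁ ++ i :: N₂).Nodup) (r : Fin n → Fin (searchRounds m + 1))
    (ℓ : Fin (searchRounds m + 1)) :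
    roundBidders (N₁ ++ i :: N₂) (Function.update r i ℓ) ℓ =
      roundBidders N₁ r ℓ ++ i :: roundBidders N₂ r ℓ := by
  rw [List.nodup_middle, List.nodup_cons, List.mem_append, not_or] at hN
  have hf : ∀ N : List (Fin n), i ∉ N →
      N.filter (fun j => (Function.update r i ℓ j : ℕ) = ℓ) = N.filter (fun j => (r j : ℕ) = ℓ) :=
    fun N hi => List.filter_congr fun j hj => by
      rw [Function.update_of_ne (by rintro rfl; exact hi hj)]
  simp [roundBidders, List.filter_append, hf _ hN.1.1, hf _ hN.1.2]

theorem roundBidders_append_cons_of_ne {N₁ N₂ : List (Fin n)} {i : Fin n}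
    (hN : (N₁ ++ i :: N₂).Nodup) (r : Fin n → Fin (searchRounds m + 1))
    {a : Fin (searchRounds m + 1)} {ℓ : ℕ} (h : (a : ℕ) ≠ ℓ) :
    roundBidders (N₁ ++ i :: N₂) (Function.update r i a) ℓ =
      roundBidders N₁ r ℓ ++ roundBidders N₂ r ℓ := by
  rw [List.nodup_middle, List.nodup_cons, List.mem_append, not_or] at hN
  have hf : ∀ N : List (Fin n), i ∉ N →
      N.filter (fun j => (Function.update r i a j : ℕ) = ℓ) = N.filter (fun j => (r j : ℕ) = ℓ) :=
    fun N hi => List.filter_congr fun j hj => by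
      rw [Function.update_of_ne (by rintro rfl; exact hi hj)]
  simp [roundBidders, List.filter_append, hf _ hN.1.1, hf _ hN.1.2, h]

/-- A bidder placed in round `ℓ` or later is absent from all rounds before `ℓ`, so it does not
matter which of these rounds it is. -/
theorem lowIndex_update_eq {N₁ N₂ : List (Fin n)} {i : Fin n} (hN : (N₁ ++ i :: N₂).Nodup)
    (σ : Fin n → Strategy m) (ψ : ℝ) (r : Fin n → Fin (searchRounds m + 1))
    {a b : Fin (searchRounds m + 1)} {ℓ : ℕ} (ha : ℓ ≤ a) (hb : ℓ ≤ b) :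
    lowIndex σ (N₁ ++ i :: N₂) ψ (Function.update r i a) ℓ =
      lowIndex σ (N₁ ++ i :: N₂) ψ (Function.update r i b) ℓ :=
  lowIndex_congr _ _ (fun k hk => by
    rw [roundBidders_append_cons_of_ne hN r (by omega),
      roundBidders_append_cons_of_ne hN r (by omega)]) fun _ _ _ _ => rfl

theorem IsSubadditive.le_sum_fibers {v : Finset (Fin m) → ℝ≥0} (hsub : IsSubadditive v)
    (hv : IsValuation v) {ι : Type*} [Fintype ι] [DecidableEq ι] (κ : Fin m → ι)
    (Y : Finset (Fin m)) : (v Y : ℝ) ≤ ∑ a, (v (Y.filter fun e => κ e = a) : ℝ) := by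
  have key : ∀ A : Finset ι, (v (Y.filter fun e => κ e ∈ A) : ℝ) ≤
      ∑ a ∈ A, (v (Y.filter fun e => κ e = a) : ℝ) := by
    intro A
    induction A using Finset.induction_on with
    | empty => simp [hv.empty]
    | insert a A ha ih =>
      rw [Finset.sum_insert ha]
      have h1 : Y.filter (fun e => κ e ∈ insert a A) =
          Y.filter (fun e => κ e = a) ∪ Y.filter (fun e => κ e ∈ A) := by
        ext e; simp only [Finset.mem_filter, Finset.mem_insert, Finset.mem_union]; tauto
      have h2 := NNReal.coe_le_coe.2 (hsub (Y.filter (fun e => κ e = a)) (Y.filter (fun e => κ e ∈ A)))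
      rw [h1]
      push_cast at h2
      linarith
  simpa using key Finset.univ

/-- The utility of a bidder in the auction of a round. -/
noncomputable def searchUtility (v : Fin n → Finset (Fin m) → ℝ≥0) (σ : Fin n → Strategy m)
    (N : List (Fin n)) (ψ : ℝ) (r : Fin n → Fin (searchRounds m + 1)) (ℓ : ℕ) (i : Fin n) : ℝ :=
  (v i (searchAlloc σ N ψ r ℓ i) : ℝ) - ∑ e ∈ searchAlloc σ N ψ r ℓ i, searchPrice σ N ψ r ℓ e

open Classical in
/-- What an item is sold for in the auction of a round. -/
noncomputable def searchRevenue (σ : Fin n → Strategy m) (N : List (Fin n)) (ψ : ℝ)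
    (r : Fin n → Fin (searchRounds m + 1)) (ℓ : ℕ) (e : Fin m) : ℝ :=
  if ∃ i, e ∈ searchAlloc σ N ψ r ℓ i then searchPrice σ N ψ r ℓ e else 0

theorem searchRevenue_nonneg (σ : Fin n → Strategy m) (N : List (Fin n)) {ψ : ℝ} (hψ : 0 ≤ ψ)
    (r : Fin n → Fin (searchRounds m + 1)) (ℓ : ℕ) (e : Fin m) :
    0 ≤ searchRevenue σ N ψ r ℓ e := by
  unfold searchRevenue
  split_ifs
  exacts [searchPrice_nonneg σ N hψ r ℓ e, le_rfl]

/-- The utilities that a bidder would have in the different rounds, together with the revenue from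
a bundle if the bidder is in the last round, make up for the value of the bundle. -/
theorem le_utilities_add_revenue {v : Fin n → Finset (Fin m) → ℝ≥0} {σ : Fin n → Strategy m}
    (hσ : ∀ i, (σ i).IsTruthful (v i)) {N : List (Fin n)} (hN : N.Nodup) {ψ : ℝ} (hψ : 0 ≤ ψ)
    {i : Fin n} (hi : i ∈ N) (hv : IsValuation (v i)) (hsub : IsSubadditive (v i))
    {O : Finset (Fin m)} {c : ℝ} (hO : HasSupportingPrices (v i) O c) (hOψ : v i O ≤ ψ)
    (r : Fin n → Fin (searchRounds m + 1)) :
    c - O.card * (ψ / 2 ^ (2 ^ searchRounds m - 1)) ≤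
      ∑ ℓ : Fin (searchRounds m + 1), searchUtility v σ N ψ (Function.update r i ℓ) ℓ i +
      2 * ∑ ℓ : Fin (searchRounds m + 1), ∑ e ∈ O,
        searchRevenue σ N ψ (Function.update r i (Fin.last _)) ℓ e := by
  obtain ⟨N₁, N₂, rfl⟩ := List.append_of_mem hi
  set N := N₁ ++ i :: N₂ with hNdef
  set s := ψ / 2 ^ (2 ^ searchRounds m - 1) with hs
  have hs0 : 0 ≤ s := by positivity
  -- Reference run: with `i` in the last round, no earlier auction contains `i`, so all prices are
  -- those of the other bidders.
  set r' := Function.update r i (Fin.last (searchRounds m)) with hr'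
  obtain ⟨lam, p, hlam, hlamO, hp, hsupp⟩ := hO
  choose j hj hjle hjge using fun e => exists_candidatePrice m (hp e).1 ((hp e).2.trans hOψ)
  set q : Fin m → ℝ := fun e => candidatePrice m ψ (j e) with hq
  set P : ℕ → Fin m → ℝ := searchPrice σ N ψ r' with hP
  set avail : ℕ → Finset (Fin m) := fun ℓ =>
    remainingItems σ (P ℓ) (roundBidders N₁ r ℓ) Finset.univ with havail
  have hlt : ∀ {ℓ}, ℓ < searchRounds m → ((Fin.last (searchRounds m) : Fin _) : ℕ) ≠ ℓ :=
    fun h => by simp; omega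
  -- `avail ℓ` is what the predecessors of `i` in round `ℓ` leave over. In particular, an item
  -- unsold in the reference run would be on offer to `i` in that round.
  have hsold : ∀ ℓ ≤ searchRounds m, ∀ e, e ∉ avail ℓ → ∃ k, e ∈ searchAlloc σ N ψ r' ℓ k := by
    intro ℓ hℓ e he
    have hnd := roundBidders_nodup hN r' ℓ
    rcases hℓ.eq_or_lt with rfl | hℓ
    · have h1 := roundBidders_append_cons_self hN r (Fin.last (searchRounds m))
      simp only [Fin.val_last] at h1
      rw [← hNdef, ← hr'] at h1
      rw [h1] at hnd
      obtain ⟨k, hk⟩ := exists_sold_of_notMem_remainingItems σ (P _) Finset.univ hnd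
        (Finset.mem_univ e) he
      exact ⟨k, by rw [searchAlloc, h1]; exact hk⟩
    · have h1 := roundBidders_append_cons_of_ne hN r (hlt hℓ)
      rw [← hNdef, ← hr'] at h1
      rw [h1] at hnd
      obtain ⟨k, hk⟩ := exists_sold_of_notMem_remainingItems σ (P _) Finset.univ hnd
        (Finset.mem_univ e) he
      exact ⟨k, by rw [searchAlloc, h1]; exact hk⟩
  -- If `i` were in round `ℓ`, the prices would be those of the reference run and the offer would be
  -- `avail ℓ`; a truthful demand beats every `S` in it.
  have hutil : ∀ ℓ : Fin (searchRounds m + 1), ∀ S ⊆ avail ℓ,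
      (v i S : ℝ) - ∑ e ∈ S, P ℓ e ≤ searchUtility v σ N ψ (Function.update r i ℓ) ℓ i := by
    intro ℓ S hS
    have hlow : searchPrice σ N ψ (Function.update r i ℓ) ℓ = P ℓ := by
      rw [hP, searchPrice, searchPrice, hNdef,
        lowIndex_update_eq hN σ ψ r (le_refl (ℓ : ℕ)) (b := Fin.last _) (by simp; omega)]
    have hiL : i ∉ roundBidders N₁ r ℓ := fun h => by
      have := List.disjoint_of_nodup_append hN (mem_roundBidders.1 h).1
      simp at this
    have hA : searchAlloc σ N ψ (Function.update r i ℓ) ℓ i =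
        (σ i).demand (avail ℓ) (P ℓ) := by
      rw [searchAlloc, hlow, hNdef, roundBidders_append_cons_self hN,
        fixedPriceAuction_append _ _ _ _ hiL]
    rw [searchUtility, hlow, hA]
    exact (hσ i).2 _ _ S hS
  have hrev : ∀ ℓ : Fin (searchRounds m + 1), ∀ e, (∃ k, e ∈ searchAlloc σ N ψ r' ℓ k) →
      searchRevenue σ N ψ r' ℓ e = P ℓ e := fun ℓ e h => if_pos h
  classical
  set T := O.filter (fun e => ∃ ℓ : Fin (searchRounds m + 1),
    (∃ k, e ∈ searchAlloc σ N ψ r' ℓ k) ∧ q e ≤ P ℓ e) with hT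
  -- `T` collects the items sold at their target price or more. For any other item, `κ e` is a round
  -- in which `i` could have bought it at no more than the target; the value `0` is a default.
  have hκ : ∀ e, ∃ ℓ : Fin (searchRounds m + 1), e ∈ O → e ∉ T → e ∈ avail ℓ ∧ P ℓ e ≤ q e := by
    intro e
    by_cases heO : e ∈ O
    swap
    · exact ⟨0, fun h => absurd h heO⟩
    by_cases heT : e ∈ T
    · exact ⟨0, fun _ h => absurd heT h⟩
    have hnT : ∀ ℓ : Fin (searchRounds m + 1), (∃ k, e ∈ searchAlloc σ N ψ r' ℓ k) →
        ¬ q e ≤ P ℓ e := fun ℓ h1 h2 => heT (Finset.mem_filter.2 ⟨heO, ℓ, h1, h2⟩)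
    rcases sold_or_unsold_or_correct σ N hψ r' e (hj e) with
      ⟨ℓ, hℓ, h1, h2⟩ | ⟨ℓ, hℓ, h1, h2⟩ | h
    · exact absurd h2 (hnT ⟨ℓ, by omega⟩ h1)
    · refine ⟨⟨ℓ, by omega⟩, fun _ _ => ⟨?_, h2⟩⟩
      by_contra hav
      exact h1 (hsold ℓ hℓ.le e hav)
    · refine ⟨Fin.last _, fun _ _ => ⟨?_, h.le⟩⟩
      by_contra hav
      exact hnT (Fin.last _) (hsold _ le_rfl e hav) h.ge
  choose κ hκ using hκ
  set Util := ∑ ℓ : Fin (searchRounds m + 1), searchUtility v σ N ψ (Function.update r i ℓ) ℓ i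
    with hUtil
  -- Split `S \ T` by the round `κ`; subadditivity makes the values of the pieces suffice, and each
  -- piece is affordable in its round.
  have hU : ∀ S ⊆ O, (v i (S \ T) : ℝ) - ∑ e ∈ S \ T, p e ≤ Util := by
    intro S hS
    have hmem : ∀ e ∈ S \ T, e ∈ avail (κ e) ∧ P (κ e) e ≤ q e := fun e he =>
      hκ e (hS (Finset.mem_sdiff.1 he).1) (Finset.mem_sdiff.1 he).2
    have h1 := hsub.le_sum_fibers hv κ (S \ T)
    have h2 : ∑ e ∈ S \ T, p e = ∑ ℓ, ∑ e ∈ (S \ T).filter (fun e => κ e = ℓ), p e :=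
      (Finset.sum_fiberwise _ _ _).symm
    calc (v i (S \ T) : ℝ) - ∑ e ∈ S \ T, p e
        ≤ ∑ ℓ, ((v i ((S \ T).filter (fun e => κ e = ℓ)) : ℝ) -
            ∑ e ∈ (S \ T).filter (fun e => κ e = ℓ), p e) := by
          rw [Finset.sum_sub_distrib, ← h2]; linarith
      _ ≤ Util := Finset.sum_le_sum fun ℓ _ => by
          refine le_trans ?_ (hutil ℓ ((S \ T).filter (fun e => κ e = ℓ)) fun e he => ?_)
          · have : ∑ e ∈ (S \ T).filter (fun e => κ e = ℓ), P ℓ e ≤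
                ∑ e ∈ (S \ T).filter (fun e => κ e = ℓ), p e := by
              refine Finset.sum_le_sum fun e he => ?_
              obtain ⟨he1, rfl⟩ := Finset.mem_filter.1 he
              exact (hmem e he1).2.trans (hjle e)
            linarith
          · obtain ⟨he1, rfl⟩ := Finset.mem_filter.1 he
            exact (hmem e he1).1
  have hUavg : ∑ S, lam S * ((v i (S \ T) : ℝ) - ∑ e ∈ S \ T, p e) ≤ Util := by
    calc ∑ S, lam S * ((v i (S \ T) : ℝ) - ∑ e ∈ S \ T, p e) ≤ ∑ S, lam S * Util :=
          Finset.sum_le_sum fun S _ => by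
            by_cases h0 : lam S = 0
            · simp [h0]
            · exact mul_le_mul_of_nonneg_left (hU S (hlamO S h0)) (hlam.nonneg S)
      _ = Util := by rw [← Finset.sum_mul, hlam.sum_eq_one, one_mul]
  have hTO : T ⊆ O := Finset.filter_subset _ _
  have h1 := hsupp T hTO
  have h2 : ∑ e ∈ T, p e ≤ 2 * ∑ e ∈ T, q e + O.card * s := by
    calc ∑ e ∈ T, p e ≤ ∑ e ∈ T, (2 * q e + s) := Finset.sum_le_sum fun e _ => hjge e
      _ = 2 * ∑ e ∈ T, q e + T.card * s := by
          rw [Finset.sum_add_distrib, ← Finset.mul_sum, Finset.sum_const, nsmul_eq_mul]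
      _ ≤ _ := by
          have : (T.card : ℝ) ≤ O.card := Nat.cast_le.2 (Finset.card_le_card hTO)
          nlinarith
  have h3 : ∑ e ∈ T, q e ≤ ∑ ℓ : Fin (searchRounds m + 1), ∑ e ∈ O, searchRevenue σ N ψ r' ℓ e := by
    rw [Finset.sum_comm]
    calc ∑ e ∈ T, q e ≤ ∑ e ∈ T, ∑ ℓ : Fin (searchRounds m + 1), searchRevenue σ N ψ r' ℓ e :=
          Finset.sum_le_sum fun e he => by
            obtain ⟨ℓ, hℓ1, hℓ2⟩ := (Finset.mem_filter.1 he).2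
            rw [← hrev ℓ e hℓ1] at hℓ2
            exact hℓ2.trans (Finset.single_le_sum
              (f := fun ℓ : Fin (searchRounds m + 1) => searchRevenue σ N ψ r' ℓ e)
              (fun ℓ _ => searchRevenue_nonneg σ N hψ r' ℓ e) (Finset.mem_univ ℓ))
      _ ≤ _ := Finset.sum_le_sum_of_subset_of_nonneg hTO fun e _ _ =>
          Finset.sum_nonneg fun ℓ _ => searchRevenue_nonneg σ N hψ r' ℓ e
  linarith

/-- Overwriting coordinate `i` hits each function with `r i = a` once for each forgotten value of
that coordinate. This turns counterfactual rounds into conditioning on the drawn round. -/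
theorem sum_update {R : Type*} [Fintype R] [DecidableEq R] (F : (Fin n → R) → ℝ) (i : Fin n)
    (a : R) : ∑ r, F (Function.update r i a) =
      Fintype.card R * ∑ r, if r i = a then F r else 0 := by
  have h1 : (Fintype.card R : ℝ) * (∑ r : Fin n → R, if r i = a then F r else 0) =
      ∑ x ∈ (Finset.univ : Finset R) ×ˢ (Finset.univ.filter fun r : Fin n → R => r i = a), F x.2 := by
    rw [Finset.sum_product]
    simp [← Finset.sum_filter]
  rw [h1]
  refine Finset.sum_nbij' (fun r => (r i, Function.update r i a))
    (fun x => Function.update x.2 i x.1) ?_ ?_ ?_ ?_ ?_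
  · intro r _; simp
  · intro x _; simp
  · intro r _; simp
  · rintro ⟨b, r⟩ hr
    simp only [Finset.mem_product, Finset.mem_univ, true_and, Finset.mem_filter] at hr
    simp [← hr]
  · intro r _; rfl

theorem sum_searchRevenue (σ : Fin n → Strategy m) (N : List (Fin n)) (ψ : ℝ)
    (r : Fin n → Fin (searchRounds m + 1)) (ℓ : ℕ) :
    ∑ e, searchRevenue σ N ψ r ℓ e =
      ∑ i, ∑ e ∈ searchAlloc σ N ψ r ℓ i, searchPrice σ N ψ r ℓ e := by
  classical
  have hd : IsAllocation (searchAlloc σ N ψ r ℓ) := fixedPriceAuction_isAllocation _ _ _ _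
  rw [← Finset.sum_biUnion fun i _ j _ hij => hd i j hij]
  simp only [searchRevenue]
  rw [← Finset.sum_filter]
  refine Finset.sum_congr ?_ fun _ _ => rfl
  ext e
  simp

/-- The welfare of the binary-search mechanism, summed over its random choices. -/
theorem sum_welfare_binarySearchMechanism {v : Fin n → Finset (Fin m) → ℝ≥0}
    {σ : Fin n → Strategy m} (hσ : ∀ i, (σ i).IsTruthful (v i)) {N : List (Fin n)} (hN : N.Nodup)
    {ψ : ℝ} (hψ : 0 ≤ ψ) (hv : ∀ i, IsValuation (v i)) (hsub : ∀ i, IsSubadditive (v i))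
    {O : Fin n → Finset (Fin m)} (hO : IsAllocation O) {c : Fin n → ℝ}
    (hc : ∀ i ∈ N, HasSupportingPrices (v i) (O i) (c i)) (hOψ : ∀ i ∈ N, v i (O i) ≤ ψ) :
    (Fintype.card (Fin n → Fin (searchRounds m + 1)) : ℝ) * (∑ i ∈ N.toFinset, c i - ψ) ≤
      2 * (searchRounds m + 1) * ∑ r : Fin n → Fin (searchRounds m + 1),
        ∑ ℓ, welfare v (binarySearchMechanism σ N ψ r ℓ).alloc := by
  set s := ψ / 2 ^ (2 ^ searchRounds m - 1) with hs
  have hs0 : 0 ≤ s := by positivity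
  -- The target bundles are disjoint, so their rounding errors add up to at most `m * s`.
  have hms : m * s ≤ ψ := by
    have h1 : (m : ℝ) ≤ 2 ^ (2 ^ searchRounds m - 1) := by exact_mod_cast le_two_pow_sub_one m
    rw [hs, mul_div_assoc', div_le_iff₀ (by positivity)]
    nlinarith
  have hcard : ∑ i ∈ N.toFinset, ((O i).card : ℝ) ≤ m := by
    have h1 : (N.toFinset.biUnion O).card = ∑ i ∈ N.toFinset, (O i).card :=
      Finset.card_biUnion fun i _ j _ hij => hO i j hij
    have h2 : (N.toFinset.biUnion O).card ≤ m := (Finset.card_le_univ _).trans_eq (by simp)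
    rw [h1] at h2
    exact_mod_cast h2
  have hunz : ∀ r ℓ i, 0 ≤ searchUtility v σ N ψ r ℓ i := by
    intro r ℓ i
    by_cases hi : i ∈ roundBidders N r ℓ
    · obtain ⟨L₁, L₂, hL⟩ := List.append_of_mem hi
      have hnd := roundBidders_nodup hN r ℓ
      rw [hL] at hnd
      have hiL : i ∉ L₁ := fun h => by
        have := List.disjoint_of_nodup_append hnd h
        simp at this
      rw [searchUtility, searchAlloc, hL, fixedPriceAuction_append _ _ _ _ hiL]
      have := (hσ i).2 (remainingItems σ (searchPrice σ N ψ r ℓ) L₁ Finset.univ)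
        (searchPrice σ N ψ r ℓ) ∅ (Finset.empty_subset _)
      simpa [(hv i).empty] using this
    · rw [searchUtility, searchAlloc, fixedPriceAuction_of_notMem _ _ _ hi]
      simp [(hv i).empty]
  have huz : ∀ r (ℓ : Fin (searchRounds m + 1)) i, r i ≠ ℓ → searchUtility v σ N ψ r ℓ i = 0 := by
    intro r ℓ i hne
    have hi : i ∉ roundBidders N r ℓ := fun h => hne (Fin.ext (mem_roundBidders.1 h).2)
    rw [searchUtility, searchAlloc, fixedPriceAuction_of_notMem _ _ _ hi]
    simp [(hv i).empty]
  -- Welfare is utility plus revenue; the factor 2 on the revenue comes from rounding prices down to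
  -- candidates.
  have hwel : ∀ (r : Fin n → Fin (searchRounds m + 1)) (ℓ : Fin (searchRounds m + 1)),
      ∑ i ∈ N.toFinset, searchUtility v σ N ψ r ℓ i +
        2 * ∑ i ∈ N.toFinset, ∑ e ∈ O i, searchRevenue σ N ψ r ℓ e ≤
      2 * welfare v (binarySearchMechanism σ N ψ r ℓ).alloc := by
    intro r ℓ
    have h1 : welfare v (binarySearchMechanism σ N ψ r ℓ).alloc =
        ∑ i, searchUtility v σ N ψ r ℓ i + ∑ e, searchRevenue σ N ψ r ℓ e := by
      rw [sum_searchRevenue, ← Finset.sum_add_distrib]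
      refine Finset.sum_congr rfl fun i _ => ?_
      rw [searchUtility, sub_add_cancel]
      rfl
    have h2 : ∑ i ∈ N.toFinset, searchUtility v σ N ψ r ℓ i ≤ ∑ i, searchUtility v σ N ψ r ℓ i :=
      Finset.sum_le_sum_of_subset_of_nonneg (Finset.subset_univ _) fun i _ _ => hunz r ℓ i
    have h3 : 0 ≤ ∑ i, searchUtility v σ N ψ r ℓ i := Finset.sum_nonneg fun i _ => hunz r ℓ i
    have h4 : ∑ i ∈ N.toFinset, ∑ e ∈ O i, searchRevenue σ N ψ r ℓ e ≤
        ∑ e, searchRevenue σ N ψ r ℓ e := by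
      rw [← Finset.sum_biUnion fun i _ j _ hij => hO i j hij]
      exact Finset.sum_le_sum_of_subset_of_nonneg (Finset.subset_univ _)
        fun e _ _ => searchRevenue_nonneg σ N hψ r ℓ e
    linarith
  have hmain : ∀ i ∈ N.toFinset,
      (Fintype.card (Fin n → Fin (searchRounds m + 1)) : ℝ) * (c i - (O i).card * s) ≤
      (searchRounds m + 1) * ∑ r : Fin n → Fin (searchRounds m + 1),
        ∑ ℓ : Fin (searchRounds m + 1), (searchUtility v σ N ψ r ℓ i +
          2 * ∑ e ∈ O i, searchRevenue σ N ψ r ℓ e) := by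
    intro i hi
    rw [List.mem_toFinset] at hi
    have h1 := Finset.sum_le_sum fun (r : Fin n → Fin (searchRounds m + 1)) (_ : r ∈ Finset.univ) =>
      le_utilities_add_revenue hσ hN hψ hi (hv i) (hsub i) (hc i hi) (hOψ i hi) r
    rw [Finset.sum_const, Finset.card_univ, nsmul_eq_mul] at h1
    refine h1.trans ?_
    rw [Finset.sum_add_distrib, ← Finset.mul_sum]
    -- An equality, because the utility in round `ℓ` vanishes unless `r i = ℓ`.
    have h2 : ∑ r : Fin n → Fin (searchRounds m + 1), ∑ ℓ : Fin (searchRounds m + 1),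
        searchUtility v σ N ψ (Function.update r i ℓ) ℓ i =
        (searchRounds m + 1) * ∑ r : Fin n → Fin (searchRounds m + 1),
          ∑ ℓ : Fin (searchRounds m + 1), searchUtility v σ N ψ r ℓ i := by
      rw [Finset.sum_comm, Finset.sum_comm (s := (Finset.univ : Finset (Fin n → _))),
        Finset.mul_sum]
      refine Finset.sum_congr rfl fun ℓ _ => ?_
      rw [sum_update (fun r => searchUtility v σ N ψ r ℓ i) i ℓ]
      have : (Fintype.card (Fin (searchRounds m + 1)) : ℝ) = searchRounds m + 1 := by simp
      rw [this]
      congr 1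
      refine Finset.sum_congr rfl fun r _ => ?_
      split_ifs with h
      · rfl
      · exact (huz r ℓ i h).symm
    -- Only the draws with `r i` the last round are needed; the nonnegative revenue of the others is
    -- added for free.
    have h3 : ∑ r : Fin n → Fin (searchRounds m + 1), ∑ ℓ : Fin (searchRounds m + 1), ∑ e ∈ O i,
        searchRevenue σ N ψ (Function.update r i (Fin.last _)) ℓ e ≤
        (searchRounds m + 1) * ∑ r : Fin n → Fin (searchRounds m + 1),
          ∑ ℓ : Fin (searchRounds m + 1), ∑ e ∈ O i, searchRevenue σ N ψ r ℓ e := by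
      rw [sum_update (fun r => ∑ ℓ : Fin (searchRounds m + 1), ∑ e ∈ O i,
        searchRevenue σ N ψ r ℓ e) i (Fin.last _)]
      have : (Fintype.card (Fin (searchRounds m + 1)) : ℝ) = searchRounds m + 1 := by simp
      rw [this]
      refine mul_le_mul_of_nonneg_left (Finset.sum_le_sum fun r _ => ?_) (by positivity)
      split_ifs
      · exact le_rfl
      · exact Finset.sum_nonneg fun ℓ _ => Finset.sum_nonneg fun e _ =>
          searchRevenue_nonneg σ N hψ r ℓ e
    simp_rw [Finset.sum_add_distrib, ← Finset.mul_sum]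
    rw [h2]
    linarith
  calc (Fintype.card (Fin n → Fin (searchRounds m + 1)) : ℝ) * (∑ i ∈ N.toFinset, c i - ψ)
      ≤ (Fintype.card (Fin n → Fin (searchRounds m + 1)) : ℝ) *
          ∑ i ∈ N.toFinset, (c i - (O i).card * s) := by
        refine mul_le_mul_of_nonneg_left ?_ (Nat.cast_nonneg _)
        rw [Finset.sum_sub_distrib, ← Finset.sum_mul]
        nlinarith
    _ ≤ ∑ i ∈ N.toFinset, (searchRounds m + 1) * ∑ r : Fin n → Fin (searchRounds m + 1),
        ∑ ℓ : Fin (searchRounds m + 1), (searchUtility v σ N ψ r ℓ i +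
          2 * ∑ e ∈ O i, searchRevenue σ N ψ r ℓ e) := by
        rw [Finset.mul_sum]; exact Finset.sum_le_sum hmain
    _ = (searchRounds m + 1) * ∑ r : Fin n → Fin (searchRounds m + 1),
        ∑ ℓ : Fin (searchRounds m + 1), (∑ i ∈ N.toFinset, searchUtility v σ N ψ r ℓ i +
          2 * ∑ i ∈ N.toFinset, ∑ e ∈ O i, searchRevenue σ N ψ r ℓ e) := by
        rw [← Finset.mul_sum, Finset.sum_comm]
        congr 1
        refine Finset.sum_congr rfl fun r _ => ?_
        rw [Finset.sum_comm]
        refine Finset.sum_congr rfl fun ℓ _ => ?_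
        rw [Finset.sum_add_distrib, Finset.mul_sum]
    _ ≤ (searchRounds m + 1) * ∑ r : Fin n → Fin (searchRounds m + 1),
        ∑ ℓ : Fin (searchRounds m + 1), 2 * welfare v (binarySearchMechanism σ N ψ r ℓ).alloc :=
        mul_le_mul_of_nonneg_left (Finset.sum_le_sum fun r _ => Finset.sum_le_sum fun ℓ _ =>
          hwel r ℓ) (by positivity)
    _ = _ := by
        simp_rw [← Finset.mul_sum]
        ring

end BinarySearch

/-! ## Welfare of the final mechanism -/

section FinalWelfare

variable {n m : ℕ}

theorem welfare_nonneg (v : Fin n → Finset (Fin m) → ℝ≥0) (A : Fin n → Finset (Fin m)) :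
    0 ≤ welfare v A := Finset.sum_nonneg fun _ _ => NNReal.coe_nonneg _

theorem le_welfare_secondPriceAuction {v : Fin n → Finset (Fin m) → ℝ≥0} {N : Finset (Fin n)}
    {t : Fin n} (ht : t ∈ N) :
    (v t Finset.univ : ℝ) ≤
      welfare v (secondPriceAuction N fun i => v i Finset.univ).alloc := by
  classical
  set bid : Fin n → ℝ≥0 := fun i => v i Finset.univ with hbid
  obtain ⟨a, haN, ha⟩ := Finset.exists_max_image N bid ⟨t, ht⟩
  set s := N.filter (fun i => bid i = bid a) with hs
  have hsne : s.Nonempty := ⟨a, Finset.mem_filter.2 ⟨haN, rfl⟩⟩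
  have hw := Finset.mem_filter.1 (s.min'_mem hsne)
  set w := s.min' hsne with hwdef
  have hwins : w ∈ N ∧ ∀ j ∈ N, bid j < bid w ∨ (bid j = bid w ∧ w ≤ j) := by
    refine ⟨hw.1, fun j hj => ?_⟩
    rw [hw.2]
    rcases (ha j hj).lt_or_eq with h | h
    · exact Or.inl h
    · exact Or.inr ⟨h, s.min'_le j (Finset.mem_filter.2 ⟨hj, h⟩)⟩
  have h1 : (v w ((secondPriceAuction N bid).alloc w) : ℝ) = bid w := by
    simp only [secondPriceAuction]
    rw [if_pos hwins]
  calc (v t Finset.univ : ℝ) ≤ bid w := by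
        rw [hw.2]; exact NNReal.coe_le_coe.2 (ha t ht)
    _ = (v w ((secondPriceAuction N bid).alloc w) : ℝ) := h1.symm
    _ ≤ _ := Finset.single_le_sum (f := fun i => (v i ((secondPriceAuction N bid).alloc i) : ℝ))
        (fun i _ => NNReal.coe_nonneg _) (Finset.mem_univ w)

theorem expectedWelfare_finalMechanism_nonneg (v : Fin n → Finset (Fin m) → ℝ≥0)
    (σ : Fin n → Strategy m) : 0 ≤ (finalMechanism n m).expectedWelfare v σ :=
  div_nonneg (Finset.sum_nonneg fun _ _ => welfare_nonneg _ _) (Nat.cast_nonneg _)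

/-- Multiplying by the number of seeds avoids divisions. The second-price outcome ignores `r` and
`rstar`, hence its multiplicity. -/
theorem expectedWelfare_finalMechanism {v : Fin n → Finset (Fin m) → ℝ≥0}
    {σ : Fin n → Strategy m} (hσ : ∀ i, (σ i).IsTruthful (v i)) :
    (finalMechanism n m).expectedWelfare v σ *
      (2 ^ n * 2 * (Fintype.card (Fin n → Fin (searchRounds m + 1)) : ℝ) * (searchRounds m + 1)) =
    ∑ h : Fin n → Bool,
      ((Fintype.card (Fin n → Fin (searchRounds m + 1)) : ℝ) * (searchRounds m + 1) *
        welfare v (secondPriceAuction (Finset.univ.filter fun i => h i = true)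
          fun i => v i Finset.univ).alloc +
      ∑ r : Fin n → Fin (searchRounds m + 1), ∑ ℓ,
        welfare v (binarySearchMechanism σ ((List.finRange n).filter fun i => h i = false)
          (((Finset.univ.filter fun i => h i = true).sup fun i => v i Finset.univ : ℝ≥0) : ℝ)
          r ℓ).alloc) := by
  have hcard : (Fintype.card (finalMechanism n m).Seed : ℝ) =
      2 ^ n * 2 * (Fintype.card (Fin n → Fin (searchRounds m + 1)) : ℝ) * (searchRounds m + 1) := by
    have : Fintype.card (finalMechanism n m).Seed = Fintype.card ((Fin n → Bool) × Bool ×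
      (Fin n → Fin (searchRounds m + 1)) × Fin (searchRounds m + 1)) := rfl
    rw [this]
    simp only [Fintype.card_prod, Fintype.card_pi, Fintype.card_bool, Fintype.card_fin,
      Finset.prod_const, Finset.card_univ]
    push_cast
    ring
  have hbid : (fun i => (σ i).value Finset.univ) = fun i => v i Finset.univ :=
    funext fun i => (hσ i).1 _
  have hpos : (0 : ℝ) < Fintype.card (finalMechanism n m).Seed := by
    exact_mod_cast Fintype.card_pos
  rw [RandomizedMechanism.expectedWelfare, ← hcard, div_mul_cancel₀ _ hpos.ne']
  change ∑ s : (Fin n → Bool) × Bool × (Fin n → Fin (searchRounds m + 1)) ×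
    Fin (searchRounds m + 1), _ = _
  rw [Fintype.sum_prod_type]
  refine Finset.sum_congr rfl fun h _ => ?_
  rw [Fintype.sum_prod_type, Fintype.sum_bool]
  simp only [finalMechanism, hbid]
  congr 1
  · simp
  · rw [Fintype.sum_prod_type]
    simp

theorem sum_bool_indicator (t : Fin n) (b : Bool) :
    ∑ h : Fin n → Bool, (if h t = b then (1 : ℝ) else 0) = 2 ^ n / 2 := by
  have h := sum_update (fun _ : Fin n → Bool => (1 : ℝ)) t b
  simp at h
  simp
  linarith

theorem sum_bool_indicator_and {t i : Fin n} (hti : i ≠ t) :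
    ∑ h : Fin n → Bool, (if h t = true then (if h i = false then (1 : ℝ) else 0) else 0) =
      2 ^ n / 4 := by
  have h := sum_update (fun h : Fin n → Bool => if h i = false then (1 : ℝ) else 0) t true
  simp only [Function.update_of_ne hti, sum_bool_indicator, Fintype.card_bool] at h
  push_cast at h
  linarith

/-- The approximation guarantee, in terms of the quality of the supporting prices. -/
theorem optimalWelfare_le_mul_expectedWelfare {v : Fin n → Finset (Fin m) → ℝ≥0}
    {σ : Fin n → Strategy m} (hσ : ∀ i, (σ i).IsTruthful (v i)) (hv : ∀ i, IsValuation (v i))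
    (hsub : ∀ i, IsSubadditive (v i)) {b : ℝ} (hb : 1 ≤ b)
    (hsupp : ∀ i U, HasSupportingPrices (v i) U (v i U / b)) :
    optimalWelfare v ≤
      16 * b * (searchRounds m + 1) ^ 2 * (finalMechanism n m).expectedWelfare v σ := by
  classical
  have hE := expectedWelfare_finalMechanism_nonneg v σ
  have : Nonempty {A : Fin n → Finset (Fin m) // IsAllocation A} :=
    ⟨⟨fun _ => ∅, fun _ _ _ => by simp⟩⟩
  refine ciSup_le fun ⟨O, hO⟩ => ?_
  rcases isEmpty_or_nonempty (Fin n) with hn | hn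
  · simp only [welfare, Finset.univ_eq_empty, Finset.sum_empty]
    positivity
  obtain ⟨t, -, ht⟩ := Finset.exists_max_image Finset.univ (fun i => v i Finset.univ)
    (Finset.univ_nonempty (α := Fin n))
  set V : ℝ := ((v t Finset.univ : ℝ≥0) : ℝ) with hV
  have hV0 : 0 ≤ V := NNReal.coe_nonneg _
  set c : Fin n → ℝ := fun i => v i (O i) / b with hc
  have hc0 : ∀ i, 0 ≤ c i := fun i => div_nonneg (NNReal.coe_nonneg _) (by linarith)
  set B : ℝ := (Fintype.card (Fin n → Fin (searchRounds m + 1)) : ℝ) with hB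
  have hBpos : 0 < B := by rw [hB]; exact_mod_cast Fintype.card_pos
  set q : ℝ := (searchRounds m : ℝ) + 1 with hq
  have hq1 : 1 ≤ q := by
    have : (0 : ℝ) ≤ searchRounds m := Nat.cast_nonneg _
    linarith
  set X : ℝ := ∑ i ∈ Finset.univ.erase t, c i with hX
  have hkey := expectedWelfare_finalMechanism (n := n) (m := m) hσ
  rw [← hB, ← hq] at hkey
  set E := (finalMechanism n m).expectedWelfare v σ with hEdef
  set SPA : (Fin n → Bool) → ℝ := fun h => welfare v (secondPriceAuction
    (Finset.univ.filter fun i => h i = true) fun i => v i Finset.univ).alloc with hSPA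
  set BS : (Fin n → Bool) → ℝ := fun h => ∑ r : Fin n → Fin (searchRounds m + 1), ∑ ℓ,
    welfare v (binarySearchMechanism σ ((List.finRange n).filter fun i => h i = false)
      (((Finset.univ.filter fun i => h i = true).sup fun i => v i Finset.univ : ℝ≥0) : ℝ)
      r ℓ).alloc with hBS
  -- Only splits with `t` split off are used: then `ψ = V`, and the second-price term, bounded below
  -- by `V`, is large enough to absorb the error `-V` of the search.
  have hpoint : ∀ h : Fin n → Bool,
      (if h t = true then 2 * q ^ 2 * B * V + B * (∑ i ∈ Finset.univ.erase t,
        (if h i = false then c i else 0) - V) else 0) ≤ 2 * q * (B * q * SPA h + BS h) := by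
    intro h
    have hS0 : 0 ≤ SPA h := welfare_nonneg _ _
    have hB0 : 0 ≤ BS h := Finset.sum_nonneg fun _ _ => Finset.sum_nonneg fun _ _ =>
      welfare_nonneg _ _
    split_ifs with hh
    · have htN : t ∈ Finset.univ.filter (fun i => h i = true) := by simpa using hh
      have h1 : V ≤ SPA h := le_welfare_secondPriceAuction htN
      have hψ : ((Finset.univ.filter fun i => h i = true).sup fun i => v i Finset.univ) =
          v t Finset.univ :=
        le_antisymm (Finset.sup_le fun i _ => ht i (Finset.mem_univ i))
          (Finset.le_sup (f := fun i => v i Finset.univ) htN)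
      have h2 := sum_welfare_binarySearchMechanism hσ
        (N := (List.finRange n).filter fun i => h i = false) ((List.nodup_finRange n).filter _)
        hV0 hv hsub hO (c := c) (fun i _ => hsupp i (O i)) (fun i _ => NNReal.coe_le_coe.2
          (((hv i).mono _ _ (Finset.subset_univ _)).trans (ht i (Finset.mem_univ i))))
      have h3 : BS h = ∑ r : Fin n → Fin (searchRounds m + 1), ∑ ℓ, welfare v
          (binarySearchMechanism σ ((List.finRange n).filter fun i => h i = false) V r ℓ).alloc := by
        simp only [hBS, hψ, hV]
      rw [← h3, ← hB, ← hq] at h2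
      have h4 : ∑ i ∈ ((List.finRange n).filter fun i => h i = false).toFinset, c i =
          ∑ i ∈ Finset.univ.erase t, (if h i = false then c i else 0) := by
        rw [← Finset.sum_filter]
        refine Finset.sum_congr ?_ fun _ _ => rfl
        ext i
        simp only [List.mem_toFinset, List.mem_filter, List.mem_finRange, true_and,
          decide_eq_true_eq, Finset.mem_filter, Finset.mem_erase, Finset.mem_univ, and_true]
        constructor
        · intro hi
          exact ⟨by rintro rfl; simp [hh] at hi, hi⟩
        · exact fun hi => hi.2
      rw [h4] at h2
      have h5 : 2 * q ^ 2 * B * V ≤ 2 * q ^ 2 * B * SPA h :=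
        mul_le_mul_of_nonneg_left h1 (by positivity)
      linarith
    · positivity
  have hsum := Finset.sum_le_sum fun (h : Fin n → Bool) (_ : h ∈ Finset.univ) => hpoint h
  rw [← Finset.mul_sum, ← hkey] at hsum
  have hsplit : ∀ h : Fin n → Bool,
      (if h t = true then 2 * q ^ 2 * B * V + B * (∑ i ∈ Finset.univ.erase t,
        (if h i = false then c i else 0) - V) else 0) =
      (2 * q ^ 2 * B * V - B * V) * (if h t = true then 1 else 0) +
        B * ∑ i ∈ Finset.univ.erase t, c i *
          (if h t = true then (if h i = false then (1 : ℝ) else 0) else 0) := by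
    intro h
    split_ifs
    · simp only [mul_ite, mul_one, mul_zero]; ring
    · simp
  simp_rw [hsplit] at hsum
  rw [Finset.sum_add_distrib, ← Finset.mul_sum, ← Finset.mul_sum, sum_bool_indicator,
    Finset.sum_comm] at hsum
  simp_rw [← Finset.mul_sum] at hsum
  have hinner : ∑ i ∈ Finset.univ.erase t, c i * ∑ h : Fin n → Bool,
      (if h t = true then (if h i = false then (1 : ℝ) else 0) else 0) = X * (2 ^ n / 4) := by
    rw [hX, Finset.sum_mul]
    exact Finset.sum_congr rfl fun i hi => by
      rw [sum_bool_indicator_and (Finset.ne_of_mem_erase hi)]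
  rw [hinner] at hsum
  have hP : (0 : ℝ) < 2 ^ n * B := by positivity
  -- `t` is split off in half of all splits, and in a quarter of them `t` is split off while a given
  -- other bidder is not.
  have hmain : q ^ 2 * V - V / 2 + X / 4 ≤ 4 * q ^ 2 * E := by
    refine le_of_mul_le_mul_left ?_ hP
    nlinarith
  have hOPT : welfare v O ≤ V + b * X := by
    rw [welfare, ← Finset.add_sum_erase _ _ (Finset.mem_univ t), hX, Finset.mul_sum]
    refine add_le_add (NNReal.coe_le_coe.2 ((hv t).mono _ _ (Finset.subset_univ _)))
      (Finset.sum_le_sum fun i _ => ?_)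
    rw [hc]
    have : b ≠ 0 := by linarith
    exact le_of_eq (by field_simp)
  have hqq : V ≤ q ^ 2 * V := le_mul_of_one_le_left hV0 (by nlinarith)
  calc welfare v O ≤ V + b * X := hOPT
    _ ≤ b * (2 * V + X) := by nlinarith
    _ ≤ b * (16 * q ^ 2 * E) := mul_le_mul_of_nonneg_left (by linarith) (by linarith)
    _ = _ := by ring

/-- Two nested logarithms. Since `log 3 > 1`, `log (log m)` is bounded below by a positive constant
for `m ≥ 3`, which absorbs the additive constants. -/
theorem searchRounds_add_one_le : ∃ C : ℝ, 0 < C ∧ ∀ m : ℕ, 3 ≤ m →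
    (searchRounds m : ℝ) + 1 ≤ C * Real.log (Real.log m) := by
  have hlog3 : 1 < Real.log 3 := by
    rw [Real.lt_log_iff_exp_lt (by norm_num)]
    exact Real.exp_one_lt_d9.trans (by norm_num)
  have hL0 : 0 < Real.log (Real.log 3) := Real.log_pos hlog3
  have h10 : 0 < Real.log 10 := Real.log_pos (by norm_num)
  have hlog2 : 1 / 2 < Real.log 2 := by linarith [Real.log_two_gt_d9]
  have hclog : ∀ x : ℕ, 1 < x → (Nat.clog 2 x : ℝ) ≤ 2 * Real.log x + 1 := by
    intro x hx
    have h1 : 2 ^ (Nat.clog 2 x - 1) < x := Nat.pow_pred_clog_lt_self (by norm_num) hx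
    have h2 : ((2 ^ (Nat.clog 2 x - 1) : ℕ) : ℝ) ≤ x := Nat.cast_le.2 h1.le
    have h3 := Real.log_le_log (by positivity) h2
    push_cast at h3
    rw [Real.log_pow] at h3
    have h4 : (Nat.clog 2 x : ℝ) ≤ ((Nat.clog 2 x - 1 : ℕ) : ℝ) + 1 := by
      exact_mod_cast (by omega : Nat.clog 2 x ≤ (Nat.clog 2 x - 1) + 1)
    have h5 : (0 : ℝ) ≤ ((Nat.clog 2 x - 1 : ℕ) : ℝ) := Nat.cast_nonneg _
    nlinarith
  refine ⟨(2 + 2 * Real.log 10) / Real.log (Real.log 3) + 2, by positivity, fun m hm => ?_⟩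
  have hm3 : (3 : ℝ) ≤ m := by exact_mod_cast hm
  have hlogm : Real.log 3 ≤ Real.log m := Real.log_le_log (by norm_num) hm3
  have hLL : Real.log (Real.log 3) ≤ Real.log (Real.log m) :=
    Real.log_le_log (by linarith) hlogm
  have h1 := hclog m (by omega)
  have hcpos : 0 < Nat.clog 2 m := Nat.clog_pos (by norm_num) (by omega)
  have h2 := hclog (3 * Nat.clog 2 m + 1) (by omega)
  have h3 : ((3 * Nat.clog 2 m + 1 : ℕ) : ℝ) ≤ 10 * Real.log m := by push_cast; linarith
  have h4 := Real.log_le_log (by positivity) h3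
  rw [Real.log_mul (by norm_num) (by linarith)] at h4
  have h5 : 2 + 2 * Real.log 10 ≤
      (2 + 2 * Real.log 10) / Real.log (Real.log 3) * Real.log (Real.log m) := by
    rw [div_mul_eq_mul_div, le_div_iff₀ hL0]
    exact mul_le_mul_of_nonneg_left hLL (by linarith)
  rw [searchRounds, add_mul]
  linarith

/-- The number of search rounds also serves as the number of squarings in the subadditive case. -/
theorem four_mul_le_two_pow_two_pow {m : ℕ} (hm : 3 ≤ m) : 4 * m ≤ 2 ^ 2 ^ searchRounds m := by
  have h := three_mul_clog_lt m
  have hcpos : 0 < Nat.clog 2 m := Nat.clog_pos (by norm_num) (by omega)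
  calc 4 * m ≤ 2 ^ 2 * 2 ^ Nat.clog 2 m :=
        Nat.mul_le_mul (by norm_num) (Nat.le_pow_clog (by norm_num) m)
    _ = 2 ^ (2 + Nat.clog 2 m) := (pow_add _ _ _).symm
    _ ≤ _ := Nat.pow_le_pow_right (by norm_num) (by omega)

theorem exists_approximation_constant : ∃ C : ℝ, 0 < C ∧ ∀ n m : ℕ, 3 ≤ m →
    ∀ v : Fin n → Finset (Fin m) → ℝ≥0, (∀ i, IsValuation (v i)) →
    ∀ σ : Fin n → Strategy m, (∀ i, (σ i).IsTruthful (v i)) →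
      ((∀ i, IsSubadditive (v i)) →
        optimalWelfare v ≤
          C * Real.log (Real.log m) ^ 3 * (finalMechanism n m).expectedWelfare v σ) ∧
      ((∀ i, IsXOS (v i)) →
        optimalWelfare v ≤
          C * Real.log (Real.log m) ^ 2 * (finalMechanism n m).expectedWelfare v σ) ∧
      ((∀ i, IsSubmodular (v i)) →
        optimalWelfare v ≤
          C * Real.log (Real.log m) ^ 2 * (finalMechanism n m).expectedWelfare v σ) := by
  obtain ⟨D, hD, hDle⟩ := searchRounds_add_one_le
  -- `64` comes from `16 * (4 * β + 1) ≤ 64 * (β + 1)` in the subadditive case, `32` from `16 * 2`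
  -- in the other two.
  refine ⟨64 * D ^ 3 + 32 * D ^ 2, by positivity, fun n m hm v hv σ hσ => ?_⟩
  have hE := expectedWelfare_finalMechanism_nonneg v σ
  set E := (finalMechanism n m).expectedWelfare v σ
  have hq := hDle m hm
  set L := Real.log (Real.log m)
  have hβ : (0 : ℝ) ≤ searchRounds m := Nat.cast_nonneg _
  have hL : 0 ≤ L := by
    by_contra hneg
    nlinarith
  have hq2 : ((searchRounds m : ℝ) + 1) ^ 2 ≤ D ^ 2 * L ^ 2 := by
    rw [← mul_pow]; exact pow_le_pow_left₀ (by positivity) hq 2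
  have hq3 : ((searchRounds m : ℝ) + 1) ^ 3 ≤ D ^ 3 * L ^ 3 := by
    rw [← mul_pow]; exact pow_le_pow_left₀ (by positivity) hq 3
  have hquad : 16 * 2 * ((searchRounds m : ℝ) + 1) ^ 2 * E ≤
      (64 * D ^ 3 + 32 * D ^ 2) * L ^ 2 * E := by
    refine mul_le_mul_of_nonneg_right ?_ hE
    have : 0 ≤ D ^ 3 * L ^ 2 := by positivity
    linarith
  refine ⟨fun hsub => ?_, fun hxos => ?_, fun hsubm => ?_⟩
  · refine (optimalWelfare_le_mul_expectedWelfare hσ hv hsub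
      (b := 4 * (searchRounds m : ℝ) + 1) (by linarith) fun i U =>
        (hsub i).hasSupportingPrices (hv i) U (four_mul_le_two_pow_two_pow hm)).trans ?_
    refine mul_le_mul_of_nonneg_right ?_ hE
    have h1 : 0 ≤ D ^ 2 * L ^ 3 := by positivity
    have h2 : 0 ≤ ((searchRounds m : ℝ) + 1) ^ 2 := by positivity
    nlinarith
  · exact (optimalWelfare_le_mul_expectedWelfare hσ hv (fun i => (hxos i).isSubadditive)
      (by norm_num) fun i U => (hxos i).hasSupportingPrices U).trans hquad
  · exact (optimalWelfare_le_mul_expectedWelfare hσ hv (fun i => (hsubm i).isSubadditive)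
      (by norm_num) fun i U => (hsubm i).hasSupportingPrices (hv i) U).trans hquad

end FinalWelfare

/-! ## Semantics of programs -/

section Semantics

variable {n m : ℕ}

section Memory

@[simp] theorem Memory.tick_nat (μ : Memory) (c : ℕ) : (μ.tick c).nat = μ.nat := rfl
@[simp] theorem Memory.tick_real (μ : Memory) (c : ℕ) : (μ.tick c).real = μ.real := rfl
@[simp] theorem Memory.tick_queries (μ : Memory) (c : ℕ) : (μ.tick c).queries = μ.queries := rfl
@[simp] theorem Memory.countQuery_nat (μ : Memory) (b : ℕ) : (μ.countQuery b).nat = μ.nat := rfl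
@[simp] theorem Memory.countQuery_real (μ : Memory) (b : ℕ) : (μ.countQuery b).real = μ.real := rfl
@[simp] theorem Memory.countQuery_queries (μ : Memory) (b i : ℕ) :
    (μ.countQuery b).queries i = if i = b then μ.queries i + 1 else μ.queries i := by
  by_cases h : i = b
  · subst h; simp [Memory.countQuery]
  · simp [Memory.countQuery, h]
@[simp] theorem Memory.setNat_nat (μ : Memory) (a i x b j : ℕ) :
    (μ.setNat a i x).nat b j = if b = a ∧ j = i then x else μ.nat b j := by
  by_cases h : b = a
  · subst h
    by_cases h' : j = i
    · subst h'; simp [Memory.setNat]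
    · simp [Memory.setNat, h']
  · simp [Memory.setNat, h]
@[simp] theorem Memory.setNat_real (μ : Memory) (a i x : ℕ) : (μ.setNat a i x).real = μ.real := rfl
@[simp] theorem Memory.setNat_queries (μ : Memory) (a i x : ℕ) :
    (μ.setNat a i x).queries = μ.queries := rfl
@[simp] theorem Memory.setReal_real (μ : Memory) (a i : ℕ) (x : ℝ) (b j : ℕ) :
    (μ.setReal a i x).real b j = if b = a ∧ j = i then x else μ.real b j := by
  by_cases h : b = a
  · subst h
    by_cases h' : j = i
    · subst h'; simp [Memory.setReal]
    · simp [Memory.setReal, h']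
  · simp [Memory.setReal, h]
@[simp] theorem Memory.setReal_nat (μ : Memory) (a i : ℕ) (x : ℝ) :
    (μ.setReal a i x).nat = μ.nat := rfl
@[simp] theorem Memory.setReal_queries (μ : Memory) (a i : ℕ) (x : ℝ) :
    (μ.setReal a i x).queries = μ.queries := rfl
@[simp] theorem Memory.setBundle_real (μ : Memory) (a : ℕ) (S : Finset (Fin m)) :
    (μ.setBundle a S).real = μ.real := rfl
@[simp] theorem Memory.setBundle_queries (μ : Memory) (a : ℕ) (S : Finset (Fin m)) :
    (μ.setBundle a S).queries = μ.queries := rfl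
theorem Memory.setBundle_nat_of_ne (μ : Memory) {a b : ℕ} (S : Finset (Fin m)) (h : b ≠ a) :
    (μ.setBundle a S).nat b = μ.nat b := by
  simp [Memory.setBundle, h]
theorem Memory.setBundle_nat_self (μ : Memory) (a : ℕ) (S : Finset (Fin m)) (e : Fin m) :
    (μ.setBundle a S).nat a e = if e ∈ S then 1 else 0 := by
  simp [Memory.setBundle]

end Memory

/-! ### Deterministic programs -/

/-- The syntactic checks on programs are Boolean, so that for concrete programs they hold by `rfl`.
-/
def Program.drawFree : Program → Bool
  | .draw _ _ _ => false
  | .seq P Q => P.drawFree && Q.drawFree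
  | .cond _ P Q => P.drawFree && Q.drawFree
  | .loop _ _ P => P.drawFree
  | _ => true

def Program.queryFree : Program → Bool
  | .askValue _ _ _ _ => false
  | .askDemand _ _ _ _ => false
  | .seq P Q => P.queryFree && Q.queryFree
  | .cond _ P Q => P.queryFree && Q.queryFree
  | .loop _ _ P => P.queryFree
  | _ => true

/-- Whether a program may write into a number array. -/
def Program.writesNat (a : ℕ) : Program → Bool
  | .setNat b _ _ => a == b
  | .draw b _ _ => a == b
  | .askDemand _ _ _ b => a == b
  | .seq P Q => P.writesNat a || Q.writesNat a
  | .cond _ P Q => P.writesNat a || Q.writesNat a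
  | .loop x _ P => a == x || P.writesNat a
  | _ => false

/-- Whether a program may write into a real array. -/
def Program.writesReal (a : ℕ) : Program → Bool
  | .setReal b _ _ => a == b
  | .askValue _ _ b _ => a == b
  | .seq P Q => P.writesReal a || Q.writesReal a
  | .cond _ P Q => P.writesReal a || Q.writesReal a
  | .loop _ _ P => P.writesReal a
  | _ => false

noncomputable def iterateDet (f : ℕ → Memory → Memory) : ℕ → Memory → Memory
  | 0, μ => μ
  | k + 1, μ => f k (iterateDet f k μ)

open Classical in
/-- The memory after a run of a program without draws. -/
noncomputable def Program.det (σ : Fin n → Strategy m) : Program → Memory → Memory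
  | .skip, μ => μ.tick 1
  | .setNat a i x, μ => (μ.tick 1).setNat a (i.eval μ) (x.eval μ)
  | .setReal a i x, μ => (μ.tick 1).setReal a (i.eval μ) (x.eval μ)
  -- A default value; `Program.exec_eq_pure_det` assumes that there are no draws.
  | .draw _ _ _, μ => μ
  | .askValue b S a i, μ =>
      ((μ.tick (m + 1)).countQuery (b.eval μ)).setReal a (i.eval μ)
        (if h : b.eval μ < n then ((σ ⟨b.eval μ, h⟩).value (μ.bundle m S) : ℝ) else 0)
  | .askDemand b U p A, μ =>
      ((μ.tick (m + 1)).countQuery (b.eval μ)).setBundle A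
        (if h : b.eval μ < n then
          (σ ⟨b.eval μ, h⟩).demand (μ.bundle m U) (fun e => μ.real p e) else ∅)
  | .seq P Q, μ => Q.det σ (P.det σ μ)
  | .cond t P Q, μ => if t.Holds μ then P.det σ (μ.tick 1) else Q.det σ (μ.tick 1)
  | .loop x k P, μ =>
      iterateDet (fun j ν => P.det σ ((ν.tick 1).setNat x 0 j)) (k.eval μ) (μ.tick 1)

theorem Program.exec_eq_pure_det (σ : Fin n → Strategy m) {P : Program} (h : P.drawFree = true)
    (μ : Memory) : P.exec σ μ = PMF.pure (P.det σ μ) := by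
  induction P generalizing μ with
  | draw => simp [drawFree] at h
  | seq P Q ihP ihQ =>
    simp only [drawFree, Bool.and_eq_true] at h
    simp only [exec, det, ihP h.1, PMF.pure_bind, ihQ h.2]
  | cond t P Q ihP ihQ =>
    simp only [drawFree, Bool.and_eq_true] at h
    simp only [exec, det]
    split_ifs
    · exact ihP h.1 _
    · exact ihQ h.2 _
  | loop x k P ih =>
    simp only [drawFree] at h
    simp only [exec, det]
    induction k.eval μ with
    | zero => rfl
    | succ k ihk => rw [iterate, iterateDet, ihk, PMF.pure_bind, ih h]
  | _ => rfl

/-- Frame rule, used throughout the verification to carry facts across subprograms. -/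
theorem Program.det_nat (σ : Fin n → Strategy m) {P : Program} {a : ℕ}
    (h : P.writesNat a = false) (μ : Memory) : (P.det σ μ).nat a = μ.nat a := by
  induction P generalizing μ with
  | setNat b i x =>
    have : a ≠ b := by simpa [writesNat] using h
    funext j; simp [det, this]
  | askDemand b U p A =>
    have : a ≠ A := by simpa [writesNat] using h
    simp only [det]
    rw [Memory.setBundle_nat_of_ne _ _ this]; rfl
  | seq P Q ihP ihQ =>
    simp only [writesNat, Bool.or_eq_false_iff] at h
    simp only [det, ihQ h.2, ihP h.1]
  | cond t P Q ihP ihQ =>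
    simp only [writesNat, Bool.or_eq_false_iff] at h
    simp only [det]
    split_ifs
    · rw [ihP h.1]; rfl
    · rw [ihQ h.2]; rfl
  | loop x k P ih =>
    simp only [writesNat, Bool.or_eq_false_iff] at h
    have hx : a ≠ x := by simpa using h.1
    simp only [det]
    induction k.eval μ with
    | zero => rfl
    | succ k ihk =>
      rw [iterateDet, ih h.2, ← ihk]
      funext j
      simp [hx]
  | _ => rfl

theorem Program.det_real (σ : Fin n → Strategy m) {P : Program} {a : ℕ}
    (h : P.writesReal a = false) (μ : Memory) : (P.det σ μ).real a = μ.real a := by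
  induction P generalizing μ with
  | setReal b i x =>
    have : a ≠ b := by simpa [writesReal] using h
    funext j; simp [det, this]
  | askValue b S c i =>
    have : a ≠ c := by simpa [writesReal] using h
    funext j; simp [det, this]
  | seq P Q ihP ihQ =>
    simp only [writesReal, Bool.or_eq_false_iff] at h
    simp only [det, ihQ h.2, ihP h.1]
  | cond t P Q ihP ihQ =>
    simp only [writesReal, Bool.or_eq_false_iff] at h
    simp only [det]
    split_ifs
    · rw [ihP h.1]; rfl
    · rw [ihQ h.2]; rfl
  | loop x k P ih =>
    simp only [writesReal] at h
    simp only [det]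
    induction k.eval μ with
    | zero => rfl
    | succ k ihk =>
      rw [iterateDet, ih h, ← ihk]
      rfl
  | _ => rfl

theorem Program.det_queries (σ : Fin n → Strategy m) {P : Program} (h : P.queryFree = true)
    (μ : Memory) : (P.det σ μ).queries = μ.queries := by
  induction P generalizing μ with
  | askValue => simp [queryFree] at h
  | askDemand => simp [queryFree] at h
  | seq P Q ihP ihQ =>
    simp only [queryFree, Bool.and_eq_true] at h
    simp only [det, ihQ h.2, ihP h.1]
  | cond t P Q ihP ihQ =>
    simp only [queryFree, Bool.and_eq_true] at h
    simp only [det]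
    split_ifs
    · rw [ihP h.1]; rfl
    · rw [ihQ h.2]; rfl
  | loop x k P ih =>
    simp only [queryFree] at h
    simp only [det]
    induction k.eval μ with
    | zero => rfl
    | succ k ihk =>
      rw [iterateDet, ih h, ← ihk]
      rfl
  | _ => rfl

/-- Loop invariants; the arrays that the loop does not write keep their contents. -/
theorem Program.det_loop_induction (σ : Fin n → Strategy m) (x : ℕ) (k : NatExpr) (P : Program)
    (μ : Memory) (Inv : ℕ → Memory → Prop) (h0 : Inv 0 (μ.tick 1))
    (hs : ∀ j < k.eval μ, ∀ ν : Memory,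
      (∀ a, (Program.loop x k P).writesNat a = false → ν.nat a = μ.nat a) →
      (∀ a, (Program.loop x k P).writesReal a = false → ν.real a = μ.real a) →
      Inv j ν → Inv (j + 1) (P.det σ ((ν.tick 1).setNat x 0 j))) :
    Inv (k.eval μ) ((Program.loop x k P).det σ μ) := by
  simp only [det]
  have key : ∀ j ≤ k.eval μ,
      (∀ a, (Program.loop x k P).writesNat a = false →
        (iterateDet (fun j ν => P.det σ ((ν.tick 1).setNat x 0 j)) j (μ.tick 1)).nat a =
          μ.nat a) ∧
      (∀ a, (Program.loop x k P).writesReal a = false →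
        (iterateDet (fun j ν => P.det σ ((ν.tick 1).setNat x 0 j)) j (μ.tick 1)).real a =
          μ.real a) ∧
      Inv j (iterateDet (fun j ν => P.det σ ((ν.tick 1).setNat x 0 j)) j (μ.tick 1)) := by
    intro j
    induction j with
    | zero => exact fun _ => ⟨fun _ _ => rfl, fun _ _ => rfl, h0⟩
    | succ j ih =>
      intro hj
      obtain ⟨ih1, ih2, ih3⟩ := ih (by omega)
      refine ⟨fun a ha => ?_, fun a ha => ?_, hs j (by omega) _ ih1 ih2 ih3⟩
      · have ha' := ha
        simp only [writesNat, Bool.or_eq_false_iff] at ha'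
        have hx : a ≠ x := by simpa using ha'.1
        rw [iterateDet, det_nat σ ha'.2, ← ih1 a ha]
        funext i
        simp [hx]
      · rw [iterateDet, det_real σ (by simpa [writesReal] using ha), ← ih2 a ha]
        rfl
  exact (key _ le_rfl).2.2

/-! ### Running time -/

/-- Expressions in the input `n`, `m`. -/
def NatExpr.isInput : NatExpr → Bool
  | .lit _ => true
  | .get 0 (.lit 0) => true
  | .get 1 (.lit 0) => true
  | .add x y => x.isInput && y.isInput
  | _ => false

/-- All loops are run a number of times that is given by an expression in the input. -/
def Program.hasInputLoops : Program → Bool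
  | .seq P Q => P.hasInputLoops && Q.hasInputLoops
  | .cond _ P Q => P.hasInputLoops && Q.hasInputLoops
  | .loop _ k P => k.isInput && P.hasInputLoops
  | _ => true

theorem NatExpr.eval_le_of_isInput {x : NatExpr} (h : x.isInput = true) :
    ∃ c, ∀ μ : Memory, x.eval μ ≤ c * (μ.nat 0 0 + μ.nat 1 0 + 1) := by
  induction x with
  | lit c => exact ⟨c, fun μ => by simp only [eval]; nlinarith⟩
  | get a i _ =>
    refine ⟨1, fun μ => ?_⟩
    unfold isInput at h
    split at h <;> simp_all [eval] <;> omega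
  | add x y ihx ihy =>
    simp only [isInput, Bool.and_eq_true] at h
    obtain ⟨c, hc⟩ := ihx h.1
    obtain ⟨d, hd⟩ := ihy h.2
    exact ⟨c + d, fun μ => by simp only [eval]; linarith [hc μ, hd μ, add_mul c d (μ.nat 0 0 + μ.nat 1 0 + 1)]⟩
  | sub => simp [isInput] at h
  | half => simp [isInput] at h

theorem Program.exec_nat {P : Program} {a : ℕ} (h : P.writesNat a = false)
    (σ : Fin n → Strategy m) (μ ν : Memory) (hν : ν ∈ (P.exec σ μ).support) :
    ν.nat a = μ.nat a := by
  induction P generalizing μ ν with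
  | draw b i k =>
    have hab : a ≠ b := by simpa [writesNat] using h
    simp only [exec, PMF.support_map, Set.mem_image] at hν
    obtain ⟨d, -, rfl⟩ := hν
    funext j; simp [hab]
  | seq P Q ihP ihQ =>
    simp only [writesNat, Bool.or_eq_false_iff] at h
    simp only [exec, PMF.support_bind, Set.mem_iUnion] at hν
    obtain ⟨ξ, h1, h2⟩ := hν
    rw [ihQ h.2 _ _ h2, ihP h.1 _ _ h1]
  | cond t P Q ihP ihQ =>
    simp only [writesNat, Bool.or_eq_false_iff] at h
    simp only [exec] at hν
    split_ifs at hν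
    · rw [ihP h.1 _ _ hν]; rfl
    · rw [ihQ h.2 _ _ hν]; rfl
  | loop x k P ih =>
    simp only [writesNat, Bool.or_eq_false_iff] at h
    have hx : a ≠ x := by simpa using h.1
    simp only [exec] at hν
    revert ν
    induction k.eval μ with
    | zero =>
      intro ν hν
      simp only [iterate, PMF.support_pure, Set.mem_singleton_iff] at hν
      rw [hν]; rfl
    | succ k ihk =>
      intro ν hν
      simp only [iterate, PMF.support_bind, Set.mem_iUnion] at hν
      obtain ⟨ξ, h1, h2⟩ := hν
      rw [ih h.2 _ _ h2, ← ihk ξ h1]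
      funext j
      simp [hx]
  | _ =>
    simp only [exec, PMF.support_pure, Set.mem_singleton_iff] at hν
    rw [hν]
    first
    | rfl
    | exact Program.det_nat σ h μ

/-- Each loop multiplies the bound by a factor linear in the input, and the program text is fixed.
That the input cells are never overwritten keeps the loop counts linear in the original `n` and `m`.
-/
theorem Program.exists_steps_le {P : Program} (h : P.hasInputLoops = true)
    (h0 : P.writesNat 0 = false) (h1 : P.writesNat 1 = false) :
    ∃ c d : ℕ, ∀ (n m : ℕ) (σ : Fin n → Strategy m) (μ : Memory), μ.nat 0 0 = n → μ.nat 1 0 = m →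
      ∀ ν ∈ (P.exec σ μ).support, ν.steps ≤ μ.steps + c * (n + m + 1) ^ d := by
  induction P with
  | skip =>
    refine ⟨1, 0, fun n m σ μ _ _ ν hν => ?_⟩
    simp only [exec, PMF.support_pure, Set.mem_singleton_iff] at hν
    rw [hν]; simp [Memory.tick]
  | setNat =>
    refine ⟨1, 0, fun n m σ μ _ _ ν hν => ?_⟩
    simp only [exec, PMF.support_pure, Set.mem_singleton_iff] at hν
    rw [hν]; simp [Memory.tick, Memory.setNat]
  | setReal =>
    refine ⟨1, 0, fun n m σ μ _ _ ν hν => ?_⟩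
    simp only [exec, PMF.support_pure, Set.mem_singleton_iff] at hν
    rw [hν]; simp [Memory.tick, Memory.setReal]
  | draw =>
    refine ⟨1, 0, fun n m σ μ _ _ ν hν => ?_⟩
    simp only [exec, PMF.support_map, Set.mem_image] at hν
    obtain ⟨d, -, rfl⟩ := hν
    simp [Memory.tick, Memory.setNat]
  | askValue =>
    refine ⟨1, 1, fun n m σ μ _ _ ν hν => ?_⟩
    simp only [exec, PMF.support_pure, Set.mem_singleton_iff] at hν
    rw [hν]; simp [Memory.tick, Memory.setReal, Memory.countQuery]
  | askDemand =>
    refine ⟨1, 1, fun n m σ μ _ _ ν hν => ?_⟩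
    simp only [exec, PMF.support_pure, Set.mem_singleton_iff] at hν
    rw [hν]; simp [Memory.tick, Memory.setBundle, Memory.countQuery]
  | seq P Q ihP ihQ =>
    simp only [hasInputLoops, Bool.and_eq_true] at h
    simp only [writesNat, Bool.or_eq_false_iff] at h0 h1
    obtain ⟨c, d, hP⟩ := ihP h.1 h0.1 h1.1
    obtain ⟨c', d', hQ⟩ := ihQ h.2 h0.2 h1.2
    refine ⟨c + c', d + d', fun n m σ μ hn hm ν hν => ?_⟩
    simp only [exec, PMF.support_bind, Set.mem_iUnion] at hν
    obtain ⟨ξ, hξ, hν⟩ := hν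
    have e1 := hP n m σ μ hn hm ξ hξ
    have e2 := hQ n m σ ξ (by rw [exec_nat h0.1 σ μ ξ hξ, hn]) (by rw [exec_nat h1.1 σ μ ξ hξ, hm]) ν hν
    have e3 : (n + m + 1) ^ d ≤ (n + m + 1) ^ (d + d') := Nat.pow_le_pow_right (by omega) (by omega)
    have e4 : (n + m + 1) ^ d' ≤ (n + m + 1) ^ (d + d') := Nat.pow_le_pow_right (by omega) (by omega)
    have e5 := Nat.mul_le_mul_left c e3
    have e6 := Nat.mul_le_mul_left c' e4
    rw [add_mul]
    omega
  | cond t P Q ihP ihQ =>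
    simp only [hasInputLoops, Bool.and_eq_true] at h
    simp only [writesNat, Bool.or_eq_false_iff] at h0 h1
    obtain ⟨c, d, hP⟩ := ihP h.1 h0.1 h1.1
    obtain ⟨c', d', hQ⟩ := ihQ h.2 h0.2 h1.2
    refine ⟨c + c' + 1, d + d', fun n m σ μ hn hm ν hν => ?_⟩
    have e3 : (n + m + 1) ^ d ≤ (n + m + 1) ^ (d + d') := Nat.pow_le_pow_right (by omega) (by omega)
    have e4 : (n + m + 1) ^ d' ≤ (n + m + 1) ^ (d + d') := Nat.pow_le_pow_right (by omega) (by omega)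
    have e5 := Nat.mul_le_mul_left c e3
    have e6 := Nat.mul_le_mul_left c' e4
    have e7 : 1 ≤ (n + m + 1) ^ (d + d') := Nat.one_le_pow _ _ (by omega)
    have e8 : (μ.tick 1).steps = μ.steps + 1 := rfl
    rw [add_mul, add_mul]
    simp only [exec] at hν
    split_ifs at hν
    · have e1 := hP n m σ (μ.tick 1) hn hm ν hν
      omega
    · have e2 := hQ n m σ (μ.tick 1) hn hm ν hν
      omega
  | loop x k P ih =>
    simp only [hasInputLoops, Bool.and_eq_true] at h
    have h0' := h0
    have h1' := h1
    simp only [writesNat, Bool.or_eq_false_iff] at h0' h1'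
    obtain ⟨c, d, hP⟩ := ih h.2 h0'.2 h1'.2
    obtain ⟨c', hk⟩ := NatExpr.eval_le_of_isInput h.1
    refine ⟨1 + c' * (c + 1), d + 1, fun n m σ μ hn hm ν hν => ?_⟩
    have hx0 : 0 ≠ x := by simpa using h0'.1
    have hx1 : 1 ≠ x := by simpa using h1'.1
    have key : ∀ j, ∀ ξ ∈ (iterate (fun j ν => P.exec σ ((ν.tick 1).setNat x 0 j)) j
        (μ.tick 1)).support, ξ.nat 0 0 = n ∧ ξ.nat 1 0 = m ∧
          ξ.steps ≤ μ.steps + 1 + j * (1 + c * (n + m + 1) ^ d) := by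
      intro j
      induction j with
      | zero =>
        intro ξ hξ
        simp only [iterate, PMF.support_pure, Set.mem_singleton_iff] at hξ
        subst hξ
        exact ⟨hn, hm, by simp [Memory.tick]⟩
      | succ j ihj =>
        intro ξ hξ
        simp only [iterate, PMF.support_bind, Set.mem_iUnion] at hξ
        obtain ⟨ζ, hζ, hξ⟩ := hξ
        obtain ⟨i0, i1, i2⟩ := ihj ζ hζ
        have j0 : ((ζ.tick 1).setNat x 0 j).nat 0 0 = n := by simp [hx0, i0]
        have j1 : ((ζ.tick 1).setNat x 0 j).nat 1 0 = m := by simp [hx1, i1]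
        have e1 := hP n m σ _ j0 j1 ξ hξ
        have e2 : ((ζ.tick 1).setNat x 0 j).steps = ζ.steps + 1 := rfl
        refine ⟨by rw [exec_nat h0'.2 σ _ ξ hξ, j0], by rw [exec_nat h1'.2 σ _ ξ hξ, j1], ?_⟩
        rw [add_mul, one_mul]
        omega
    have e1 := (key _ ν hν).2.2
    have e2 := hk μ
    rw [hn, hm] at e2
    have e3 := Nat.mul_le_mul_right (1 + c * (n + m + 1) ^ d) e2
    have e4 : 1 + c * (n + m + 1) ^ d ≤ (c + 1) * (n + m + 1) ^ d := by
      have : 1 ≤ (n + m + 1) ^ d := Nat.one_le_pow _ _ (by omega)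
      nlinarith
    have e5 := Nat.mul_le_mul_left (c' * (n + m + 1)) e4
    have e6 : c' * (n + m + 1) * ((c + 1) * (n + m + 1) ^ d) =
        c' * (c + 1) * (n + m + 1) ^ (d + 1) := by ring
    have e7 : 1 ≤ (n + m + 1) ^ (d + 1) := Nat.one_le_pow _ _ (by omega)
    rw [add_mul, one_mul]
    omega

theorem Program.isPolynomialTime_of_hasInputLoops {P : Program} (h : P.hasInputLoops = true)
    (h0 : P.writesNat 0 = false) (h1 : P.writesNat 1 = false) : P.IsPolynomialTime := by
  obtain ⟨c, d, hcd⟩ := exists_steps_le h h0 h1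
  refine ⟨c, d, fun n m σ μ hμ => ?_⟩
  have := hcd n m σ (Memory.initial n m) rfl rfl μ hμ
  simpa [Memory.initial] using this

/-! ### Random draws -/

theorem uniformOfFintype_bind_map {α β γ : Type} [Fintype α] [Nonempty α] [Fintype β] [Nonempty β]
    (F : α → β → γ) :
    (PMF.uniformOfFintype α).bind (fun a => (PMF.uniformOfFintype β).map (F a)) =
      (PMF.uniformOfFintype (α × β)).map (fun p => F p.1 p.2) := by
  have h : PMF.uniformOfFintype (α × β) =
      (PMF.uniformOfFintype α).bind (fun a => (PMF.uniformOfFintype β).map (fun b => (a, b))) := by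
    classical
    ext ⟨a, b⟩
    simp only [PMF.bind_apply, PMF.map_apply, PMF.uniformOfFintype_apply, tsum_fintype,
      Prod.mk.injEq, Fintype.card_prod, Nat.cast_mul]
    rw [Finset.sum_eq_single a, Finset.sum_eq_single b]
    · simp [ENNReal.mul_inv]
    · intro b' _ hb'; simp [hb'.symm]
    · simp
    · intro a' _ ha'; simp [ha'.symm]
    · simp
  rw [h, PMF.map_bind]
  congr 1
  funext a
  rw [PMF.map_comp]
  rfl

theorem uniformOfFintype_map_equiv {α β : Type} [Fintype α] [Nonempty α] [Fintype β] [Nonempty β]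
    (f : α ≃ β) : (PMF.uniformOfFintype α).map f = PMF.uniformOfFintype β := by
  classical
  ext b
  simp only [PMF.map_apply, PMF.uniformOfFintype_apply, tsum_fintype]
  rw [Finset.sum_eq_single (f.symm b)]
  · simp [Fintype.card_congr f]
  · intro a _ ha
    rw [if_neg]
    rintro rfl
    simp at ha
  · simp

/-- The memory after a sequence of steps with given draws. -/
def foldDraws {X : Type} (g : ℕ → Memory → X → Memory) (μ : Memory) :
    (k : ℕ) → (Fin k → X) → Memory
  | 0, _ => μ
  | k + 1, d => g k (foldDraws g μ k (fun i => d i.castSucc)) (d (Fin.last k))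

theorem foldDraws_invariant {X : Type} (g : ℕ → Memory → X → Memory) (μ : Memory)
    (Inv : Memory → Prop) (h0 : Inv μ) (hs : ∀ j ν x, Inv ν → Inv (g j ν x)) (k : ℕ)
    (d : Fin k → X) : Inv (foldDraws g μ k d) := by
  induction k with
  | zero => exact h0
  | succ k ih => exact hs _ _ _ (ih _)

/-- The invariant guarantees that each step draws from the same type `X`, so independent draws form
one uniform tuple; the last draw is appended by `Fin.snocEquiv`. -/
theorem iterate_eq_map_uniform {X : Type} [Fintype X] [Nonempty X]
    (f : ℕ → Memory → PMF Memory) (g : ℕ → Memory → X → Memory) (Inv : Memory → Prop) (μ : Memory)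
    (h0 : Inv μ) (hs : ∀ j ν x, Inv ν → Inv (g j ν x))
    (hf : ∀ j ν, Inv ν → f j ν = (PMF.uniformOfFintype X).map (g j ν)) (k : ℕ) :
    iterate f k μ = (PMF.uniformOfFintype (Fin k → X)).map (foldDraws g μ k) := by
  induction k with
  | zero =>
    have : foldDraws g μ 0 = Function.const _ μ := rfl
    rw [this, PMF.map_const, iterate]
  | succ k ih =>
    rw [iterate, ih, PMF.bind_map]
    have h1 : (f k ∘ foldDraws g μ k) = fun d => (PMF.uniformOfFintype X).map
        (g k (foldDraws g μ k d)) := by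
      funext d
      exact hf _ _ (foldDraws_invariant g μ Inv h0 hs k d)
    rw [h1, uniformOfFintype_bind_map,
      ← uniformOfFintype_map_equiv ((Equiv.prodComm _ _).trans (Fin.snocEquiv fun _ : Fin (k + 1) => X)),
      PMF.map_comp]
    congr 1
    funext ⟨d, x⟩
    simp [foldDraws, Fin.snocEquiv]

end Semantics

/-! ## A program for the mechanism

Number arrays: 0 and 1 the input, 2 the output, 3 the split, 4 the rounds of the bidders, 5 the coin,
6 the final round, 7 the number `β` of search rounds, 8 its power `2 ^ β`, 9, 10 and 11 the current
bidder, item and round, 12 the set of all items, 13 the winner of the second-price auction,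
14 the lowest remaining candidates, 15 the items for sale, 16 the demanded bundle, 17 the number of
remaining candidates, 18 and 19 the logarithm of `m` and its power. Real arrays: 0 the payments, 1
the candidate prices, 2 the current prices, 3 and 4 the highest and second highest bid, 5 the
current bid, 6 the current candidate price. -/

section TheProgram

variable {n m : ℕ}

def cell (a : ℕ) : NatExpr := .get a (.lit 0)

def threeTimes (x : NatExpr) : NatExpr := .add x (.add x x)

/-- Compute `c = ⌈log₂ x⌉` and `2 ^ c` in at most `k` rounds. -/
def clogProgram (x k : NatExpr) (c pw : ℕ) : Program :=
  .seq (.setNat pw (.lit 0) (.lit 1))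
    (.loop 10 k (.cond (.natLE x (cell pw)) .skip
      (.seq (.setNat pw (.lit 0) (.add (cell pw) (cell pw)))
        (.setNat c (.lit 0) (.add (cell c) (.lit 1))))))

def setupProgram : Program :=
  .seq (clogProgram (cell 1) (cell 1) 18 19)
    (clogProgram (.add (threeTimes (cell 18)) (.lit 1)) (.add (threeTimes (cell 1)) (.lit 1)) 7 8)

def drawBidder : Program := .seq (.draw 3 (cell 9) (.lit 1)) (.draw 4 (cell 9) (cell 7))

def drawProgram : Program :=
  .seq (.loop 9 (cell 0) drawBidder) (.seq (.draw 5 (.lit 0) (.lit 1)) (.draw 6 (.lit 0) (cell 7)))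

def allItemsProgram : Program := .loop 10 (cell 1) (.setNat 12 (cell 10) (.lit 1))

def takeBid : Program :=
  .seq (.setReal 4 (.lit 0) (.get 3 (.lit 0)))
    (.seq (.setReal 3 (.lit 0) (.get 5 (.lit 0))) (.setNat 13 (.lit 0) (.add (cell 9) (.lit 1))))

def keepBid : Program :=
  .cond (.realLE (.get 5 (.lit 0)) (.get 4 (.lit 0))) .skip
    (.setReal 4 (.lit 0) (.get 5 (.lit 0)))

def updateBid : Program :=
  .cond (.natLE (cell 13) (.lit 0)) takeBid
    (.cond (.realLE (.get 5 (.lit 0)) (.get 3 (.lit 0))) keepBid takeBid)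

def valueProgram : Program :=
  .loop 9 (cell 0) (.cond (.natLE (.get 3 (cell 9)) (.lit 0)) .skip
    (.seq (.askValue (cell 9) 12 5 (.lit 0)) updateBid))

def secondPriceProgram : Program :=
  .cond (.natLE (cell 13) (.lit 0)) .skip
    (.seq (.loop 10 (cell 1) (.setNat 2 (cell 10) (cell 13)))
      (.setReal 0 (.sub (cell 13) (.lit 1)) (.get 4 (.lit 0))))

/-- The array is filled from the top by repeated halving. Surplus iterations hit cell `0` through
truncated subtraction, which is why that cell is zeroed at the end. -/
def candidateProgram : Program :=
  .seq (.setReal 6 (.lit 0) (.get 3 (.lit 0)))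
    (.seq (.loop 10 (.add (threeTimes (.add (cell 1) (cell 1))) (.lit 2))
      (.seq (.setReal 6 (.lit 0) (.half (.get 6 (.lit 0))))
        (.setReal 1 (.sub (.sub (cell 8) (.lit 1)) (cell 10)) (.get 6 (.lit 0)))))
    (.setReal 1 (.lit 0) .zero))

def startRound : Program :=
  .loop 10 (cell 1)
    (.seq (.setReal 2 (cell 10) (.get 1 (.add (.get 14 (cell 10)) (cell 17))))
      (.seq (.setNat 15 (cell 10) (.lit 1)) (.setNat 2 (cell 10) (.lit 0))))

def markDemanded : Program :=
  .loop 10 (cell 1) (.cond (.natLE (.get 16 (cell 10)) (.lit 0)) .skip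
    (.seq (.setNat 2 (cell 10) (.add (cell 9) (.lit 1))) (.setNat 15 (cell 10) (.lit 0))))

def sellProgram : Program := .seq (.askDemand (cell 9) 15 2 16) markDemanded

def sellLoop : Program :=
  .loop 9 (cell 0) (.cond (.natLE (.get 3 (cell 9)) (.lit 0))
    (.cond (.natLE (.get 4 (cell 9)) (cell 11))
      (.cond (.natLE (cell 11) (.get 4 (cell 9))) sellProgram .skip) .skip) .skip)

def updateLow : Program :=
  .loop 10 (cell 1) (.cond (.natLE (.get 2 (cell 10)) (.lit 0)) .skip
    (.setNat 14 (cell 10) (.add (.get 14 (cell 10)) (cell 17))))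

def roundProgram : Program :=
  .seq (.setNat 17 (.lit 0) (.half (cell 17))) (.seq startRound (.seq sellLoop updateLow))

def roundsProgram : Program :=
  -- A loop bound in the input alone, at least `β + 1`; rounds after the final one are skipped.
  .loop 11 (.add (threeTimes (cell 1)) (.lit 2))
    (.cond (.natLE (cell 11) (cell 6)) roundProgram .skip)

def payProgram : Program :=
  .loop 10 (cell 1) (.cond (.natLE (.get 2 (cell 10)) (.lit 0)) .skip
    (.setReal 0 (.sub (.get 2 (cell 10)) (.lit 1))
      (.add (.get 0 (.sub (.get 2 (cell 10)) (.lit 1))) (.get 2 (cell 10)))))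

def searchProgram : Program :=
  .seq candidateProgram (.seq (.setNat 17 (.lit 0) (cell 8)) (.seq roundsProgram payProgram))

def mainProgram : Program :=
  .seq allItemsProgram (.seq valueProgram
    (.cond (.natLE (cell 5) (.lit 0)) searchProgram secondPriceProgram))

def auctionProgram : Program := .seq setupProgram (.seq drawProgram mainProgram)

theorem auctionProgram_isPolynomialTime : auctionProgram.IsPolynomialTime :=
  Program.isPolynomialTime_of_hasInputLoops rfl rfl rfl

@[simp] theorem eval_cell (a : ℕ) (μ : Memory) : (cell a).eval μ = μ.nat a 0 := rfl

@[simp] theorem eval_threeTimes (x : NatExpr) (μ : Memory) :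
    (threeTimes x).eval μ = 3 * x.eval μ := by
  simp only [threeTimes, NatExpr.eval]; ring

theorem Program.det_seq (σ : Fin n → Strategy m) (P Q : Program) (μ : Memory) :
    (Program.seq P Q).det σ μ = Q.det σ (P.det σ μ) := rfl

theorem Program.det_cond_pos (σ : Fin n → Strategy m) {t : Test} (P Q : Program) {μ : Memory}
    (h : t.Holds μ) : (Program.cond t P Q).det σ μ = P.det σ (μ.tick 1) := by
  simp only [det, if_pos h]

theorem Program.det_cond_neg (σ : Fin n → Strategy m) {t : Test} (P Q : Program) {μ : Memory}
    (h : ¬ t.Holds μ) : (Program.cond t P Q).det σ μ = Q.det σ (μ.tick 1) := by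
  simp only [det, if_neg h]

/-- After `j` iterations the counter is `min j (Nat.clog 2 X)`, because doubling stops once the
power reaches `X`. `X` iterations suffice since `X < 2 ^ X`. -/
theorem det_clogProgram (σ : Fin n → Strategy m) {x k : NatExpr} {c pw X : ℕ} (hc : c ≠ 10)
    (hpw : pw ≠ 10) (hcpw : c ≠ pw) {μ : Memory}
    (hx : ∀ ν : Memory, (∀ a, a ≠ 10 → a ≠ c → a ≠ pw → ν.nat a = μ.nat a) →
      x.eval ν = X ∧ X ≤ k.eval ν)
    (h0 : μ.nat c 0 = 0) :
    ((clogProgram x k c pw).det σ μ).nat c 0 = Nat.clog 2 X ∧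
      ((clogProgram x k c pw).det σ μ).nat pw 0 = 2 ^ Nat.clog 2 X := by
  set ν₀ := (Program.setNat pw (.lit 0) (.lit 1)).det σ μ with hν₀
  have hν₀n : ∀ a, a ≠ pw → ν₀.nat a = μ.nat a := fun a ha =>
    Program.det_nat σ (by simp [Program.writesNat, ha]) μ
  have hK := (hx ν₀ fun a _ _ ha => hν₀n a ha).2
  have hclog : Nat.clog 2 X ≤ k.eval ν₀ :=
    Nat.clog_le_of_le_pow (hK.trans Nat.lt_two_pow_self.le)
  have key := Program.det_loop_induction σ 10 k (.cond (.natLE x (cell pw)) .skip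
      (.seq (.setNat pw (.lit 0) (.add (cell pw) (cell pw)))
        (.setNat c (.lit 0) (.add (cell c) (.lit 1))))) ν₀
    (fun j ν => ν.nat c 0 = min j (Nat.clog 2 X) ∧ ν.nat pw 0 = 2 ^ min j (Nat.clog 2 X))
    (by simp [hν₀, Program.det, h0, hcpw, NatExpr.eval]) ?_
  · rw [min_eq_right hclog] at key
    exact key
  · intro j _ ν hn _ ⟨h1, h2⟩
    have hxν : x.eval ((ν.tick 1).setNat 10 0 j) = X := (hx _ fun a ha1 ha2 ha3 => by
      rw [← hν₀n a ha3, ← hn a (by simp [Program.writesNat, ha1, ha2, ha3])]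
      funext i; simp [ha1]).1
    have e1 : ((ν.tick 1).setNat 10 0 j).nat c 0 = min j (Nat.clog 2 X) := by simp [hc, h1]
    have e2 : ((ν.tick 1).setNat 10 0 j).nat pw 0 = 2 ^ min j (Nat.clog 2 X) := by simp [hpw, h2]
    generalize (ν.tick 1).setNat 10 0 j = ν' at hxν e1 e2
    by_cases hj : Nat.clog 2 X ≤ j
    · rw [Program.det_cond_pos]
      · rw [min_eq_right hj] at e1 e2
        rw [min_eq_right (by omega)]
        simp [Program.det, e1, e2]
      · rw [min_eq_right hj] at e2
        simp only [Test.Holds, hxν, eval_cell, e2]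
        exact Nat.le_pow_clog (by norm_num) X
    · push Not at hj
      rw [min_eq_left hj.le] at e1 e2
      rw [Program.det_cond_neg]
      · rw [min_eq_left (by omega)]
        simp [Program.det, NatExpr.eval, e1, e2, hcpw, hcpw.symm, pow_succ, mul_two]
      · simp only [Test.Holds, hxν, eval_cell, e2]
        intro hcon
        exact absurd (Nat.clog_le_of_le_pow hcon) (by omega)

theorem det_setupProgram (σ : Fin n → Strategy m) :
    (setupProgram.det σ (Memory.initial n m)).nat 7 0 = searchRounds m ∧
      (setupProgram.det σ (Memory.initial n m)).nat 8 0 = 2 ^ searchRounds m := by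
  rw [setupProgram, Program.det_seq]
  have h1 := det_clogProgram σ (x := cell 1) (k := cell 1) (c := 18) (pw := 19) (X := m)
    (by decide) (by decide) (by decide) (μ := Memory.initial n m)
    (fun ν hν => by simp [hν 1, Memory.initial]) rfl
  have hf : ∀ a, a ≠ 10 → a ≠ 18 → a ≠ 19 →
      ((clogProgram (cell 1) (cell 1) 18 19).det σ (Memory.initial n m)).nat a =
        (Memory.initial n m).nat a := fun a h1 h2 h3 =>
    Program.det_nat σ (by simp [clogProgram, Program.writesNat, h1, h2, h3]) _
  refine det_clogProgram σ (X := 3 * Nat.clog 2 m + 1) (by decide) (by decide) (by decide)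
    (fun ν hν => ?_) ?_
  · have e1 : ν.nat 18 0 = Nat.clog 2 m := by rw [hν 18 (by decide) (by decide) (by decide), h1.1]
    have e2 : ν.nat 1 0 = m := by
      rw [hν 1 (by decide) (by decide) (by decide), hf 1 (by decide) (by decide) (by decide)]
      simp [Memory.initial]
    have e3 : Nat.clog 2 m ≤ m := Nat.clog_le_of_le_pow Nat.lt_two_pow_self.le
    simp only [NatExpr.eval, eval_threeTimes, eval_cell, e1, e2]
    exact ⟨trivial, by omega⟩
  · rw [hf 7 (by decide) (by decide) (by decide)]
    rfl

/-- The memory after the random draws. -/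
structure Drawn (m : ℕ) (h : Fin n → Bool) (c : Bool) (r : Fin n → Fin (searchRounds m + 1))
    (rstar : Fin (searchRounds m + 1)) (μ : Memory) : Prop where
  bidders : μ.nat 0 0 = n
  items : μ.nat 1 0 = m
  split : ∀ i : Fin n, μ.nat 3 i = if h i = true then 1 else 0
  round : ∀ i : Fin n, μ.nat 4 i = r i
  coin : μ.nat 5 0 = if c = true then 1 else 0
  lastRound : μ.nat 6 0 = rstar
  rounds : μ.nat 7 0 = searchRounds m
  candidates : μ.nat 8 0 = 2 ^ searchRounds m
  nat_zero : ∀ a, a = 2 ∨ a = 13 ∨ a = 14 → ∀ i, μ.nat a i = 0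
  real_zero : ∀ a i, μ.real a i = 0
  queries : ∀ i, μ.queries i = 0

/-- Replaces the memory-dependent type of a draw by the fixed type `Fin (b + 1)`. -/
theorem exec_draw (σ : Fin n → Strategy m) (a : ℕ) (i k : NatExpr) {μ : Memory} {b : ℕ}
    (hk : k.eval μ = b) : (Program.draw a i k).exec σ μ =
      (PMF.uniformOfFintype (Fin (b + 1))).map
        (fun d : Fin (b + 1) => (μ.tick 1).setNat a (i.eval μ) d) := by
  subst hk
  simp only [Program.exec, bind_pure_comp, PMF.monad_map_eq_map, PMF.map_comp]
  rfl

/-- The memory after the draws for bidder `j`. -/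
def drawStep (b : ℕ) (j : ℕ) (ν : Memory) (x : Fin 2 × Fin (b + 1)) : Memory :=
  ((((((ν.tick 1).setNat 9 0 j).tick 1).setNat 3 j x.1).tick 1).setNat 4 j x.2)

theorem exec_drawBidder (σ : Fin n → Strategy m) {b : ℕ} (j : ℕ) {ν : Memory}
    (hb : ν.nat 7 0 = b) : drawBidder.exec σ ((ν.tick 1).setNat 9 0 j) =
      (PMF.uniformOfFintype (Fin 2 × Fin (b + 1))).map (drawStep b j ν) := by
  rw [drawBidder, Program.exec, exec_draw σ 3 (cell 9) (.lit 1) (b := 1) rfl, PMF.bind_map]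
  rw [show drawStep b j ν = fun p => drawStep b j ν (p.1, p.2) from rfl,
    ← uniformOfFintype_bind_map fun d₁ d₂ => drawStep b j ν (d₁, d₂)]
  congr 1
  funext d
  rw [Function.comp, exec_draw σ 4 (cell 9) (cell 7) (b := b) (by simp [hb])]
  simp [drawStep]

/-- The memory after all draws. -/
def drawResult (b n : ℕ) (μ : Memory) (s : (Fin n → Fin 2 × Fin (b + 1)) × Fin 2 × Fin (b + 1)) :
    Memory :=
  ((((foldDraws (drawStep b) (μ.tick 1) n s.1).tick 1).setNat 5 0 s.2.1).tick 1).setNat 6 0 s.2.2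

theorem exec_drawProgram (σ : Fin n → Strategy m) {b : ℕ} {μ : Memory} (hb : μ.nat 7 0 = b)
    (hn : μ.nat 0 0 = n) : drawProgram.exec σ μ =
      (PMF.uniformOfFintype ((Fin n → Fin 2 × Fin (b + 1)) × Fin 2 × Fin (b + 1))).map
        (drawResult b n μ) := by
  have hstep : ∀ j ν x, ν.nat 7 0 = b → (drawStep b j ν x).nat 7 0 = b := fun j ν x h => by
    simp [drawStep, h]
  have hloop : (Program.loop 9 (cell 0) drawBidder).exec σ μ =
      (PMF.uniformOfFintype (Fin n → Fin 2 × Fin (b + 1))).map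
        (foldDraws (drawStep b) (μ.tick 1) n) := by
    rw [Program.exec, eval_cell, hn]
    exact iterate_eq_map_uniform _ (drawStep b) (fun ν => ν.nat 7 0 = b) (μ.tick 1) hb hstep
      (fun j ν hν => exec_drawBidder σ j hν) n
  rw [drawProgram, Program.exec, hloop, PMF.bind_map,
    show drawResult b n μ = fun s => drawResult b n μ (s.1, s.2) from rfl,
    ← uniformOfFintype_bind_map fun d s => drawResult b n μ (d, s)]
  congr 1
  funext d
  have h7 := foldDraws_invariant (drawStep b) (μ.tick 1) (fun ν => ν.nat 7 0 = b) hb hstep n d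
  rw [Function.comp, Program.exec, exec_draw σ 5 (.lit 0) (.lit 1) (b := 1) rfl, PMF.bind_map,
    show (fun s => drawResult b n μ (d, s)) = fun s => drawResult b n μ (d, s.1, s.2) from rfl,
    ← uniformOfFintype_bind_map fun c s => drawResult b n μ (d, c, s)]
  congr 1
  funext c
  rw [Function.comp, exec_draw σ 6 (.lit 0) (cell 7) (b := b) (by simp [h7])]
  rfl

theorem foldDraws_drawStep (b : ℕ) (μ : Memory) (k : ℕ) (d : Fin k → Fin 2 × Fin (b + 1)) :
    (∀ i : Fin k, (foldDraws (drawStep b) μ k d).nat 3 i = (d i).1 ∧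
      (foldDraws (drawStep b) μ k d).nat 4 i = (d i).2) ∧
    (∀ a, a ≠ 3 → a ≠ 4 → a ≠ 9 → (foldDraws (drawStep b) μ k d).nat a = μ.nat a) ∧
    (foldDraws (drawStep b) μ k d).real = μ.real ∧
    (foldDraws (drawStep b) μ k d).queries = μ.queries := by
  induction k with
  | zero => exact ⟨fun i => i.elim0, fun _ _ _ _ => rfl, rfl, rfl⟩
  | succ k ih =>
    obtain ⟨h1, h2, h3, h4⟩ := ih fun i => d i.castSucc
    refine ⟨fun i => ?_, fun a ha3 ha4 ha9 => ?_, h3, h4⟩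
    · induction i using Fin.lastCases with
      | last => simp [foldDraws, drawStep]
      | cast i =>
        have hi : (i : ℕ) ≠ k := i.isLt.ne
        have := h1 i
        simpa [foldDraws, drawStep, hi] using this
    · rw [← h2 a ha3 ha4 ha9]
      funext j
      simp [foldDraws, drawStep, ha3, ha4, ha9]

/-- The seed of the mechanism that corresponds to the draws of the program. -/
def seedEquiv (b n : ℕ) : (Fin n → Fin 2 × Fin (b + 1)) × Fin 2 × Fin (b + 1) ≃
    (Fin n → Bool) × Bool × (Fin n → Fin (b + 1)) × Fin (b + 1) where
  toFun s := (fun i => finTwoEquiv (s.1 i).1, finTwoEquiv s.2.1, fun i => (s.1 i).2, s.2.2)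
  invFun s := (fun i => (finTwoEquiv.symm (s.1 i), s.2.2.1 i), finTwoEquiv.symm s.2.1, s.2.2.2)
  left_inv s := by simp
  right_inv s := by simp

theorem val_eq_ite_finTwoEquiv (x : Fin 2) : (x : ℕ) = if finTwoEquiv x = true then 1 else 0 := by
  fin_cases x <;> rfl

theorem drawn_drawResult (σ : Fin n → Strategy m)
    (s : (Fin n → Fin 2 × Fin (searchRounds m + 1)) × Fin 2 × Fin (searchRounds m + 1)) :
    Drawn m (seedEquiv _ n s).1 (seedEquiv _ n s).2.1 (seedEquiv _ n s).2.2.1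
      (seedEquiv _ n s).2.2.2
      (drawResult (searchRounds m) n (setupProgram.det σ (Memory.initial n m)) s) := by
  obtain ⟨d, c, rstar⟩ := s
  set μ := setupProgram.det σ (Memory.initial n m) with hμ
  have hf : ∀ a, setupProgram.writesNat a = false → μ.nat a = (Memory.initial n m).nat a :=
    fun a ha => Program.det_nat σ ha _
  obtain ⟨h7, h8⟩ := det_setupProgram σ
  rw [← hμ] at h7 h8
  obtain ⟨k1, k2, k3, k4⟩ := foldDraws_drawStep (searchRounds m) (μ.tick 1) n d
  constructor
  · simp [drawResult, k2, hf 0 rfl, Memory.initial]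
  · simp [drawResult, k2, hf 1 rfl, Memory.initial]
  · intro i
    simp [drawResult, (k1 i).1, seedEquiv, val_eq_ite_finTwoEquiv]
    rfl
  · intro i
    simp [drawResult, (k1 i).2, seedEquiv]
  · simp [drawResult, seedEquiv, val_eq_ite_finTwoEquiv]
    rfl
  · simp [drawResult, seedEquiv]
  · simp [drawResult, k2, h7]
  · simp [drawResult, k2, h8]
  · rintro a (rfl | rfl | rfl) i
    · simp [drawResult, k2, hf 2 rfl, Memory.initial]
    · simp [drawResult, k2, hf 13 rfl, Memory.initial]
    · simp [drawResult, k2, hf 14 rfl, Memory.initial]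
  · intro a i
    have : μ.real a = (Memory.initial n m).real a := Program.det_real σ rfl _
    simp [drawResult, k3, this, Memory.initial]
  · intro i
    have : μ.queries = (Memory.initial n m).queries := Program.det_queries σ rfl _
    simp [drawResult, k4, this, Memory.initial]

end TheProgram

/-! ### Value queries and the second-price auction -/

section ValuePhase

variable {n m : ℕ}

theorem det_allItemsProgram (σ : Fin n → Strategy m) {μ : Memory} (hm : μ.nat 1 0 = m) :
    (allItemsProgram.det σ μ).bundle m 12 = Finset.univ := by
  have key := Program.det_loop_induction σ 10 (cell 1) (.setNat 12 (cell 10) (.lit 1)) μ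
    (fun j ν => ∀ e < j, ν.nat 12 e = 1) (by simp) ?_
  · rw [eval_cell, hm] at key
    rw [Memory.bundle, Finset.filter_eq_self]
    intro e _
    rw [allItemsProgram, key e e.isLt]
    exact one_ne_zero
  · intro j _ ν _ _ h e he
    by_cases hej : e = j
    · simp [Program.det, NatExpr.eval, hej]
    · have := h e (by omega)
      simp [Program.det, NatExpr.eval, hej, this]

theorem det_takeBid (σ : Fin n → Strategy m) (ν : Memory) :
    (takeBid.det σ ν).real 3 0 = ν.real 5 0 ∧ (takeBid.det σ ν).real 4 0 = ν.real 3 0 ∧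
      (takeBid.det σ ν).nat 13 0 = ν.nat 9 0 + 1 := by
  simp [takeBid, Program.det, RealExpr.eval, NatExpr.eval]

theorem det_keepBid (σ : Fin n → Strategy m) (ν : Memory) :
    (keepBid.det σ ν).real 4 0 = max (ν.real 4 0) (ν.real 5 0) := by
  rw [keepBid]
  by_cases h : ν.real 5 0 ≤ ν.real 4 0
  · rw [Program.det_cond_pos σ _ _ (by simpa [Test.Holds, RealExpr.eval, NatExpr.eval] using h)]
    simp [Program.det, h]
  · rw [Program.det_cond_neg σ _ _ (by simpa [Test.Holds, RealExpr.eval, NatExpr.eval] using h)]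
    simp [Program.det, RealExpr.eval, NatExpr.eval, (not_le.1 h).le]

/-- The split-off bidders among the first `j`. -/
def splitBefore (h : Fin n → Bool) (j : ℕ) : Finset (Fin n) :=
  Finset.univ.filter fun i => h i = true ∧ (i : ℕ) < j

/-- What is known about the bids of a set of bidders: the winner of the second-price auction and
the two highest bids. -/
structure BidState (N : Finset (Fin n)) (bid : Fin n → ℝ≥0) (ν : Memory) : Prop where
  top : ν.real 3 0 = (N.sup bid : ℝ≥0)
  winner : (ν.nat 13 0 = 0 ∧ N = ∅ ∧ ν.real 4 0 = 0) ∨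
    ∃ w : Fin n, ν.nat 13 0 = w + 1 ∧ w ∈ N ∧
      (∀ i ∈ N, bid i < bid w ∨ bid i = bid w ∧ w ≤ i) ∧
      ν.real 4 0 = ((N.erase w).sup bid : ℝ≥0)

theorem BidState.sup_eq {N : Finset (Fin n)} {bid : Fin n → ℝ≥0} {w : Fin n} (hw : w ∈ N)
    (hmax : ∀ i ∈ N, bid i < bid w ∨ bid i = bid w ∧ w ≤ i) : N.sup bid = bid w :=
  le_antisymm (Finset.sup_le fun i hi => (hmax i hi).elim le_of_lt fun h => h.1.le)
    (Finset.le_sup hw)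

/-- Bidders come in increasing order, so the incumbent keeps the lead in a tie, as the tie-breaking
rule demands. A new leader turns the old top bid into the second highest. -/
theorem BidState.update (σ : Fin n → Strategy m) {N : Finset (Fin n)} {bid : Fin n → ℝ≥0}
    {ν : Memory} (hν : BidState N bid ν) {k : Fin n} (hk : ∀ i ∈ N, i < k)
    (h9 : ν.nat 9 0 = k) (h5 : ν.real 5 0 = bid k) :
    BidState (insert k N) bid (updateBid.det σ ν) := by
  have hkN : k ∉ N := fun h => lt_irrefl _ (hk k h)
  have htake : ∀ ν' : Memory, ν'.nat = ν.nat → ν'.real = ν.real →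
      (∀ i ∈ N, bid i < bid k) → BidState (insert k N) bid (takeBid.det σ ν') := by
    intro ν' hn hr hlt
    obtain ⟨e1, e2, e3⟩ := det_takeBid σ ν'
    rw [hn, h9] at e3
    rw [hr] at e1 e2
    have hmax : ∀ i ∈ insert k N, bid i < bid k ∨ bid i = bid k ∧ k ≤ i := by
      intro i hi
      rcases Finset.mem_insert.1 hi with rfl | hi
      · exact Or.inr ⟨rfl, le_rfl⟩
      · exact Or.inl (hlt i hi)
    refine ⟨?_, Or.inr ⟨k, e3, Finset.mem_insert_self _ _, hmax, ?_⟩⟩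
    · rw [e1, h5, BidState.sup_eq (Finset.mem_insert_self _ _) hmax]
    · rw [e2, hν.top, Finset.erase_insert hkN]
  rw [updateBid]
  rcases hν.winner with ⟨h1, rfl, h3⟩ | ⟨w, h1, h2, h3, h4⟩
  · rw [Program.det_cond_pos σ _ _ (by simp [Test.Holds, NatExpr.eval, h1])]
    exact htake _ rfl rfl (by simp)
  · rw [Program.det_cond_neg σ _ _ (by simp [Test.Holds, NatExpr.eval, h1])]
    have htop : ν.real 3 0 = bid w := by rw [hν.top, BidState.sup_eq h2 h3]
    by_cases hle : bid k ≤ bid w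
    · rw [Program.det_cond_pos σ _ _ (by
        simpa [Test.Holds, NatExpr.eval, RealExpr.eval, h5, htop] using hle)]
      have e1 : ((keepBid.det σ ((ν.tick 1).tick 1))).real 3 = ν.real 3 :=
        Program.det_real σ rfl _
      have e2 : ((keepBid.det σ ((ν.tick 1).tick 1))).nat 13 = ν.nat 13 :=
        Program.det_nat σ rfl _
      have e3 := det_keepBid σ ((ν.tick 1).tick 1)
      have hwk : w < k := hk w h2
      have hmax : ∀ i ∈ insert k N, bid i < bid w ∨ bid i = bid w ∧ w ≤ i := by
        intro i hi
        rcases Finset.mem_insert.1 hi with rfl | hi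
        · rcases hle.lt_or_eq with h | h
          · exact Or.inl h
          · exact Or.inr ⟨h, hwk.le⟩
        · exact h3 i hi
      refine ⟨?_, Or.inr ⟨w, by rw [e2, h1], Finset.mem_insert_of_mem h2, hmax, ?_⟩⟩
      · rw [e1, htop, BidState.sup_eq (Finset.mem_insert_of_mem h2) hmax]
      · rw [e3, Finset.erase_insert_of_ne hwk.ne', Finset.sup_insert]
        rw [NNReal.coe_max]
        simp only [Memory.tick_real]
        rw [h4, h5, max_comm]
    · rw [Program.det_cond_neg σ _ _ (by
        simpa [Test.Holds, NatExpr.eval, RealExpr.eval, h5, htop] using hle)]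
      push Not at hle
      exact htake _ rfl rfl fun i hi =>
        (h3 i hi).elim (fun h => h.trans hle) fun h => h.1.trans_lt hle

theorem splitBefore_succ (h : Fin n → Bool) {j : ℕ} (hj : j < n) :
    splitBefore h (j + 1) = if h ⟨j, hj⟩ = true then insert ⟨j, hj⟩ (splitBefore h j)
      else splitBefore h j := by
  ext i
  have hij : i = ⟨j, hj⟩ ↔ (i : ℕ) = j := by rw [Fin.ext_iff]
  split_ifs with hh
  · simp only [splitBefore, Finset.mem_insert, Finset.mem_filter, Finset.mem_univ, true_and]
    constructor
    · rintro ⟨h1, h2⟩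
      by_cases hi : (i : ℕ) = j
      · exact Or.inl (hij.2 hi)
      · exact Or.inr ⟨h1, by omega⟩
    · rintro (rfl | ⟨h1, h2⟩)
      · exact ⟨hh, Nat.lt_succ_self j⟩
      · exact ⟨h1, by omega⟩
  · simp only [splitBefore, Finset.mem_filter, Finset.mem_univ, true_and]
    constructor
    · rintro ⟨h1, h2⟩
      refine ⟨h1, ?_⟩
      by_contra hcon
      have hi : i = ⟨j, hj⟩ := hij.2 (by omega)
      exact hh (hi ▸ h1)
    · rintro ⟨h1, h2⟩
      exact ⟨h1, by omega⟩

theorem det_valueProgram (σ : Fin n → Strategy m) (h : Fin n → Bool) {μ : Memory}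
    (hn : μ.nat 0 0 = n) (h3 : ∀ i : Fin n, μ.nat 3 i = if h i = true then 1 else 0)
    (h12 : μ.bundle m 12 = Finset.univ) (h13 : μ.nat 13 0 = 0) (hr3 : μ.real 3 0 = 0)
    (hr4 : μ.real 4 0 = 0) (hq : ∀ i, μ.queries i = 0) :
    BidState (Finset.univ.filter fun i => h i = true) (fun i => (σ i).value Finset.univ)
      (valueProgram.det σ μ) ∧
    ∀ i : Fin n, (valueProgram.det σ μ).queries i ≤ if h i = true then 1 else 0 := by
  have key := Program.det_loop_induction σ 9 (cell 0) (.cond (.natLE (.get 3 (cell 9)) (.lit 0)) .skip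
    (.seq (.askValue (cell 9) 12 5 (.lit 0)) updateBid)) μ
    (fun j ν => BidState (splitBefore h j) (fun i => (σ i).value Finset.univ) ν ∧
      ∀ i : Fin n, ν.queries i ≤ if h i = true ∧ (i : ℕ) < j then 1 else 0) ?_ ?_
  · rw [eval_cell, hn] at key
    have e : splitBefore h n = Finset.univ.filter fun i => h i = true := by
      ext i; simp [splitBefore]
    rw [e] at key
    refine ⟨key.1, fun i => (key.2 i).trans ?_⟩
    simp
  · have e : splitBefore h 0 = ∅ := by ext i; simp [splitBefore]
    refine ⟨⟨?_, Or.inl ⟨h13, e, hr4⟩⟩, fun i => ?_⟩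
    · simp [e, hr3]
    · simp [hq]
  · intro j hj ν hfn hfr ⟨hb, hqν⟩
    rw [eval_cell, hn] at hj
    have e3 : ν.nat 3 = μ.nat 3 := hfn 3 rfl
    have e12 : ν.nat 12 = μ.nat 12 := hfn 12 rfl
    set ν' := (ν.tick 1).setNat 9 0 j with hν'
    have hh3 : ν'.nat 3 j = if h ⟨j, hj⟩ = true then 1 else 0 := by
      have := h3 ⟨j, hj⟩
      simp only at this
      simp [hν', e3, this]
    have hb' : ∀ ν'' : Memory, ν''.real 3 = ν.real 3 → ν''.real 4 = ν.real 4 →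
        ν''.nat 13 = ν.nat 13 →
        BidState (splitBefore h j) (fun i => (σ i).value Finset.univ) ν'' :=
      fun ν'' a1 a2 a3 => ⟨by rw [a1]; exact hb.top, by rw [a2, a3]; exact hb.winner⟩
    have h9 : ν'.nat 9 0 = j := by simp [hν']
    rw [splitBefore_succ h hj]
    by_cases hh : h ⟨j, hj⟩ = true
    · rw [Program.det_cond_neg σ _ _ (by simp [Test.Holds, NatExpr.eval, h9, hh3, hh]), if_pos hh,
        Program.det_seq]
      set ξ := (Program.askValue (cell 9) 12 5 (.lit 0)).det σ (ν'.tick 1) with hξ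
      have hbun : ν'.bundle m 12 = Finset.univ := by
        rw [← h12]
        simp [Memory.bundle, hν', e12]
      have x5 : ξ.real 5 0 = (σ ⟨j, hj⟩).value Finset.univ := by
        have hb2 : (ν'.tick 1).bundle m 12 = Finset.univ := hbun
        simp only [hξ, Program.det, eval_cell, Memory.tick_nat, h9, hj, dif_pos, hb2]
        simp [NatExpr.eval]
      have x9 : ξ.nat 9 0 = j := by simp [hξ, Program.det, h9]
      refine ⟨BidState.update σ (hb' ξ ?_ ?_ ?_) (k := ⟨j, hj⟩) ?_ x9 x5, fun i => ?_⟩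
      · rw [hξ, Program.det_real σ rfl]; rfl
      · rw [hξ, Program.det_real σ rfl]; rfl
      · rw [hξ, Program.det_nat σ rfl]; funext i; simp [hν']
      · intro i hi
        exact Fin.lt_def.2 (Finset.mem_filter.1 hi).2.2
      · rw [Program.det_queries σ rfl]
        have x6 : ξ.queries i = if (i : ℕ) = j then ν.queries i + 1 else ν.queries i := by
          simp [hξ, Program.det, hν']
        have := hqν i
        rw [x6]
        by_cases hij : (i : ℕ) = j
        · obtain rfl : i = ⟨j, hj⟩ := Fin.ext hij
          simp [hh] at this ⊢
          omega
        · rw [if_neg hij]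
          refine this.trans (le_of_eq ?_)
          have : (i : ℕ) < j ↔ (i : ℕ) < j + 1 := by omega
          simp only [this]
    · rw [Program.det_cond_pos σ _ _ (by simp [Test.Holds, NatExpr.eval, h9, hh3, hh]), if_neg hh]
      refine ⟨hb' _ ?_ ?_ ?_, fun i => ?_⟩
      · rw [Program.det_real σ rfl]; rfl
      · rw [Program.det_real σ rfl]; rfl
      · rw [Program.det_nat σ rfl]; funext i; simp [hν']
      · rw [Program.det_queries σ rfl]
        refine (hqν i).trans ?_
        split_ifs <;> first | omega | simp_all
        all_goals omega

theorem det_secondPriceProgram (σ : Fin n → Strategy m) {N : Finset (Fin n)} {bid : Fin n → ℝ≥0}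
    {μ : Memory} (hb : BidState N bid μ) (hm : μ.nat 1 0 = m) (h2 : ∀ i, μ.nat 2 i = 0)
    (hr0 : ∀ i, μ.real 0 i = 0) :
    Memory.outcome n m (secondPriceProgram.det σ μ) = secondPriceAuction N bid := by
  rw [secondPriceProgram]
  rcases hb.winner with ⟨h1, rfl, h3⟩ | ⟨w, h1, hw, hmax, h4⟩
  · rw [Program.det_cond_pos σ _ _ (by simp [Test.Holds, NatExpr.eval, h1])]
    simp [Memory.outcome, secondPriceAuction, Program.det, h2, hr0]
  · rw [Program.det_cond_neg σ _ _ (by simp [Test.Holds, NatExpr.eval, h1]), Program.det_seq]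
    have key := Program.det_loop_induction σ 10 (cell 1) (.setNat 2 (cell 10) (cell 13)) (μ.tick 1)
      (fun j ν => ∀ e < j, ν.nat 2 e = w + 1) (by simp) ?_
    · set ξ := (Program.loop 10 (cell 1) (.setNat 2 (cell 10) (cell 13))).det σ (μ.tick 1) with hξ
      simp only [eval_cell, Memory.tick_nat, hm] at key
      have x13 : ξ.nat 13 = μ.nat 13 := Program.det_nat σ rfl _
      have xr : ξ.real = μ.real := funext fun a => Program.det_real σ rfl _
      have hwins : ∀ i, (i ∈ N ∧ ∀ j ∈ N, bid j < bid i ∨ bid j = bid i ∧ i ≤ j) ↔ i = w := by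
        intro i
        constructor
        · rintro ⟨hi, hi'⟩
          rcases hi' w hw with a | a <;> rcases hmax i hi with b | b
          · exact absurd a (lt_asymm b)
          · exact absurd b.1.symm a.ne
          · exact absurd a.1.symm b.ne
          · exact le_antisymm a.2 b.2
        · rintro rfl
          exact ⟨hw, hmax⟩
      have e1 : ∀ (e : Fin m), ((Program.setReal 0 (.sub (cell 13) (.lit 1))
          (.get 4 (.lit 0))).det σ ξ).nat 2 e = w + 1 := fun e => by
        simp [Program.det, key e e.isLt]
      have e2 : ∀ i : Fin n, ((Program.setReal 0 (.sub (cell 13) (.lit 1))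
          (.get 4 (.lit 0))).det σ ξ).real 0 i =
          if i = w then (((N.erase w).sup bid : ℝ≥0) : ℝ) else 0 := fun i => by
        simp [Program.det, NatExpr.eval, RealExpr.eval, x13, xr, h1, h4, hr0, Fin.ext_iff]
      simp only [Memory.outcome, secondPriceAuction, hwins, e1, e2]
      congr 1
      · funext i
        by_cases hi : i = w
        · simp [hi]
        · simp [hi]
          intro hh; exact absurd (Fin.ext hh.symm) hi
      · funext i
        by_cases hi : i = w
        · simp [hi]
        · simp [hi]
    · intro j _ ν hfn _ hν e he
      have e13 : ν.nat 13 = μ.nat 13 := hfn 13 rfl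
      by_cases hej : e = j
      · simp [Program.det, hej, e13, h1]
      · have := hν e (by omega)
        simp [Program.det, hej, this]

end ValuePhase

/-! ### Demand queries and the binary-search mechanism -/

section SearchPhase

variable {n m : ℕ}

theorem two_pow_searchRounds_le (m : ℕ) : 2 ^ searchRounds m ≤ 6 * m + 2 := by
  have h1 : Nat.clog 2 m ≤ m := Nat.clog_le_of_le_pow Nat.lt_two_pow_self.le
  rcases Nat.eq_zero_or_pos (Nat.clog 2 m) with h | h
  · simp [searchRounds, h]
  · have h2 : 2 ^ (searchRounds m - 1) < 3 * Nat.clog 2 m + 1 :=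
      Nat.pow_pred_clog_lt_self (by norm_num) (by omega)
    have h3 : 0 < searchRounds m := Nat.clog_pos (by norm_num) (by omega)
    have h4 : 2 ^ searchRounds m = 2 * 2 ^ (searchRounds m - 1) := by
      rw [← pow_succ', Nat.sub_add_cancel h3]
    omega

theorem searchRounds_le (m : ℕ) : searchRounds m ≤ 3 * m + 1 := by
  have h1 : Nat.clog 2 m ≤ m := Nat.clog_le_of_le_pow Nat.lt_two_pow_self.le
  have h2 : searchRounds m ≤ 3 * Nat.clog 2 m + 1 :=
    Nat.clog_le_of_le_pow Nat.lt_two_pow_self.le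
  omega

theorem Program.det_setReal (σ : Fin n → Strategy m) (a : ℕ) (i : NatExpr) (x : RealExpr)
    (μ : Memory) : (Program.setReal a i x).det σ μ =
      (μ.tick 1).setReal a (i.eval μ) (x.eval μ) := rfl

theorem det_candidateProgram (σ : Fin n → Strategy m) {μ : Memory} (hm : μ.nat 1 0 = m)
    (h8 : μ.nat 8 0 = 2 ^ searchRounds m) {j : ℕ} (hj : j < 2 ^ searchRounds m) :
    (candidateProgram.det σ μ).real 1 j = candidatePrice m (μ.real 3 0) j := by
  set ψ := μ.real 3 0 with hψ
  set K := 2 ^ searchRounds m with hK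
  rw [candidateProgram, Program.det_seq, Program.det_seq]
  set ν₀ := (Program.setReal 6 (.lit 0) (.get 3 (.lit 0))).det σ μ with hν₀
  have hn : ν₀.nat = μ.nat := funext fun a => Program.det_nat σ rfl _
  have key := Program.det_loop_induction σ 10 (.add (threeTimes (.add (cell 1) (cell 1))) (.lit 2))
    (.seq (.setReal 6 (.lit 0) (.half (.get 6 (.lit 0))))
        (.setReal 1 (.sub (.sub (cell 8) (.lit 1)) (cell 10)) (.get 6 (.lit 0)))) ν₀
    (fun t ν => ν.real 6 0 = ψ / 2 ^ t ∧
      ∀ i < K, 0 < i → K ≤ i + t → ν.real 1 i = ψ / 2 ^ (K - i)) ?_ ?_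
  · have hcount : NatExpr.eval ν₀ (.add (threeTimes (.add (cell 1) (cell 1))) (.lit 2)) =
        6 * m + 2 := by
      simp only [NatExpr.eval, eval_threeTimes, eval_cell, hn, hm]; omega
    rw [hcount] at key
    have hKle := two_pow_searchRounds_le m
    by_cases hj0 : j = 0
    · simp [Program.det_setReal, candidatePrice, hj0, NatExpr.eval, RealExpr.eval]
    · have := key.2 j hj (by omega) (by omega)
      simp [Program.det_setReal, candidatePrice, hj0, NatExpr.eval, this, hK]
  · refine ⟨?_, fun i hi _ h => absurd h (by omega)⟩
    simp [hν₀, Program.det, NatExpr.eval, RealExpr.eval, hψ]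
  · intro t _ ν hfn _ ⟨h1, h2⟩
    have e8 : ν.nat 8 0 = K := by rw [hfn 8 rfl, hn, h8]
    have h6 : ψ / 2 ^ t / 2 = ψ / 2 ^ (t + 1) := by rw [div_div, pow_succ]
    refine ⟨?_, fun i hi hi0 hit => ?_⟩
    · simp [Program.det, NatExpr.eval, RealExpr.eval, h1, h6]
    -- Iteration `t` writes `ψ / 2 ^ (t + 1)` to cell `K - 1 - t`.
    · by_cases hie : i = K - 1 - t
      · have : K - i = t + 1 := by omega
        simp [Program.det, NatExpr.eval, RealExpr.eval, e8, ← hie, h1, h6, this]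
      · have := h2 i hi hi0 (by omega)
        simp [Program.det, NatExpr.eval, RealExpr.eval, e8, hie, this]

theorem det_startRound (σ : Fin n → Strategy m) {μ : Memory} (hm : μ.nat 1 0 = m) (e : Fin m) :
    (startRound.det σ μ).real 2 e = μ.real 1 (μ.nat 14 e + μ.nat 17 0) ∧
      (startRound.det σ μ).nat 15 e = 1 ∧ (startRound.det σ μ).nat 2 e = 0 := by
  have key := Program.det_loop_induction σ 10 (cell 1)
    (.seq (.setReal 2 (cell 10) (.get 1 (.add (.get 14 (cell 10)) (cell 17))))
      (.seq (.setNat 15 (cell 10) (.lit 1)) (.setNat 2 (cell 10) (.lit 0)))) μ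
    (fun j ν => ∀ e < j, ν.real 2 e = μ.real 1 (μ.nat 14 e + μ.nat 17 0) ∧ ν.nat 15 e = 1 ∧
      ν.nat 2 e = 0) (by simp) ?_
  · rw [eval_cell, hm] at key
    exact key e e.isLt
  · intro j _ ν hfn hfr hν e he
    have e14 : ν.nat 14 = μ.nat 14 := hfn 14 rfl
    have e17 : ν.nat 17 = μ.nat 17 := hfn 17 rfl
    have e1 : ν.real 1 = μ.real 1 := hfr 1 rfl
    by_cases hej : e = j
    · simp [Program.det, NatExpr.eval, RealExpr.eval, hej, e14, e17, e1]
    · have := hν e (by omega)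
      simp [Program.det, NatExpr.eval, RealExpr.eval, hej, this]

theorem det_markDemanded (σ : Fin n → Strategy m) {μ : Memory} (hm : μ.nat 1 0 = m) (e : Fin m) :
    (markDemanded.det σ μ).nat 2 e = (if μ.nat 16 e = 0 then μ.nat 2 e else μ.nat 9 0 + 1) ∧
      (markDemanded.det σ μ).nat 15 e = if μ.nat 16 e = 0 then μ.nat 15 e else 0 := by
  rw [markDemanded]
  have key := Program.det_loop_induction σ 10 (cell 1)
    (.cond (.natLE (.get 16 (cell 10)) (.lit 0)) .skip
    (.seq (.setNat 2 (cell 10) (.add (cell 9) (.lit 1))) (.setNat 15 (cell 10) (.lit 0)))) μ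
    (fun j ν => ∀ e, ν.nat 2 e = (if e < j ∧ μ.nat 16 e ≠ 0 then μ.nat 9 0 + 1 else μ.nat 2 e) ∧
      ν.nat 15 e = if e < j ∧ μ.nat 16 e ≠ 0 then 0 else μ.nat 15 e) (by simp) ?_
  · rw [eval_cell, hm] at key
    have h := key e
    by_cases h0 : μ.nat 16 e = 0
    · simpa [h0] using h
    · simpa [h0] using h
  · intro j _ ν hfn _ hν e
    have e16 : ν.nat 16 = μ.nat 16 := hfn 16 rfl
    have e9 : ν.nat 9 = μ.nat 9 := hfn 9 rfl
    have hlt : e ≠ j → (e < j + 1 ↔ e < j) := fun h => by omega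
    obtain ⟨h1, h2⟩ := hν e
    by_cases h0 : μ.nat 16 j = 0
    · rw [Program.det_cond_pos σ _ _ (by simp [Test.Holds, NatExpr.eval, e16, h0])]
      by_cases hej : e = j
      · subst hej
        simpa [Program.det, h0] using And.intro h1 h2
      · simpa [Program.det, hlt hej] using And.intro h1 h2
    · rw [Program.det_cond_neg σ _ _ (by simp [Test.Holds, NatExpr.eval, e16, h0])]
      by_cases hej : e = j
      · subst hej
        simp [Program.det, NatExpr.eval, h0, e9]
      · simpa [Program.det, NatExpr.eval, hej, hlt hej] using And.intro h1 h2

theorem remainingItems_append (σ : Fin n → Strategy m) (p : Fin m → ℝ) (L₁ L₂ : List (Fin n))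
    (U : Finset (Fin m)) :
    remainingItems σ p (L₁ ++ L₂) U = remainingItems σ p L₂ (remainingItems σ p L₁ U) := by
  induction L₁ generalizing U with
  | nil => rfl
  | cons j L ih => exact ih _

theorem remainingItems_subset (σ : Fin n → Strategy m) (p : Fin m → ℝ) (L : List (Fin n))
    (U : Finset (Fin m)) : remainingItems σ p L U ⊆ U := by
  induction L generalizing U with
  | nil => exact subset_rfl
  | cons j L ih => exact (ih _).trans Finset.sdiff_subset

theorem notMem_fixedPriceAuction_of_mem_remainingItems (σ : Fin n → Strategy m) (p : Fin m → ℝ)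
    (L : List (Fin n)) (U : Finset (Fin m)) {e : Fin m} (he : e ∈ remainingItems σ p L U)
    (i : Fin n) : e ∉ fixedPriceAuction σ p L U i := by
  induction L generalizing U with
  | nil => simp [fixedPriceAuction]
  | cons j L ih =>
    by_cases hi : i = j
    · subst hi
      have := Finset.mem_sdiff.1 (remainingItems_subset σ p L _ he)
      simpa [fixedPriceAuction] using this.2
    · simpa [fixedPriceAuction, Function.update_of_ne hi] using ih _ he

/-- The auction recurses from the front, whereas the loop invariant of the program extends the list
at its end. -/
theorem fixedPriceAuction_concat (σ : Fin n → Strategy m) (p : Fin m → ℝ) {L : List (Fin n)}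
    (U : Finset (Fin m)) {i : Fin n} (hi : i ∉ L) :
    fixedPriceAuction σ p (L ++ [i]) U = Function.update (fixedPriceAuction σ p L U) i
      ((σ i).demand (remainingItems σ p L U) p) := by
  induction L generalizing U with
  | nil => simp [fixedPriceAuction, remainingItems]
  | cons j L ih =>
    obtain ⟨h1, h2⟩ := not_or.1 (fun hh => hi (List.mem_cons.2 hh))
    simp only [List.cons_append, fixedPriceAuction, remainingItems, ih _ h2]
    rw [Function.update_comm h1]

/-- The number array 2 stores the owners of the items in the allocation `A`. -/
structure StoresAlloc (A : Fin n → Finset (Fin m)) (ν : Memory) : Prop where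
  owner : ∀ (e : Fin m) (i : Fin n), ν.nat 2 e = i + 1 ↔ e ∈ A i
  -- Ensures that a nonzero entry names an actual bidder, so that it means sold.
  le : ∀ e : Fin m, ν.nat 2 e ≤ n

theorem StoresAlloc.ne_zero_iff {A : Fin n → Finset (Fin m)} {ν : Memory} (h : StoresAlloc A ν)
    (e : Fin m) : ν.nat 2 e ≠ 0 ↔ ∃ i, e ∈ A i := by
  constructor
  · intro h0
    have := h.le e
    exact ⟨⟨ν.nat 2 e - 1, by omega⟩, (h.owner e _).1 (by simp only; omega)⟩
  · rintro ⟨i, hi⟩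
    rw [(h.owner e i).2 hi]
    omega

/-- The state of a fixed-price auction after the bidders in the list `L`. -/
structure AuctionState (σ : Fin n → Strategy m) (p : Fin m → ℝ) (L : List (Fin n)) (ν : Memory) :
    Prop where
  price : ∀ e : Fin m, ν.real 2 e = p e
  available : ν.bundle m 15 = remainingItems σ p L Finset.univ
  stores : StoresAlloc (fixedPriceAuction σ p L Finset.univ) ν

/-- The answer lies inside the available items, so marking it never overwrites an earlier owner. -/
theorem AuctionState.sell {σ : Fin n → Strategy m} {p : Fin m → ℝ} {L : List (Fin n)} {ν : Memory}
    (hν : AuctionState σ p L ν) {i : Fin n} (hi : i ∉ L) (h9 : ν.nat 9 0 = i)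
    (hm : ν.nat 1 0 = m) : AuctionState σ p (L ++ [i]) (sellProgram.det σ ν) := by
  rw [sellProgram, Program.det_seq]
  set ξ := (Program.askDemand (cell 9) 15 2 16).det σ ν with hξ
  set D := (σ i).demand (remainingItems σ p L Finset.univ) p with hD
  have hξn : ∀ a, a ≠ 16 → ξ.nat a = ν.nat a := fun a ha =>
    Program.det_nat σ (by simp [Program.writesNat, ha]) _
  have hξD : ∀ e : Fin m, ξ.nat 16 e = if e ∈ D then 1 else 0 := by
    intro e
    have hp : (fun e : Fin m => ν.real 2 e) = p := funext hν.price
    simp only [hξ, Program.det, eval_cell, h9, i.isLt, dif_pos, hν.available, hp]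
    exact Memory.setBundle_nat_self _ _ _ _
  have hmark := det_markDemanded σ (μ := ξ) (by rw [hξn 1 (by decide), hm])
  have hD0 : ∀ e : Fin m, ξ.nat 16 e = 0 ↔ e ∉ D := fun e => by
    rw [hξD]; split_ifs with h <;> simp [h]
  have hDsub : D ⊆ remainingItems σ p L Finset.univ := (σ i).demand_subset _ _
  have havail : ∀ e : Fin m, ν.nat 15 e ≠ 0 ↔ e ∈ remainingItems σ p L Finset.univ := fun e => by
    rw [← hν.available]; simp [Memory.bundle]
  refine ⟨fun e => ?_, ?_, ⟨fun e k => ?_, fun e => ?_⟩⟩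
  · rw [Program.det_real σ rfl, hξ, Program.det_real σ rfl]
    exact hν.price e
  · rw [remainingItems_append]
    ext e
    simp only [Memory.bundle, Finset.mem_filter, Finset.mem_univ, true_and, remainingItems,
      Finset.mem_sdiff, (hmark e).2]
    rw [hξn 15 (by decide), ← havail e]
    by_cases he : e ∈ D
    · simp [hD0, he, ← hD]
    · simp [(hD0 e).2 he, he, ← hD]
  · rw [(hmark e).1, hξn 9 (by decide), hξn 2 (by decide), h9, fixedPriceAuction_concat σ p _ hi,
      ← hD]
    by_cases he : e ∈ D
    · rw [if_neg (by rw [hD0]; exact not_not.2 he)]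
      by_cases hk : k = i
      · subst hk; simp [he]
      · rw [Function.update_of_ne hk]
        have h1 := notMem_fixedPriceAuction_of_mem_remainingItems σ p L Finset.univ (hDsub he) k
        have h2 : ¬ ((i : ℕ) + 1 = k + 1) := fun h => hk (Fin.ext (by omega))
        simp only [h1, h2]
    · rw [if_pos ((hD0 e).2 he), hν.stores.owner e k]
      by_cases hk : k = i
      · subst hk
        rw [fixedPriceAuction_of_notMem σ p _ hi]
        simp [he]
      · rw [Function.update_of_ne hk]
  · rw [(hmark e).1, hξn 9 (by decide), hξn 2 (by decide), h9]
    split_ifs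
    · exact hν.stores.le e
    · exact i.isLt

/-- The bidders of a round among the first `j`. -/
def roundBefore (h : Fin n → Bool) (r : Fin n → Fin (searchRounds m + 1)) (ℓ j : ℕ) :
    List (Fin n) :=
  ((List.finRange n).take j).filter fun i => h i = false ∧ (r i : ℕ) = ℓ

theorem roundBefore_succ (h : Fin n → Bool) (r : Fin n → Fin (searchRounds m + 1)) (ℓ : ℕ) {j : ℕ}
    (hj : j < n) : roundBefore h r ℓ (j + 1) =
      if h ⟨j, hj⟩ = false ∧ (r ⟨j, hj⟩ : ℕ) = ℓ then roundBefore h r ℓ j ++ [⟨j, hj⟩]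
      else roundBefore h r ℓ j := by
  have h1 : (List.finRange n).take (j + 1) = (List.finRange n).take j ++ [⟨j, hj⟩] := by
    rw [List.take_succ_eq_append_getElem (by simpa using hj)]
    simp
  rw [roundBefore, h1, List.filter_append]
  split_ifs with hh
  · simp [roundBefore, hh]
  · simp only [roundBefore, List.filter_singleton]
    rw [decide_eq_false hh, cond_false, List.append_nil]

theorem notMem_roundBefore (h : Fin n → Bool) (r : Fin n → Fin (searchRounds m + 1)) (ℓ : ℕ)
    {j : ℕ} (hj : j < n) : (⟨j, hj⟩ : Fin n) ∉ roundBefore h r ℓ j := by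
  intro hmem
  have h1 := (List.mem_filter.1 hmem).1
  rw [List.mem_take_iff_getElem] at h1
  obtain ⟨i, hi, hi'⟩ := h1
  simp [Fin.ext_iff] at hi'
  simp at hi
  omega

theorem roundBefore_all (h : Fin n → Bool) (r : Fin n → Fin (searchRounds m + 1)) (ℓ : ℕ) :
    roundBefore h r ℓ n = roundBidders ((List.finRange n).filter fun i => h i = false) r ℓ := by
  rw [roundBefore, roundBidders, List.filter_filter,
    List.take_of_length_le (by simp)]
  refine List.filter_congr fun i _ => ?_
  simp [Bool.and_comm]

theorem det_sellLoop (σ : Fin n → Strategy m) {h : Fin n → Bool}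
    {r : Fin n → Fin (searchRounds m + 1)} {p : Fin m → ℝ} {ℓ : ℕ} {μ : Memory}
    (hn : μ.nat 0 0 = n) (hm : μ.nat 1 0 = m)
    (h3 : ∀ i : Fin n, μ.nat 3 i = if h i = true then 1 else 0)
    (h4 : ∀ i : Fin n, μ.nat 4 i = r i) (h11 : μ.nat 11 0 = ℓ) (hμ : AuctionState σ p [] μ) :
    AuctionState σ p (roundBidders ((List.finRange n).filter fun i => h i = false) r ℓ)
      (sellLoop.det σ μ) ∧
    ∀ i : Fin n, (sellLoop.det σ μ).queries i =
      μ.queries i + if h i = false ∧ (r i : ℕ) = ℓ then 1 else 0 := by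
  rw [sellLoop]
  have key := Program.det_loop_induction σ 9 (cell 0) (.cond (.natLE (.get 3 (cell 9)) (.lit 0))
    (.cond (.natLE (.get 4 (cell 9)) (cell 11))
      (.cond (.natLE (cell 11) (.get 4 (cell 9))) sellProgram .skip) .skip) .skip) μ
    (fun j ν => AuctionState σ p (roundBefore h r ℓ j) ν ∧ ∀ i : Fin n, ν.queries i =
      μ.queries i + if h i = false ∧ (r i : ℕ) = ℓ ∧ (i : ℕ) < j then 1 else 0) ?_ ?_
  · rw [eval_cell, hn, roundBefore_all] at key
    refine ⟨key.1, fun i => ?_⟩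
    have := key.2 i
    simpa using this
  · refine ⟨⟨hμ.price, ?_, ?_⟩, fun i => by simp⟩
    · exact hμ.available
    · exact ⟨hμ.stores.owner, hμ.stores.le⟩
  · intro j hj ν hfn _ ⟨hν, hq⟩
    rw [eval_cell, hn] at hj
    set ν' := (ν.tick 1).setNat 9 0 j with hν'
    have e : ∀ a, sellLoop.writesNat a = false → ν'.nat a = μ.nat a := fun a ha => by
      have ha9 : a ≠ 9 := by rintro rfl; exact absurd ha (by decide)
      rw [← hfn a ha]
      funext i
      simp [hν', ha9]
    have h9 : ν'.nat 9 0 = j := by simp [hν']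
    have h3' : ν'.nat 3 j = if h ⟨j, hj⟩ = true then 1 else 0 := by
      rw [e 3 rfl]; exact h3 ⟨j, hj⟩
    have h4' : ν'.nat 4 j = r ⟨j, hj⟩ := by rw [e 4 rfl]; exact h4 ⟨j, hj⟩
    have h11' : ν'.nat 11 0 = ℓ := by rw [e 11 rfl, h11]
    have hcopy : ∀ ξ : Memory, ξ.nat = ν'.nat → ξ.real = ν'.real →
        AuctionState σ p (roundBefore h r ℓ j) ξ := fun ξ hξn hξr => by
      have a2 : ξ.nat 2 = ν.nat 2 := by rw [hξn]; funext i; simp [hν']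
      have a15 : ξ.nat 15 = ν.nat 15 := by rw [hξn]; funext i; simp [hν']
      refine ⟨fun e => by rw [hξr]; exact hν.price e, ?_, ?_⟩
      · rw [← hν.available, Memory.bundle, Memory.bundle, a15]
      · exact ⟨fun e i => by rw [a2]; exact hν.stores.owner e i,
          fun e => by rw [a2]; exact hν.stores.le e⟩
    rw [roundBefore_succ h r ℓ hj]
    have hother : ∀ i : Fin n, (i : ℕ) ≠ j → ((i : ℕ) < j + 1 ↔ (i : ℕ) < j) := fun i hi => by omega
    have hskip : ∀ ξ : Memory, ξ.nat = ν'.nat → ξ.real = ν'.real → ξ.queries = ν.queries →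
        ¬ (h ⟨j, hj⟩ = false ∧ (r ⟨j, hj⟩ : ℕ) = ℓ) →
        (AuctionState σ p (if h ⟨j, hj⟩ = false ∧ (r ⟨j, hj⟩ : ℕ) = ℓ then
          roundBefore h r ℓ j ++ [⟨j, hj⟩] else roundBefore h r ℓ j) ξ ∧
        ∀ i : Fin n, ξ.queries i = μ.queries i +
          if h i = false ∧ (r i : ℕ) = ℓ ∧ (i : ℕ) < j + 1 then 1 else 0) := by
      intro ξ hξn hξr hξq hne
      rw [if_neg hne, hξq]
      refine ⟨hcopy ξ hξn hξr, fun i => (hq i).trans ?_⟩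
      by_cases hij : (i : ℕ) = j
      · obtain rfl : i = ⟨j, hj⟩ := Fin.ext hij
        rw [if_neg (fun hh => hne ⟨hh.1, hh.2.1⟩), if_neg (fun hh => hne ⟨hh.1, hh.2.1⟩)]
      · simp only [hother i hij]
    by_cases c1 : h ⟨j, hj⟩ = true
    · rw [Program.det_cond_neg σ _ _ (by simp [Test.Holds, NatExpr.eval, h9, h3', c1])]
      exact hskip _ rfl rfl rfl (by simp [c1])
    · rw [Program.det_cond_pos σ _ _ (by simp [Test.Holds, NatExpr.eval, h9, h3', c1])]
      have c1' : h ⟨j, hj⟩ = false := by simpa using c1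
      by_cases c2 : (r ⟨j, hj⟩ : ℕ) ≤ ℓ
      · rw [Program.det_cond_pos σ _ _ (by simp [Test.Holds, NatExpr.eval, h9, h4', h11', c2])]
        by_cases c3 : ℓ ≤ (r ⟨j, hj⟩ : ℕ)
        · rw [Program.det_cond_pos σ _ _ (by simp [Test.Holds, NatExpr.eval, h9, h4', h11', c3])]
          rw [if_pos ⟨c1', le_antisymm c2 c3⟩]
          refine ⟨AuctionState.sell (hcopy (((ν'.tick 1).tick 1).tick 1) rfl rfl) (notMem_roundBefore h r ℓ hj) h9
            (by rw [← hm]; exact congrFun (e 1 rfl) 0), fun i => ?_⟩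
          rw [sellProgram, Program.det_seq, Program.det_queries σ rfl]
          have x6 : ((Program.askDemand (cell 9) 15 2 16).det σ
              (((ν'.tick 1).tick 1).tick 1)).queries i =
              if (i : ℕ) = j then ν.queries i + 1 else ν.queries i := by
            simp [Program.det, hν']
          rw [x6, hq i]
          by_cases hij : (i : ℕ) = j
          · obtain rfl : i = ⟨j, hj⟩ := Fin.ext hij
            simp [c1', le_antisymm c2 c3]
          · rw [if_neg hij]
            simp only [hother i hij]
        · rw [Program.det_cond_neg σ _ _ (by simpa [Test.Holds, NatExpr.eval, h9, h4', h11'] using c3)]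
          exact hskip _ rfl rfl rfl (fun hh => c3 hh.2.ge)
      · rw [Program.det_cond_neg σ _ _ (by simpa [Test.Holds, NatExpr.eval, h9, h4', h11'] using c2)]
        exact hskip _ rfl rfl rfl (fun hh => c2 hh.2.le)

theorem det_updateLow (σ : Fin n → Strategy m) {μ : Memory} (hm : μ.nat 1 0 = m) (e : Fin m) :
    (updateLow.det σ μ).nat 14 e =
      if μ.nat 2 e ≠ 0 then μ.nat 14 e + μ.nat 17 0 else μ.nat 14 e := by
  rw [updateLow]
  have key := Program.det_loop_induction σ 10 (cell 1)
    (.cond (.natLE (.get 2 (cell 10)) (.lit 0)) .skip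
    (.setNat 14 (cell 10) (.add (.get 14 (cell 10)) (cell 17)))) μ
    (fun j ν => ∀ e, ν.nat 14 e =
      if e < j ∧ μ.nat 2 e ≠ 0 then μ.nat 14 e + μ.nat 17 0 else μ.nat 14 e) (by simp) ?_
  · rw [eval_cell, hm] at key
    simpa using key e
  · intro j _ ν hfn _ hν e
    have e2 : ν.nat 2 = μ.nat 2 := hfn 2 rfl
    have e17 : ν.nat 17 = μ.nat 17 := hfn 17 rfl
    have hlt : e ≠ j → (e < j + 1 ↔ e < j) := fun h => by omega
    have h1 := hν e
    by_cases h0 : μ.nat 2 j = 0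
    · rw [Program.det_cond_pos σ _ _ (by simp [Test.Holds, NatExpr.eval, e2, h0])]
      by_cases hej : e = j
      · subst hej
        simpa [Program.det, h0] using h1
      · simpa [Program.det, hlt hej] using h1
    · rw [Program.det_cond_neg σ _ _ (by simp [Test.Holds, NatExpr.eval, e2, h0])]
      by_cases hej : e = j
      · subst hej
        simp at h1
        simp [Program.det, NatExpr.eval, h0, e17, h1]
      · simpa [Program.det, NatExpr.eval, hej, hlt hej] using h1

/-- Keeps the price index within the cells that `candidateProgram` has filled. -/
theorem lowIndex_add_le (σ : Fin n → Strategy m) (N : List (Fin n)) (ψ : ℝ)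
    (r : Fin n → Fin (searchRounds m + 1)) (e : Fin m) {ℓ : ℕ} (hℓ : ℓ ≤ searchRounds m) :
    lowIndex σ N ψ r ℓ e + 2 ^ (searchRounds m - ℓ) ≤ 2 ^ searchRounds m := by
  induction ℓ with
  | zero => simp [lowIndex]
  | succ ℓ ih =>
    have := ih (by omega)
    obtain ⟨h1, h2⟩ := two_pow_sub_half (show ℓ < searchRounds m by omega)
    rw [lowIndex_succ, h1]
    split_ifs <;> omega

/-- The state of the binary-search mechanism before round `ℓ`. -/
structure SearchState (σ : Fin n → Strategy m) (h : Fin n → Bool) (ψ : ℝ)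
    (r : Fin n → Fin (searchRounds m + 1)) (ℓ : ℕ) (ν : Memory) : Prop where
  low : ∀ e : Fin m, ν.nat 14 e =
    lowIndex σ ((List.finRange n).filter fun i => h i = false) ψ r ℓ e
  -- The guard is needed: the last round halves the width `1` to `0`.
  width : ℓ ≤ searchRounds m → ν.nat 17 0 = 2 ^ (searchRounds m - ℓ)
  price : ∀ k, ℓ = k + 1 → ∀ e : Fin m, ν.real 2 e =
    searchPrice σ ((List.finRange n).filter fun i => h i = false) ψ r k e
  stores : ∀ k, ℓ = k + 1 → StoresAlloc
    (searchAlloc σ ((List.finRange n).filter fun i => h i = false) ψ r k) ν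

theorem SearchState.round {σ : Fin n → Strategy m} {h : Fin n → Bool} {ψ : ℝ}
    {r : Fin n → Fin (searchRounds m + 1)} {ℓ : ℕ} {ν : Memory} (hν : SearchState σ h ψ r ℓ ν)
    (hℓ : ℓ ≤ searchRounds m) (hn : ν.nat 0 0 = n) (hm : ν.nat 1 0 = m)
    (h3 : ∀ i : Fin n, ν.nat 3 i = if h i = true then 1 else 0)
    (h4 : ∀ i : Fin n, ν.nat 4 i = r i) (h11 : ν.nat 11 0 = ℓ)
    (hc : ∀ j < 2 ^ searchRounds m, ν.real 1 j = candidatePrice m ψ j) :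
    SearchState σ h ψ r (ℓ + 1) (roundProgram.det σ ν) ∧
    ∀ i : Fin n, (roundProgram.det σ ν).queries i =
      ν.queries i + if h i = false ∧ (r i : ℕ) = ℓ then 1 else 0 := by
  set N := (List.finRange n).filter fun i => h i = false with hN
  rw [roundProgram, Program.det_seq, Program.det_seq, Program.det_seq]
  set ν₁ := (Program.setNat 17 (.lit 0) (.half (cell 17))).det σ ν with hν₁
  set ν₂ := startRound.det σ ν₁ with hν₂
  set ν₃ := sellLoop.det σ ν₂ with hν₃
  have f₁ : ∀ a, a ≠ 17 → ν₁.nat a = ν.nat a := fun a ha =>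
    Program.det_nat σ (by simp [Program.writesNat, ha]) _
  have f₁r : ν₁.real = ν.real := rfl
  have f₂ : ∀ a, startRound.writesNat a = false → ν₂.nat a = ν₁.nat a := fun a ha =>
    Program.det_nat σ ha _
  have f₃ : ∀ a, sellLoop.writesNat a = false → ν₃.nat a = ν₂.nat a := fun a ha =>
    Program.det_nat σ ha _
  have hw : ν₁.nat 17 0 = 2 ^ (searchRounds m - ℓ) / 2 := by
    simp [hν₁, Program.det, NatExpr.eval, hν.width hℓ]
  have hstart := det_startRound σ (μ := ν₁) (by rw [f₁ 1 (by decide), hm])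
  have hA : AuctionState σ (searchPrice σ N ψ r ℓ) [] ν₂ := by
    refine ⟨fun e => ?_, ?_, ⟨fun e i => ?_, fun e => ?_⟩⟩
    · rw [(hstart e).1, f₁ 14 (by decide), hν.low e, hw, f₁r, hc]
      · rfl
      · have h1 := lowIndex_add_le σ N ψ r e hℓ
        have h2 : 0 < 2 ^ (searchRounds m - ℓ) := by positivity
        change lowIndex σ N ψ r ℓ e + 2 ^ (searchRounds m - ℓ) / 2 < _
        omega
    · ext e
      simp only [Memory.bundle, Finset.mem_filter, Finset.mem_univ, true_and, remainingItems,
        iff_true]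
      rw [(hstart e).2.1]
      exact one_ne_zero
    · rw [(hstart e).2.2]
      simp [fixedPriceAuction]
    · rw [(hstart e).2.2]
      exact Nat.zero_le _
  obtain ⟨hsell, hq⟩ := det_sellLoop σ (h := h) (r := r) (ℓ := ℓ) (μ := ν₂)
    (by rw [f₂ 0 rfl, f₁ 0 (by decide), hn]) (by rw [f₂ 1 rfl, f₁ 1 (by decide), hm])
    (fun i => by rw [f₂ 3 rfl, f₁ 3 (by decide), h3]) (fun i => by rw [f₂ 4 rfl, f₁ 4 (by decide), h4])
    (by rw [f₂ 11 rfl, f₁ 11 (by decide), h11]) hA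
  have hlow := det_updateLow σ (μ := ν₃) (by rw [f₃ 1 rfl, f₂ 1 rfl, f₁ 1 (by decide), hm])
  have hstores : StoresAlloc (searchAlloc σ N ψ r ℓ) ν₃ := hsell.stores
  refine ⟨⟨fun e => ?_, fun hℓ' => ?_, fun k hk e => ?_, fun k hk => ?_⟩, fun i => ?_⟩
  · rw [hlow e, lowIndex_succ, f₃ 14 rfl, f₃ 17 rfl, f₂ 14 rfl, f₂ 17 rfl, f₁ 14 (by decide),
      hν.low e, hw]
    have := hstores.ne_zero_iff e
    by_cases h0 : ν₃.nat 2 e = 0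
    · rw [if_neg (not_not.2 h0), if_neg (fun hh => this.2 hh h0)]
    · rw [if_pos h0, if_pos (this.1 h0)]
  · rw [Program.det_nat σ rfl, f₃ 17 rfl, f₂ 17 rfl, hw]
    exact (two_pow_sub_half (by omega)).1
  · obtain rfl : ℓ = k := by omega
    rw [Program.det_real σ rfl]
    exact hsell.price e
  · obtain rfl : ℓ = k := by omega
    have e2 : (updateLow.det σ ν₃).nat 2 = ν₃.nat 2 := Program.det_nat σ rfl _
    exact ⟨fun e i => by rw [e2]; exact hstores.owner e i, fun e => by rw [e2]; exact hstores.le e⟩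
  · rw [Program.det_queries σ rfl, hq i, hν₂, Program.det_queries σ rfl]
    rfl

theorem det_roundsProgram (σ : Fin n → Strategy m) {h : Fin n → Bool} {ψ : ℝ}
    {r : Fin n → Fin (searchRounds m + 1)} {rstar : Fin (searchRounds m + 1)} {μ : Memory}
    (hn : μ.nat 0 0 = n) (hm : μ.nat 1 0 = m)
    (h3 : ∀ i : Fin n, μ.nat 3 i = if h i = true then 1 else 0)
    (h4 : ∀ i : Fin n, μ.nat 4 i = r i) (h6 : μ.nat 6 0 = rstar)
    (hc : ∀ j < 2 ^ searchRounds m, μ.real 1 j = candidatePrice m ψ j)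
    (h14 : ∀ i, μ.nat 14 i = 0) (h17 : μ.nat 17 0 = 2 ^ searchRounds m)
    (hq : ∀ i : Fin n, μ.queries i ≤ if h i = true then 1 else 0) :
    SearchState σ h ψ r (rstar + 1) (roundsProgram.det σ μ) ∧
    ∀ i : Fin n, (roundsProgram.det σ μ).queries i ≤ 1 := by
  have key := Program.det_loop_induction σ 11 (.add (threeTimes (cell 1)) (.lit 2))
    (.cond (.natLE (cell 11) (cell 6)) roundProgram .skip) μ
    -- The state freezes after round `rstar`, so it ends with the prices and owners of that round.
    -- The query bound grows only when the loop passes a bidder's own round, and split-off bidders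
    -- have used their single query already.
    (fun j ν => SearchState σ h ψ r (min j (rstar + 1)) ν ∧
      ∀ i : Fin n, ν.queries i ≤ if h i = true ∨ (r i : ℕ) < j then 1 else 0) ?_ ?_
  · have hcount : NatExpr.eval μ (.add (threeTimes (cell 1)) (.lit 2)) = 3 * m + 2 := by
      simp only [NatExpr.eval, eval_threeTimes, eval_cell, hm]
    have hle := searchRounds_le m
    rw [hcount, min_eq_right (by omega)] at key
    refine ⟨key.1, fun i => (key.2 i).trans ?_⟩
    split_ifs <;> omega
  · refine ⟨⟨fun e => ?_, fun _ => ?_, fun k hk => ?_, fun k hk => ?_⟩, fun i => ?_⟩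
    · simp [lowIndex, h14]
    · simpa using h17
    · simp at hk
    · simp at hk
    · simpa using hq i
  · intro j _ ν hfn hfr ⟨hν, hqν⟩
    set ν' := (ν.tick 1).setNat 11 0 j with hν'
    have hf : ∀ a, roundsProgram.writesNat a = false → ν'.nat a = μ.nat a := fun a ha => by
      have ha11 : a ≠ 11 := by rintro rfl; exact absurd ha (by decide)
      rw [← hfn a ha]
      funext i
      simp [hν', ha11]
    have h11 : ν'.nat 11 0 = j := by simp [hν']
    have hcopy : SearchState σ h ψ r (min j (rstar + 1)) (ν'.tick 1) := by
      have a2 : (ν'.tick 1).nat 2 = ν.nat 2 := by funext i; simp [hν']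
      have a14 : (ν'.tick 1).nat 14 = ν.nat 14 := by funext i; simp [hν']
      have a17 : (ν'.tick 1).nat 17 = ν.nat 17 := by funext i; simp [hν']
      refine ⟨fun e => by rw [a14]; exact hν.low e, fun hh => by rw [a17]; exact hν.width hh,
        hν.price, fun k hk => ⟨fun e i => ?_, fun e => ?_⟩⟩
      · rw [a2]; exact (hν.stores k hk).owner e i
      · rw [a2]; exact (hν.stores k hk).le e
    by_cases hj : j ≤ rstar
    · rw [Program.det_cond_pos σ _ _ (by simp [Test.Holds, h11, hf 6 rfl, h6, hj])]
      rw [min_eq_left (by omega)] at hcopy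
      rw [min_eq_left (by omega)]
      have hround := hcopy.round (by omega) (by simp [hf 0 rfl, hn]) (by simp [hf 1 rfl, hm])
        (fun i => by simp [hf 3 rfl, h3]) (fun i => by simp [hf 4 rfl, h4]) h11
        (fun i hi => by rw [← hc i hi, ← hfr 1 rfl]; rfl)
      refine ⟨hround.1, fun i => ?_⟩
      rw [hround.2 i]
      have := hqν i
      have e : (ν'.tick 1).queries i = ν.queries i := rfl
      rw [e]
      cases hi : h i
      · simp only [hi, Bool.false_eq_true, false_or] at this ⊢
        by_cases hr : (r i : ℕ) = j
        · simp [hr] at this ⊢; omega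
        · have : (r i : ℕ) < j + 1 ↔ (r i : ℕ) < j := by omega
          simp [hr, this]
          assumption
      · simp [hi] at this ⊢
        exact this
    · rw [Program.det_cond_neg σ _ _ (by simpa [Test.Holds, h11, hf 6 rfl, h6] using hj)]
      rw [min_eq_right (by omega)] at hcopy
      rw [min_eq_right (by omega)]
      refine ⟨⟨hcopy.low, hcopy.width, hcopy.price, fun k hk =>
        ⟨(hcopy.stores k hk).owner, (hcopy.stores k hk).le⟩⟩, fun i => (hqν i).trans ?_⟩
      by_cases hi : h i = true ∨ (r i : ℕ) < j
      · rw [if_pos hi, if_pos (hi.imp id fun hh => by omega)]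
      · rw [if_neg hi]; exact Nat.zero_le _

theorem det_payProgram (σ : Fin n → Strategy m) {A : Fin n → Finset (Fin m)} {μ : Memory}
    (hm : μ.nat 1 0 = m) (hr0 : ∀ i, μ.real 0 i = 0) (hA : StoresAlloc A μ) (i : Fin n) :
    (payProgram.det σ μ).real 0 i = ∑ e ∈ A i, μ.real 2 e := by
  rw [payProgram]
  have key := Program.det_loop_induction σ 10 (cell 1)
    (.cond (.natLE (.get 2 (cell 10)) (.lit 0)) .skip
    (.setReal 0 (.sub (.get 2 (cell 10)) (.lit 1))
      (.add (.get 0 (.sub (.get 2 (cell 10)) (.lit 1))) (.get 2 (cell 10))))) μ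
    (fun j ν => ν.real 0 i = ∑ e ∈ (A i).filter (fun e : Fin m => (e : ℕ) < j), μ.real 2 e)
    (by simp [hr0]) ?_
  · rw [eval_cell, hm] at key
    simpa using key
  · intro j hj ν hfn hfr hν
    rw [eval_cell, hm] at hj
    have e2 : ν.nat 2 = μ.nat 2 := hfn 2 rfl
    have er2 : ν.real 2 = μ.real 2 := hfr 2 rfl
    have hown := hA.owner ⟨j, hj⟩ i
    simp only at hown
    have hfil : (A i).filter (fun e : Fin m => (e : ℕ) < j + 1) =
        if (⟨j, hj⟩ : Fin m) ∈ A i then insert ⟨j, hj⟩ ((A i).filter (fun e : Fin m => (e : ℕ) < j))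
        else (A i).filter (fun e : Fin m => (e : ℕ) < j) := by
      ext e
      split_ifs with hmem
      · simp only [Finset.mem_filter, Finset.mem_insert, Fin.ext_iff]
        constructor
        · rintro ⟨h1, h2⟩
          by_cases hej : (e : ℕ) = j
          · exact Or.inl hej
          · exact Or.inr ⟨h1, by omega⟩
        · rintro (h1 | ⟨h1, h2⟩)
          · obtain rfl : e = ⟨j, hj⟩ := Fin.ext h1
            exact ⟨hmem, Nat.lt_succ_self j⟩
          · exact ⟨h1, by omega⟩
      · simp only [Finset.mem_filter]
        refine and_congr_right fun h1 => ?_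
        have : (e : ℕ) ≠ j := by
          intro hej
          obtain rfl : e = ⟨j, hj⟩ := Fin.ext hej
          exact hmem h1
        omega
    rw [hfil]
    by_cases h0 : μ.nat 2 j = 0
    · rw [Program.det_cond_pos σ _ _ (by simp [Test.Holds, NatExpr.eval, e2, h0])]
      rw [if_neg (fun hh => by have := hown.2 hh; omega)]
      exact hν
    · rw [Program.det_cond_neg σ _ _ (by simp [Test.Holds, NatExpr.eval, e2, h0])]
      by_cases hi : (⟨j, hj⟩ : Fin m) ∈ A i
      · rw [if_pos hi, Finset.sum_insert (by simp), ← hν]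
        simp [Program.det, NatExpr.eval, RealExpr.eval, e2, er2, hown.2 hi]
        ring
      · rw [if_neg hi, ← hν]
        -- The entry is nonzero here, so subtracting 1 is exact and the payment goes to a different
        -- bidder.
        have hne : (i : ℕ) ≠ μ.nat 2 j - 1 := fun hh => hi (hown.1 (by omega))
        simp [Program.det, NatExpr.eval, RealExpr.eval, e2, hne]

theorem det_searchProgram (σ : Fin n → Strategy m) {h : Fin n → Bool}
    {r : Fin n → Fin (searchRounds m + 1)} {rstar : Fin (searchRounds m + 1)} {μ : Memory}
    (hn : μ.nat 0 0 = n) (hm : μ.nat 1 0 = m)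
    (h3 : ∀ i : Fin n, μ.nat 3 i = if h i = true then 1 else 0)
    (h4 : ∀ i : Fin n, μ.nat 4 i = r i) (h6 : μ.nat 6 0 = rstar)
    (h8 : μ.nat 8 0 = 2 ^ searchRounds m) (h14 : ∀ i, μ.nat 14 i = 0)
    (hr0 : ∀ i, μ.real 0 i = 0) (hq : ∀ i : Fin n, μ.queries i ≤ if h i = true then 1 else 0) :
    Memory.outcome n m (searchProgram.det σ μ) =
      binarySearchMechanism σ ((List.finRange n).filter fun i => h i = false) (μ.real 3 0) r rstar ∧
    ∀ i : Fin n, (searchProgram.det σ μ).queries i ≤ 1 := by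
  set N := (List.finRange n).filter fun i => h i = false with hN
  rw [searchProgram, Program.det_seq, Program.det_seq, Program.det_seq]
  set ν₁ := candidateProgram.det σ μ with hν₁
  set ν₂ := (Program.setNat 17 (.lit 0) (cell 8)).det σ ν₁ with hν₂
  set ν₃ := roundsProgram.det σ ν₂ with hν₃
  have f₁ : ∀ a, a ≠ 10 → ν₁.nat a = μ.nat a := fun a ha =>
    Program.det_nat σ (by simp [candidateProgram, Program.writesNat, ha]) _
  have f₂ : ∀ a, a ≠ 17 → ν₂.nat a = ν₁.nat a := fun a ha =>
    Program.det_nat σ (by simp [Program.writesNat, ha]) _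
  have f₃ : ∀ a, roundsProgram.writesNat a = false → ν₃.nat a = ν₂.nat a := fun a ha =>
    Program.det_nat σ ha _
  have g : ∀ a, a ≠ 10 → a ≠ 17 → ν₂.nat a = μ.nat a := fun a h1 h2 => by rw [f₂ a h2, f₁ a h1]
  obtain ⟨hs, hq₃⟩ := det_roundsProgram σ (h := h) (ψ := μ.real 3 0) (r := r) (rstar := rstar)
    (μ := ν₂) (by rw [g 0 (by decide) (by decide), hn]) (by rw [g 1 (by decide) (by decide), hm])
    (fun i => by rw [g 3 (by decide) (by decide), h3])
    (fun i => by rw [g 4 (by decide) (by decide), h4]) (by rw [g 6 (by decide) (by decide), h6])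
    (fun j hj => det_candidateProgram σ hm h8 hj)
    (fun i => by rw [g 14 (by decide) (by decide), h14])
    (by simp [hν₂, Program.det, NatExpr.eval, f₁ 8 (by decide), h8])
    (fun i => by
      rw [hν₂, Program.det_queries σ rfl, hν₁, Program.det_queries σ rfl]
      exact hq i)
  rw [← hν₃] at hs hq₃
  have hstores := hs.stores rstar rfl
  have hprice := hs.price rstar rfl
  have hpay := det_payProgram σ (A := searchAlloc σ N (μ.real 3 0) r rstar) (μ := ν₃)
    (by rw [f₃ 1 rfl, g 1 (by decide) (by decide), hm])
    (fun i => by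
      rw [hν₃, Program.det_real σ rfl, hν₂, Program.det_real σ rfl, hν₁, Program.det_real σ rfl]
      exact hr0 i) hstores
  refine ⟨?_, fun i => ?_⟩
  · have e2 : (payProgram.det σ ν₃).nat 2 = ν₃.nat 2 := Program.det_nat σ rfl _
    have h1 : (Memory.outcome n m (payProgram.det σ ν₃)).alloc =
        searchAlloc σ N (μ.real 3 0) r rstar := by
      funext i
      ext e
      simp only [Memory.outcome, Finset.mem_filter, Finset.mem_univ, true_and, e2]
      exact hstores.owner e i
    have h2 : (Memory.outcome n m (payProgram.det σ ν₃)).pay = fun i =>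
        ∑ e ∈ searchAlloc σ N (μ.real 3 0) r rstar i, searchPrice σ N (μ.real 3 0) r rstar e := by
      funext i
      simp only [Memory.outcome, hpay i, hprice]
      rfl
    exact (congrArg₂ Outcome.mk h1 h2 :)
  · rw [Program.det_queries σ rfl]
    exact hq₃ i

end SearchPhase

/-! ### The program plays the mechanism -/

section Implementation

variable {n m : ℕ}

theorem det_mainProgram (σ : Fin n → Strategy m) {h : Fin n → Bool} {c : Bool}
    {r : Fin n → Fin (searchRounds m + 1)} {rstar : Fin (searchRounds m + 1)} {μ : Memory}
    (hμ : Drawn m h c r rstar μ) :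
    Memory.outcome n m (mainProgram.det σ μ) =
      (finalMechanism n m).outcome (h, c, r, rstar) σ ∧
    ∀ i : Fin n, (mainProgram.det σ μ).queries i ≤ 1 := by
  rw [mainProgram, Program.det_seq, Program.det_seq]
  set ν₁ := allItemsProgram.det σ μ with hν₁
  set ν₂ := valueProgram.det σ ν₁ with hν₂
  have h12 : ν₁.bundle m 12 = Finset.univ := det_allItemsProgram σ hμ.items
  have f₁ : ∀ a, allItemsProgram.writesNat a = false → ν₁.nat a = μ.nat a := fun a ha =>
    Program.det_nat σ ha _
  have f₁r : ν₁.real = μ.real := funext fun a => Program.det_real σ rfl _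
  have f₁q : ν₁.queries = μ.queries := Program.det_queries σ rfl _
  have f₂ : ∀ a, valueProgram.writesNat a = false → ν₂.nat a = ν₁.nat a := fun a ha =>
    Program.det_nat σ ha _
  obtain ⟨hb, hq⟩ := det_valueProgram σ h (μ := ν₁) (by rw [f₁ 0 rfl, hμ.bidders])
    (fun i => by rw [f₁ 3 rfl, hμ.split]) h12 (by rw [f₁ 13 rfl, hμ.nat_zero 13 (by simp)])
    (by rw [f₁r, hμ.real_zero]) (by rw [f₁r, hμ.real_zero]) (fun i => by rw [f₁q, hμ.queries])
  rw [← hν₂] at hb hq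
  have hr0 : ∀ i, ν₂.real 0 i = 0 := fun i => by
    rw [hν₂, Program.det_real σ rfl, f₁r, hμ.real_zero]
  cases c with
  | true =>
    rw [Program.det_cond_neg σ _ _ (by
      simp [Test.Holds, NatExpr.eval, f₂ 5 rfl, f₁ 5 rfl, hμ.coin])]
    refine ⟨?_, fun i => ?_⟩
    · have hb' : BidState (Finset.univ.filter fun i => h i = true)
          (fun i => (σ i).value Finset.univ) (ν₂.tick 1) := ⟨hb.top, hb.winner⟩
      rw [det_secondPriceProgram σ hb' (by simp [f₂ 1 rfl, f₁ 1 rfl, hμ.items])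
        (fun i => by simp [f₂ 2 rfl, f₁ 2 rfl, hμ.nat_zero 2 (by simp)]) hr0]
      simp [finalMechanism]
    · rw [Program.det_queries σ rfl]
      refine (hq i).trans ?_
      split_ifs <;> omega
  | false =>
    rw [Program.det_cond_pos σ _ _ (by
      simp [Test.Holds, NatExpr.eval, f₂ 5 rfl, f₁ 5 rfl, hμ.coin])]
    obtain ⟨h1, h2⟩ := det_searchProgram σ (h := h) (r := r) (rstar := rstar) (μ := ν₂.tick 1)
      (by simp [f₂ 0 rfl, f₁ 0 rfl, hμ.bidders]) (by simp [f₂ 1 rfl, f₁ 1 rfl, hμ.items])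
      (fun i => by simp [f₂ 3 rfl, f₁ 3 rfl, hμ.split])
      (fun i => by simp [f₂ 4 rfl, f₁ 4 rfl, hμ.round])
      (by simp [f₂ 6 rfl, f₁ 6 rfl, hμ.lastRound]) (by simp [f₂ 8 rfl, f₁ 8 rfl, hμ.candidates])
      (fun i => by simp [f₂ 14 rfl, f₁ 14 rfl, hμ.nat_zero 14 (by simp)]) hr0 hq
    refine ⟨?_, h2⟩
    rw [h1, Memory.tick_real, hb.top]
    simp [finalMechanism]

theorem run_auctionProgram (σ : Fin n → Strategy m) : auctionProgram.run σ =
    (PMF.uniformOfFintype ((Fin n → Fin 2 × Fin (searchRounds m + 1)) × Fin 2 ×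
      Fin (searchRounds m + 1))).map (fun s => mainProgram.det σ
        (drawResult (searchRounds m) n (setupProgram.det σ (Memory.initial n m)) s)) := by
  have h0 : (setupProgram.det σ (Memory.initial n m)).nat 0 0 = n := by
    rw [Program.det_nat σ rfl]; rfl
  rw [Program.run, auctionProgram, Program.exec, Program.exec_eq_pure_det σ rfl, PMF.pure_bind,
    Program.exec, exec_drawProgram σ (det_setupProgram σ).1 h0, PMF.bind_map]
  simp only [Function.comp_def, Program.exec_eq_pure_det σ (P := mainProgram) rfl]
  rfl

/-- The program draws `h i` and `r i` bidder by bidder; `seedEquiv` regroups the draws bijectively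
and so preserves uniformity. -/
theorem auctionProgram_implements (n m : ℕ) : auctionProgram.Implements (finalMechanism n m) := by
  intro σ
  have h1 := uniformOfFintype_map_equiv (β := (finalMechanism n m).Seed)
    (seedEquiv (searchRounds m) n)
  rw [run_auctionProgram, PMF.map_comp, ← h1, PMF.map_comp]
  congr 1
  funext s
  exact (det_mainProgram σ (drawn_drawResult σ s)).1

theorem auctionProgram_usesFewQueries (n m : ℕ) : auctionProgram.UsesFewQueries n m := by
  intro σ μ hμ
  rw [run_auctionProgram, PMF.support_map] at hμ
  obtain ⟨s, -, rfl⟩ := hμ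
  have h := (det_mainProgram σ (drawn_drawResult σ s)).2
  refine ⟨h, (Finset.sum_le_sum fun i _ => h i).trans (by simp)⟩

end Implementation

end CombinatorialAuction

open CombinatorialAuction
theorem theorem5p1 :
    (∀ n m : ℕ, (finalMechanism n m).IsFeasible ∧ (finalMechanism n m).IsUniversallyTruthful) ∧
    (∃ P : Program, P.IsPolynomialTime ∧
      ∀ n m : ℕ, P.Implements (finalMechanism n m) ∧ P.UsesFewQueries n m) ∧
    (∃ C : ℝ, 0 < C ∧ ∀ n m : ℕ, 3 ≤ m →
      ∀ v : Fin n → Finset (Fin m) → ℝ≥0, (∀ i, IsValuation (v i)) →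
      ∀ σ : Fin n → Strategy m, (∀ i, (σ i).IsTruthful (v i)) →
        ((∀ i, IsSubadditive (v i)) →
          optimalWelfare v ≤
            C * Real.log (Real.log m) ^ 3 * (finalMechanism n m).expectedWelfare v σ) ∧
        ((∀ i, IsXOS (v i)) →
          optimalWelfare v ≤
            C * Real.log (Real.log m) ^ 2 * (finalMechanism n m).expectedWelfare v σ) ∧
        ((∀ i, IsSubmodular (v i)) →
          optimalWelfare v ≤
            C * Real.log (Real.log m) ^ 2 * (finalMechanism n m).expectedWelfare v σ)) :=
  ⟨fun n m => ⟨finalMechanism_isFeasible n m, finalMechanism_isUniversallyTruthful n m⟩,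
    ⟨auctionProgram, auctionProgram_isPolynomialTime, fun n m =>
      ⟨auctionProgram_implements n m, auctionProgram_usesFewQueries n m⟩⟩,
    exists_approximation_constant⟩
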